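/- **Theorem.** Let $c\in\mathbb R$ and let $N^3(c)$ be a three-dimensional space form, i.e. a simply connected complete smooth Riemannian $3$-manifold of constant sectional curvature $c$. Let $M^2$ be a connected smooth surface and $\psi:M\to N^3(c)$ a smooth immersion with unit normal field $\eta$, shape operator $A$, mean curvature function $f=\operatorname{trace}A$, induced metric $g$ and Gaussian curvature $K$ of $g$. Suppose that $\psi$ is biconservative, i.e. $\operatorname{div}S_2=0$, where $\tau=\operatorname{trace}_g\nabla d\psi$ is the tension field of $\psi$ and $$S_2(X,Y)=\Big(\tfrac12|\tau|^2+\langle d\psi,\nabla\tau\rangle\Big)\langle X,Y\rangle-\langle d\psi(X),\nabla_Y\tau\rangle-\langle d\psi(Y),\nabla_X\tau\rangle ,$$ and suppose that $f(p)>0$ and $(\nabla f)(p)\neq0$ for every $p\in M$. Let $\nabla$ and $\Delta=-\operatorname{trace}\nabla^2$ be the gradient and the Laplacian of $g$. Call a Riemannian metric $h$ on a surface, with Gaussian curvature $K_h$, a *Ricci metric* (with constant $c$) if $c-K_h>0$ and the metric $(c-K_h)^{1/2}h$ is flat. Then $c-K>0$ on $M$, and the following hold. 1. Let $V\subseteq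 M$ be open and $r:V\to\mathbb R$ smooth. The Gaussian curvature $K_r$ of the metric $(c-K)^rg$ on $V$ is $$K_r=(c-K)^{-r}\left(\frac{3-4r}{3}K+\frac12\log(c-K)\,\Delta r+(c-K)^{-1}g(\nabla r,\nabla K)\right),$$ and if $c-K_r>0$ on $V$, then $(V,(c-K)^rg)$ is a Ricci surface (with constant $c$) if and only if $$K+\Delta\left(\frac14\log(c-K_r)+\frac r2\log(c-K)\right)=0\quad\text{on }V.\qquad(*)$$ 2. There is an open dense set $W\subseteq M$ such that every point of $W$ has an open neighbourhood $V\subseteq W$ on which there is a smooth function $r$, with $dr(v)=0$ whenever $df(v)=0$, such that $c-K_r>0$ on $V$, $r$ satisfies $(*)$ on $V$, and $(V,(c-K)^rg)$ is a Ricci surface: the metric $(c-K_r)^{1/2}(c-K)^rg$ is flat. -/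

import Mathlib

open Set Manifold Bundle
open scoped ContDiff Topology

noncomputable section

namespace RiemSurf

/-- The model space `ℝⁿ`. -/
abbrev E (n : ℕ) : Type := EuclideanSpace ℝ (Fin n)

/-- A continuous bilinear form on `ℝⁿ`. -/
abbrev Bil (n : ℕ) : Type := E n →L[ℝ] E n →L[ℝ] ℝ

/-! ### Calculus for a metric `G` given on (an open set of) `ℝⁿ` -/

/-- The `i`-th vector of the standard basis of `ℝⁿ`. -/
def basisVec {n : ℕ} (i : Fin n) : E n := EuclideanSpace.single i (1 : ℝ)

/-- The `i`-th covector of the dual basis of `ℝⁿ`. -/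
def dualVec {n : ℕ} (i : Fin n) : E n →L[ℝ] ℝ := EuclideanSpace.proj i

/-- The trace `∑ gⁱʲ B(eᵢ, eⱼ)` of a bilinear map `B` with respect to an inner product `b`;
here `b.inverse (dualVec i) = ∑ⱼ gⁱʲ eⱼ`. -/
def metricTrace {n : ℕ} {F : Type*} [AddCommMonoid F] (b : Bil n) (B : E n → E n → F) : F :=
  ∑ i, B (basisVec i) (b.inverse (dualVec i))

/-- The Christoffel map `Γ_x(v, w)` of the metric `G`:
`2 G(Γ(v, w), z) = D_v G(w, z) + D_w G(v, z) - D_z G(v, w)`. -/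
def christoffel {n : ℕ} (G : E n → Bil n) (x v w : E n) : E n :=
  (G x).inverse ((1 / 2 : ℝ) •
    (fderiv ℝ G x v w + fderiv ℝ G x w v - ((fderiv ℝ G x).flip v).flip w))

/-- The curvature `R(u, v)w = ∇_u ∇_v w - ∇_v ∇_u w` (constant fields `u, v, w`) of `G`. -/
def curvature {n : ℕ} (G : E n → Bil n) (x u v w : E n) : E n :=
  fderiv ℝ (fun y => christoffel G y v w) x u - fderiv ℝ (fun y => christoffel G y u w) x v
    + christoffel G x u (christoffel G x v w) - christoffel G x v (christoffel G x u w)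

/-- The sectional curvature of the plane spanned by `u, v` at `x`. -/
def coordSectional {n : ℕ} (G : E n → Bil n) (x u v : E n) : ℝ :=
  G x (curvature G x u v v) u / (G x u u * G x v v - G x u v ^ 2)

/-! ### Fields of bilinear forms on manifolds

The chart used at the point `p` is the preferred chart `extChartAt (𝓡 n) p`, the one through which
Mathlib identifies `TangentSpace (𝓡 n) p` with `ℝⁿ`. -/

section Manifold

variable {n : ℕ} {M : Type*} [TopologicalSpace M] [ChartedSpace (E n) M]

variable (n M) in
/-- A field of bilinear forms on the tangent spaces of `M`. -/
abbrev BilField : Type _ :=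
  ∀ p : M, TangentSpace (𝓡 n) p →L[ℝ] TangentSpace (𝓡 n) p →L[ℝ] ℝ

/-- The value at `p` of a field of bilinear forms, in coordinates. -/
def BilField.toBil (g : BilField n M) (p : M) : Bil n := g p

/-- The derivative of the inverse `φ⁻¹` of the chart `φ` at `p`: at the point `x` of `ℝⁿ` it sends
the `i`-th basis vector to the coordinate vector `∂ᵢ`, in the tangent space at `φ⁻¹(x)`
(which in Mathlib is a copy of `ℝⁿ`). -/
def coordFrame (p : M) (x : E n) : E n →L[ℝ] E n :=
  mfderiv 𝓘(ℝ, E n) (𝓡 n) (extChartAt (𝓡 n) p).symm x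

/-- The field `g` read in the chart at `p`. -/
def coordMetric (g : BilField n M) (p : M) (x : E n) : Bil n :=
  (g.toBil ((extChartAt (𝓡 n) p).symm x)).bilinearComp (coordFrame p x) (coordFrame p x)

/-- The gradient of `u` with respect to `g`: `g(grad u, v) = du(v)`. -/
def grad (g : BilField n M) (u : M → ℝ) (p : M) : TangentSpace (𝓡 n) p :=
  (g p).inverse (mvfderiv (𝓡 n) u p)

/-- The Laplacian `Δu = -trace ∇du` of `g` (with the sign that makes it a nonnegative operator),
where `∇du(v, w) = D²u(v, w) - Du(Γ(v, w))` in a chart. -/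
def laplacian (g : BilField n M) (u : M → ℝ) (p : M) : ℝ :=
  let φ := extChartAt (𝓡 n) p
  let uh : E n → ℝ := fun x => u (φ.symm x)
  let x := φ p;
  -metricTrace (coordMetric g p x) (fun v w =>
    fderiv ℝ (fderiv ℝ uh) x v w - fderiv ℝ uh x (christoffel (coordMetric g p) x v w))

/-- The sectional curvature at `p` of the plane spanned by two tangent vectors, which are given by
their components in the chart at `p`. -/
def sectionalCurvature (g : BilField n M) (p : M) (u v : E n) : ℝ :=
  coordSectional (coordMetric g p) (extChartAt (𝓡 n) p p) u v

/-- All sectional curvatures of `g` are equal to `c`. -/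
def HasConstantCurvature (g : BilField n M) (c : ℝ) : Prop :=
  ∀ (p : M) (u v : E n), LinearIndependent ℝ ![u, v] → sectionalCurvature g p u v = c

/-- The divergence `(div S)(z) = trace (∇_· S)(·, z)` at `p` of a field `S` of bilinear forms,
where `(∇_v S)(w, z) = D_v(S(w, z)) - S(Γ(v, w), z) - S(w, Γ(v, z))` in a chart. -/
def divergence (g : BilField n M)
    (S : ∀ p : M, TangentSpace (𝓡 n) p → TangentSpace (𝓡 n) p → ℝ) (p : M) (z : E n) : ℝ :=
  let φ := extChartAt (𝓡 n) p
  let Sh : E n → E n → E n → ℝ := fun x v w => S (φ.symm x) (coordFrame p x v) (coordFrame p x w)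
  let x := φ p
  let Γ := christoffel (coordMetric g p) x
  metricTrace (coordMetric g p x) (fun v w =>
    fderiv ℝ (fun y => Sh y w z) x v - Sh x (Γ v w) z - Sh x w (Γ v z))

end Manifold

/-! ### Surfaces -/

section Surface

variable {M : Type*} [TopologicalSpace M] [ChartedSpace (E 2) M]

/-- The Gaussian curvature of a metric on a surface. -/
def gaussCurvature (g : BilField 2 M) (p : M) : ℝ :=
  sectionalCurvature g p (basisVec 0) (basisVec 1)

/-- The conformal metric `ρ g`. -/
def conformal (ρ : M → ℝ) (g : BilField 2 M) : BilField 2 M := fun p => ρ p • g p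

/-- On the open set `V` the metric `g` satisfies the Ricci condition with constant `c`: its
Gaussian curvature `K` satisfies `c - K > 0`, and the metric `(c - K)^{1/2} g` is flat. -/
def IsRicciSurfaceOn (c : ℝ) (g : BilField 2 M) (V : Set M) : Prop :=
  (∀ p ∈ V, 0 < c - gaussCurvature g p) ∧
    ∀ p ∈ V, gaussCurvature (conformal (fun q => (c - gaussCurvature g q) ^ (1 / 2 : ℝ)) g) p = 0

/-- The metric `g_r = (c - K)^r g`, where `K` is the Gaussian curvature of `g`. -/
def powerMetric (c : ℝ) (g : BilField 2 M) (r : M → ℝ) : BilField 2 M :=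
  conformal (fun p => (c - gaussCurvature g p) ^ r p) g

/-- On `V`, the function `r` satisfies `K + Δ(1/4 log(c - K_r) + r/2 log(c - K)) = 0`, where `K` and
`Δ` are the Gaussian curvature and the Laplacian of `g`, and `K_r` is the Gaussian curvature of
`(c - K)^r g`. -/
def SolvesEquationOn (c : ℝ) (g : BilField 2 M) (r : M → ℝ) (V : Set M) : Prop :=
  ∀ p ∈ V, gaussCurvature g p + laplacian g (fun q =>
    1 / 4 * Real.log (c - gaussCurvature (powerMetric c g r) q)
      + r q / 2 * Real.log (c - gaussCurvature g q)) p = 0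

end Surface

/-! ### The metric of a Riemannian manifold -/

section Ambient

variable {N : Type*} [TopologicalSpace N] [ChartedSpace (E 3) N]
  [RiemannianBundle (fun x : N => TangentSpace (𝓡 3) x)]

variable (N) in
/-- The Riemannian metric of `N` as a field of bilinear forms. -/
def metricField : BilField 3 N := fun x => innerSL ℝ (E := TangentSpace (𝓡 3) x)

end Ambient

/-! ### Immersed surfaces -/

section Immersion

variable {M : Type*} [TopologicalSpace M] [ChartedSpace (E 2) M]
  {N : Type*} [TopologicalSpace N] [ChartedSpace (E 3) N]
  [RiemannianBundle (fun x : N => TangentSpace (𝓡 3) x)]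

/-- The differential of `ψ` at `p`; in Mathlib the tangent spaces at `p` and at `ψ p` are copies of
`ℝ²` and `ℝ³`. -/
def differential (ψ : M → N) (p : M) : E 2 →L[ℝ] E 3 := mfderiv (𝓡 2) (𝓡 3) ψ p

/-- A smooth immersion of a surface. -/
def IsSmoothImmersion (ψ : M → N) : Prop :=
  ContMDiff (𝓡 2) (𝓡 3) ∞ ψ ∧ ∀ p, Function.Injective (differential ψ p)

/-- The metric induced on `M` by `ψ : M → N`. -/
def inducedMetric (ψ : M → N) : BilField 2 M := fun p =>
  ((metricField N).toBil (ψ p)).bilinearComp (differential ψ p) (differential ψ p)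

/-- A vector field along `ψ`. -/
abbrev FieldAlong (ψ : M → N) : Type _ := ∀ p : M, TangentSpace (𝓡 3) (ψ p)

/-- The covariant derivative `∇_v ξ` at `p` of a field `ξ` along `ψ` (pull-back of the Levi-Civita
connection of `N`): `D_v ξ + Γ(dψ(v), ξ)` in the charts at `p` and at `ψ p`. -/
def covDerivAlong {ψ : M → N} (ξ : FieldAlong ψ) (p : M) (v : TangentSpace (𝓡 2) p) :
    TangentSpace (𝓡 3) (ψ p) :=
  let φ := extChartAt (𝓡 2) p
  let ξh : E 2 → E 3 := fun x =>
    mfderiv (𝓡 3) 𝓘(ℝ, E 3) (extChartAt (𝓡 3) (ψ p)) (ψ (φ.symm x)) (ξ (φ.symm x))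
  let ψh : E 2 → E 3 := writtenInExtChartAt (𝓡 2) (𝓡 3) p ψ
  let x : E 2 := φ p
  (fderiv ℝ ξh x v + christoffel (coordMetric (metricField N) (ψ p)) (ψh x)
    (fderiv ℝ ψh x v) (ξh x) : E 3)

/-- The tension field `τ(ψ) = trace ∇dψ`, with
`∇dψ(v, w) = D²ψ(v, w) - Dψ(Γᴹ(v, w)) + Γᴺ(Dψ(v), Dψ(w))` in the charts at `p` and at `ψ p`. -/
def tension (ψ : M → N) : FieldAlong ψ := fun p =>
  let ψh : E 2 → E 3 := writtenInExtChartAt (𝓡 2) (𝓡 3) p ψ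
  let x : E 2 := extChartAt (𝓡 2) p p
  let G := coordMetric (inducedMetric ψ) p
  let H := coordMetric (metricField N) (ψ p)
  (metricTrace (G x) (fun v w => fderiv ℝ (fderiv ℝ ψh) x v w
    - fderiv ℝ ψh x (christoffel G x v w)
    + christoffel H (ψh x) (fderiv ℝ ψh x v) (fderiv ℝ ψh x w)) : E 3)

/-- The stress-energy tensor of the bienergy,
`S₂(X, Y) = (|τ|²/2 + ⟨dψ, ∇τ⟩) ⟨X, Y⟩ - ⟨dψ(X), ∇_Y τ⟩ - ⟨dψ(Y), ∇_X τ⟩`. -/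
def stressBienergy (ψ : M → N) (p : M) (X Y : TangentSpace (𝓡 2) p) : ℝ :=
  let h := metricField N (ψ p)
  let dψ := differential ψ p
  let τ := tension ψ
  let pair : E 2 → E 2 → ℝ := fun v w => h (dψ v) (covDerivAlong τ p w)
  ((1 / 2) * h (τ p) (τ p) + metricTrace ((inducedMetric ψ).toBil p) pair) * inducedMetric ψ p X Y
    - h (dψ X) (covDerivAlong τ p Y) - h (dψ Y) (covDerivAlong τ p X)

/-- The immersed surface `ψ` is biconservative: `div S₂ = 0`. -/
def IsBiconservative (ψ : M → N) : Prop :=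
  ∀ (p : M) (z : E 2), divergence (inducedMetric ψ) (stressBienergy ψ) p z = 0

/-- `η` is a smooth unit normal field of the immersed surface `ψ`. -/
def IsUnitNormal [IsManifold (𝓡 3) ∞ N] (ψ : M → N) (η : FieldAlong ψ) : Prop :=
  ContMDiff (𝓡 2) (𝓡 3).tangent ∞ (fun p => (⟨ψ p, η p⟩ : TangentBundle (𝓡 3) N)) ∧
    ∀ p, metricField N (ψ p) (η p) (η p) = 1 ∧
      ∀ v, metricField N (ψ p) (η p) (differential ψ p v) = 0

/-- The shape operator, `dψ(A X) = -(∇_X η)ᵀ`, i.e. `g(A X, Y) = -⟨∇_X η, dψ(Y)⟩`. -/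
def shapeOperator {ψ : M → N} (η : FieldAlong ψ) (p : M) (X : TangentSpace (𝓡 2) p) :
    TangentSpace (𝓡 2) p :=
  ((inducedMetric ψ).toBil p).inverse
    (-(((metricField N).toBil (ψ p) (covDerivAlong η p X)).comp (differential ψ p)))

/-- The mean curvature function `f = trace A`. -/
def meanCurvature {ψ : M → N} (η : FieldAlong ψ) (p : M) : ℝ :=
  ∑ i : Fin 2, dualVec i (shapeOperator η p (basisVec i))

end Immersion

end RiemSurf

end

open RiemSurf

open Set Manifold Bundle
open scoped ContDiff Topology

noncomputable section

namespace RiemSurf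

set_option synthInstance.maxHeartbeats 200000

/-! ### Shortcut instances -/

/-! Let b be the second fundamental form. Since τ = f η, the stress-energy tensor is S₂ = -(f²/2) g
+ 2 f b. In a space form b is a Codazzi tensor, so the divergence of b is df, and div S₂ = 0 becomes
A(∇f) = -(f/2) ∇f (`secondForm_grad`). The principal curvatures are therefore -f/2 and 3f/2, and the
Gauss equation gives c - K = (3/4) f² > 0.

Let e₁ = ∇f/|∇f| and let e₂ complete it to an orthonormal frame. The Codazzi equation determines the
entries (e₁, e₂) and (e₂, e₂) of the Hessian of f (`BiconsOn.hess_frame`); the Ricci identity for ∇f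
then determines the entry (e₁, e₁) (`BiconsOn.hess_e₁`). Two consequences carry the rest. First, Δ
log f = -(4/3) K, which says that (c - K)^{3/4} g is flat (`BiconsSurface.laplacian_log`). Second,
(9/16)|∇f|² + c f² + (9/4) f⁴ = C f^{7/2} locally (`BiconsOn.fderiv_first_integral`), so that |∇f|²
and Δf are functions of f.

For the first claim, the curvature of e^{2σ} g is e^{-2σ}(K + Δσ) (`gaussK_exp`). With σ = (r/2)
log(c - K), the product rule for Δ gives the formula for K_r; the same formula for the metric (c -
K_r)^{1/2} (c - K)^r g gives the equivalence with (*).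

For the second claim, one looks for (c - K)^r g = e^{2Φ(f)} (c - K)^{3/4} g with c - K_r =
e^{-4Φ(f)}. Then (c - K_r)^{1/2} (c - K)^r g is the flat metric (c - K)^{3/4} g, whatever Φ is. The
prescribed value of K_r means ΔΦ = (c - K)^{3/4} (c e^{2Φ} - e^{-2Φ}), which by the above is a
second order ordinary differential equation in the variable f with leading coefficient |∇f|² ≠ 0,
hence locally solvable. Recovering r requires division by log(c - K), which is possible where c - K
≠ 1. This set is W; it is dense because f is not constant on any nonempty open set.

The local geometry is developed on open sets of ℝⁿ. The notions on manifolds use at each point its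
own preferred chart, so naturality under coordinate changes is needed before anything can be
differentiated; it is the case of equal dimensions of the theory of immersions. -/

instance instNormedAddCommGroupDual {n : ℕ} : NormedAddCommGroup (E n →L[ℝ] ℝ) := inferInstance
instance instNormedSpaceDual {n : ℕ} : NormedSpace ℝ (E n →L[ℝ] ℝ) := inferInstance
instance instNormedAddCommGroupHom {m n : ℕ} : NormedAddCommGroup (E m →L[ℝ] E n) := inferInstance
instance instNormedSpaceHom {m n : ℕ} : NormedSpace ℝ (E m →L[ℝ] E n) := inferInstance
instance instNormedAddCommGroupBil {n : ℕ} : NormedAddCommGroup (Bil n) := inferInstance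
instance instNormedSpaceBil {n : ℕ} : NormedSpace ℝ (Bil n) := inferInstance
instance instNormedAddCommGroupHomHom {m n : ℕ} : NormedAddCommGroup (E m →L[ℝ] E m →L[ℝ] E n) :=
  inferInstance
instance instNormedSpaceHomHom {m n : ℕ} : NormedSpace ℝ (E m →L[ℝ] E m →L[ℝ] E n) := inferInstance

/-! ### Inner products and their inverses -/

/-- A bilinear form which is symmetric and positive definite. -/
structure IsInner {n : ℕ} (b : Bil n) : Prop where
  symm : ∀ v w, b v w = b w v
  pos : ∀ v, v ≠ 0 → 0 < b v v

namespace IsInner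

variable {n : ℕ} {b : Bil n}

theorem eq_zero (h : IsInner b) {v : E n} (hv : b v v = 0) : v = 0 := by
  by_contra h0
  exact (h.pos v h0).ne' hv

theorem ext (h : IsInner b) {v w : E n} (hvw : ∀ z, b v z = b w z) : v = w := by
  have : b (v - w) (v - w) = 0 := by
    rw [map_sub b, _root_.sub_apply, hvw, sub_self]
  exact sub_eq_zero.1 (h.eq_zero this)

/-- `inverse` is zero on maps that are not invertible, so invertibility has to be known before it
means anything. Positivity gives injectivity, and ℝⁿ and its dual have the same dimension. -/
theorem isInvertible (h : IsInner b) : b.IsInvertible := by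
  have hinj : Function.Injective (b : E n →ₗ[ℝ] (E n →L[ℝ] ℝ)) := fun v w hvw =>
    h.ext fun z => by
      have : b v = b w := hvw
      rw [this]
  have hdim : Module.finrank ℝ (E n) = Module.finrank ℝ (E n →L[ℝ] ℝ) := by
    rw [← LinearEquiv.finrank_eq (LinearMap.toContinuousLinearMap (𝕜 := ℝ) (E := E n) (F' := ℝ))]
    exact (Subspace.dual_finrank_eq (K := ℝ) (V := E n)).symm
  refine ⟨(LinearEquiv.ofInjectiveOfFinrankEq _ hinj hdim).toContinuousLinearEquiv, ?_⟩
  ext v w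
  rfl

theorem apply_inverse (h : IsInner b) (α : E n →L[ℝ] ℝ) (v : E n) : b (b.inverse α) v = α v := by
  obtain ⟨e, rfl⟩ := h.isInvertible
  simp

theorem apply_inverse_right (h : IsInner b) (α : E n →L[ℝ] ℝ) (v : E n) :
    b v (b.inverse α) = α v := by
  rw [h.symm, h.apply_inverse]

end IsInner

/-- A smooth Riemannian metric on the open set `U` of `ℝⁿ`. -/
structure MetricOn {n : ℕ} (G : E n → Bil n) (U : Set (E n)) : Prop where
  isOpen : IsOpen U
  smooth : ContDiffOn ℝ ∞ G U
  inner : ∀ x ∈ U, IsInner (G x)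

/-- A smooth map from the open set `U` to the set `U'`. -/
structure MapOn {m n : ℕ} (T : E m → E n) (U : Set (E m)) (U' : Set (E n)) : Prop where
  isOpen : IsOpen U
  smooth : ContDiffOn ℝ ∞ T U
  mapsTo : MapsTo T U U'

section Smooth

variable {F F' : Type*} [NormedAddCommGroup F] [NormedSpace ℝ F] [NormedAddCommGroup F']
  [NormedSpace ℝ F'] {U : Set F} {u : F → F'} {x : F}

theorem smooth_fderiv (hu : ContDiffOn ℝ ∞ u U) (hU : IsOpen U) :
    ContDiffOn ℝ ∞ (fderiv ℝ u) U :=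
  hu.fderiv_of_isOpen hU (by simp)

theorem smooth_diffAt (hu : ContDiffOn ℝ ∞ u U) (hU : IsOpen U) (hx : x ∈ U) :
    DifferentiableAt ℝ u x :=
  (hu.contDiffAt (hU.mem_nhds hx)).differentiableAt (by simp)

theorem smooth_snd_symm (hu : ContDiffOn ℝ ∞ u U) (hU : IsOpen U) (hx : x ∈ U) (v w : F) :
    fderiv ℝ (fderiv ℝ u) x v w = fderiv ℝ (fderiv ℝ u) x w v :=
  (hu.contDiffAt (hU.mem_nhds hx)).isSymmSndFDerivAt 
    (by simpa using WithTop.coe_le_coe.2 (le_top : (2 : ℕ∞) ≤ ⊤)) v w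

theorem fderiv_fderiv_apply (hu : ContDiffOn ℝ ∞ u U) (hU : IsOpen U) (hx : x ∈ U) (v w : F) :
    fderiv ℝ (fun y => fderiv ℝ u y w) x v = fderiv ℝ (fderiv ℝ u) x v w := by
  rw [fderiv_clm_apply (smooth_diffAt (smooth_fderiv hu hU) hU hx) (by fun_prop)]
  simp

theorem fderiv_congr_on {u' : F → F'} (hU : IsOpen U) (hx : x ∈ U) (h : ∀ y ∈ U, u y = u' y) :
    fderiv ℝ u x = fderiv ℝ u' x :=
  Filter.EventuallyEq.fderiv_eq (Filter.eventually_of_mem (hU.mem_nhds hx) h)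

end Smooth

/-! ### The Levi-Civita connection -/

section Connection

variable {n : ℕ} {G : E n → Bil n} {U : Set (E n)} {x : E n}

/-- The Christoffel map as a continuous bilinear map. -/
def chris (G : E n → Bil n) (x : E n) : E n →L[ℝ] E n →L[ℝ] E n :=
  (ContinuousLinearMap.compL ℝ (E n) (E n →L[ℝ] ℝ) (E n) (G x).inverse) ∘L
    ((1 / 2 : ℝ) • (fderiv ℝ G x + (fderiv ℝ G x).flip -
      (ContinuousLinearMap.flipₗᵢ ℝ (E n) (E n) ℝ).toContinuousLinearEquiv.toContinuousLinearMap ∘L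
        (fderiv ℝ G x).flip))

theorem chris_apply (G : E n → Bil n) (x v w : E n) : chris G x v w = christoffel G x v w := by
  simp only [chris, christoffel, ContinuousLinearMap.comp_apply, ContinuousLinearMap.compL_apply,
    _root_.smul_apply]
  rfl

theorem MetricOn.smooth_inverse (hG : MetricOn G U) :
    ContDiffOn ℝ ∞ (fun x => (G x).inverse) U := fun x hx => by
  have := (hG.inner x hx).isInvertible.contDiffAt_map_inverse (n := ∞)
  exact (this.comp x (hG.smooth.contDiffAt (hG.isOpen.mem_nhds hx))).contDiffWithinAt

theorem MetricOn.smooth_chris (hG : MetricOn G U) : ContDiffOn ℝ ∞ (chris G) U := by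
  have hD := smooth_fderiv hG.smooth hG.isOpen
  refine contDiffOn_clm_apply.2 fun v => contDiffOn_clm_apply.2 fun w => ?_
  simp only [chris_apply, christoffel]
  refine hG.smooth_inverse.clm_apply (ContDiffOn.const_smul _ (ContDiffOn.sub ?_ ?_))
  · exact ((hD.clm_apply contDiffOn_const).clm_apply contDiffOn_const).add
      ((hD.clm_apply contDiffOn_const).clm_apply contDiffOn_const)
  · refine contDiffOn_clm_apply.2 fun z => ?_
    simp only [ContinuousLinearMap.flip_apply]
    exact ((hD.clm_apply contDiffOn_const).clm_apply contDiffOn_const).clm_apply contDiffOn_const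

theorem MetricOn.fderiv_symm (hG : MetricOn G U) (hx : x ∈ U) (u v w : E n) :
    fderiv ℝ G x u v w = fderiv ℝ G x u w v := by
  have hd : DifferentiableAt ℝ G x := smooth_diffAt hG.smooth hG.isOpen hx
  have key : ∀ a b, fderiv ℝ (fun y => G y a b) x u = fderiv ℝ G x u a b := fun a b => by
    rw [fderiv_clm_apply (by fun_prop) (by fun_prop), fderiv_clm_apply hd (by fun_prop)]
    simp
  rw [← key, ← key, fderiv_congr_on hG.isOpen hx fun y hy => (hG.inner y hy).symm v w]

theorem MetricOn.koszul (hG : MetricOn G U) (hx : x ∈ U) (v w z : E n) :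
    2 * G x (chris G x v w) z = fderiv ℝ G x v w z + fderiv ℝ G x w v z - fderiv ℝ G x z v w := by
  rw [chris_apply, christoffel, (hG.inner x hx).apply_inverse]
  simp

theorem MetricOn.chris_symm (hG : MetricOn G U) (hx : x ∈ U) (v w : E n) :
    chris G x v w = chris G x w v :=
  (hG.inner x hx).ext fun z => by
    have h1 := hG.koszul hx v w z
    have h2 := hG.koszul hx w v z
    rw [hG.fderiv_symm hx z v w] at h1
    linarith

/-- Compatibility with the metric: in the sum of the Koszul formulas for (u, v; w) and (u, w; v),
four of the six terms cancel. -/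
theorem MetricOn.fderiv_eq (hG : MetricOn G U) (hx : x ∈ U) (u v w : E n) :
    fderiv ℝ G x u v w = G x (chris G x u v) w + G x v (chris G x u w) := by
  have h1 := hG.koszul hx u v w
  have h2 := hG.koszul hx u w v
  rw [(hG.inner x hx).symm v, hG.fderiv_symm hx v u w, hG.fderiv_symm hx w u v] at *
  rw [hG.fderiv_symm hx u w v] at h2
  linarith

end Connection

/-! ### The covariant derivative along a map -/

section Along

variable {m n : ℕ} {H : E n → Bil n} {T : E m → E n} {U : Set (E m)} {U' : Set (E n)}
  {ξ ζ : E m → E n} {x : E m}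

/-- The covariant derivative of a field `ξ` along the map `T` into a space with the metric `H`. -/
def covD (H : E n → Bil n) (T ξ : E m → E n) (x : E m) : E m →L[ℝ] E n :=
  fderiv ℝ ξ x + ((chris H (T x)).flip (ξ x)) ∘L fderiv ℝ T x

theorem covD_apply (H : E n → Bil n) (T ξ : E m → E n) (x v : E m) :
    covD H T ξ x v = fderiv ℝ ξ x v + chris H (T x) (fderiv ℝ T x v) (ξ x) := by
  simp [covD]

theorem covD_congr {ξ' : E m → E n} (hU : IsOpen U) (hx : x ∈ U) (h : ∀ y ∈ U, ξ y = ξ' y) :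
    covD H T ξ x = covD H T ξ' x := by
  rw [covD, covD, fderiv_congr_on hU hx h, h x hx]

theorem covD_id {G : E n → Bil n} (ξ : E n → E n) (x v : E n) :
    covD G id ξ x v = fderiv ℝ ξ x v + chris G x v (ξ x) := by
  simp [covD_apply]

theorem covD_add (hξ : DifferentiableAt ℝ ξ x) (hζ : DifferentiableAt ℝ ζ x) :
    covD H T (fun y => ξ y + ζ y) x = covD H T ξ x + covD H T ζ x := by
  ext1 v
  simp only [covD_apply, _root_.add_apply, fderiv_fun_add hξ hζ, map_add]
  abel

theorem covD_smul {a : E m → ℝ} (ha : DifferentiableAt ℝ a x) (hξ : DifferentiableAt ℝ ξ x)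
    (v : E m) :
    covD H T (fun y => a y • ξ y) x v = fderiv ℝ a x v • ξ x + a x • covD H T ξ x v := by
  simp only [covD_apply, fderiv_fun_smul ha hξ, map_smul, _root_.add_apply,
    _root_.smul_apply, ContinuousLinearMap.smulRight_apply, smul_add]
  abel

variable (hH : MetricOn H U') (hT : MapOn T U U')

include hH hT

theorem smooth_covD (hξ : ContDiffOn ℝ ∞ ξ U) : ContDiffOn ℝ ∞ (covD H T ξ) U := by
  refine contDiffOn_clm_apply.2 fun v => ?_
  simp only [covD_apply]
  have h1 := smooth_fderiv hξ hT.isOpen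
  have h2 := smooth_fderiv hT.smooth hT.isOpen
  have h3 := hH.smooth_chris.comp hT.smooth hT.mapsTo
  exact (h1.clm_apply contDiffOn_const).add
    ((h3.clm_apply (h2.clm_apply contDiffOn_const)).clm_apply hξ)

theorem smooth_metric_along (hξ : ContDiffOn ℝ ∞ ξ U) (hζ : ContDiffOn ℝ ∞ ζ U) :
    ContDiffOn ℝ ∞ (fun y => H (T y) (ξ y) (ζ y)) U :=
  ((hH.smooth.comp hT.smooth hT.mapsTo).clm_apply hξ).clm_apply hζ

/-- The covariant derivative is compatible with the metric. -/
theorem fderiv_metric_along (hx : x ∈ U) (hξ : ContDiffOn ℝ ∞ ξ U) (hζ : ContDiffOn ℝ ∞ ζ U)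
    (v : E m) :
    fderiv ℝ (fun y => H (T y) (ξ y) (ζ y)) x v
      = H (T x) (covD H T ξ x v) (ζ x) + H (T x) (ξ x) (covD H T ζ x v) := by
  have dξ := smooth_diffAt hξ hT.isOpen hx
  have dζ := smooth_diffAt hζ hT.isOpen hx
  have dT := smooth_diffAt hT.smooth hT.isOpen hx
  have dH := smooth_diffAt hH.smooth hH.isOpen (hT.mapsTo hx)
  have dHT : DifferentiableAt ℝ (fun y => H (T y)) x := dH.comp x dT
  rw [fderiv_clm_apply (dHT.clm_apply dξ) dζ, fderiv_clm_apply dHT dξ]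
  have : fderiv ℝ (fun y => H (T y)) x = fderiv ℝ H (T x) ∘L fderiv ℝ T x :=
    fderiv_comp x dH dT
  simp only [this, covD_apply, _root_.add_apply, ContinuousLinearMap.comp_apply,
    ContinuousLinearMap.flip_apply, map_add, hH.fderiv_eq (hT.mapsTo hx)]
  ring

/-- Vanishing torsion along `T`: both the second derivative of `T` and the Christoffel map are
symmetric. -/
theorem covD_fderiv_symm (hx : x ∈ U) (v w : E m) :
    covD H T (fun y => fderiv ℝ T y w) x v = covD H T (fun y => fderiv ℝ T y v) x w := by
  rw [covD_apply, covD_apply, fderiv_fderiv_apply hT.smooth hT.isOpen hx,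
    fderiv_fderiv_apply hT.smooth hT.isOpen hx, smooth_snd_symm hT.smooth hT.isOpen hx,
    hH.chris_symm (hT.mapsTo hx)]

end Along

theorem curvature_eq {n : ℕ} {G : E n → Bil n} {U : Set (E n)} (hG : MetricOn G U) {x : E n}
    (hx : x ∈ U) (u v w : E n) :
    curvature G x u v w = fderiv ℝ (chris G) x u v w - fderiv ℝ (chris G) x v u w
      + chris G x u (chris G x v w) - chris G x v (chris G x u w) := by
  have hd : DifferentiableAt ℝ (chris G) x := smooth_diffAt hG.smooth_chris hG.isOpen hx
  have key : ∀ a b c, fderiv ℝ (fun y => chris G y a b) x c = fderiv ℝ (chris G) x c a b :=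
    fun a b c => by
      rw [fderiv_clm_apply (by fun_prop) (by fun_prop), fderiv_clm_apply hd (by fun_prop)]
      simp
  simp only [curvature, ← chris_apply, key]

/-! ### Commuting covariant derivatives along a map -/

section Commutation

variable {m n : ℕ} {H : E n → Bil n} {T : E m → E n} {U : Set (E m)} {U' : Set (E n)}
  {ξ : E m → E n} {x : E m}

/-- The commutator of covariant derivatives is given by the curvature. -/
theorem covD_comm (hH : MetricOn H U') (hT : MapOn T U U') (hx : x ∈ U)
    (hξ : ContDiffOn ℝ ∞ ξ U) (u v : E m) :
    covD H T (fun y => covD H T ξ y v) x u - covD H T (fun y => covD H T ξ y u) x v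
      = curvature H (T x) (fderiv ℝ T x u) (fderiv ℝ T x v) (ξ x) := by
  have dξ := smooth_diffAt hξ hT.isOpen hx
  have dξ' := smooth_diffAt (smooth_fderiv hξ hT.isOpen) hT.isOpen hx
  have dT := smooth_diffAt hT.smooth hT.isOpen hx
  have dT' := smooth_diffAt (smooth_fderiv hT.smooth hT.isOpen) hT.isOpen hx
  have dΓ := smooth_diffAt hH.smooth_chris hH.isOpen (hT.mapsTo hx)
  have dΓT : DifferentiableAt ℝ (fun y => chris H (T y)) x := dΓ.comp x dT
  have hΓT : fderiv ℝ (fun y => chris H (T y)) x = fderiv ℝ (chris H) (T x) ∘L fderiv ℝ T x :=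
    fderiv_comp x dΓ dT
  -- The full expansion of ∇_b ∇_a ξ. Antisymmetrizing in a and b removes the second derivatives of
  -- ξ and of `T` and the mixed first order terms; what remains is the curvature.
  have key : ∀ a b : E m, covD H T (fun y => covD H T ξ y a) x b =
      fderiv ℝ (fderiv ℝ ξ) x b a
      + (fderiv ℝ (chris H) (T x) (fderiv ℝ T x b) (fderiv ℝ T x a) (ξ x)
        + chris H (T x) (fderiv ℝ (fderiv ℝ T) x b a) (ξ x)
        + chris H (T x) (fderiv ℝ T x a) (fderiv ℝ ξ x b))
      + chris H (T x) (fderiv ℝ T x b) (fderiv ℝ ξ x a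
          + chris H (T x) (fderiv ℝ T x a) (ξ x)) := by
    intro a b
    rw [covD_apply, covD_apply]
    simp only [covD_apply]
    have d1 : DifferentiableAt ℝ (fun y => fderiv ℝ T y a) x := dT'.clm_apply (by fun_prop)
    rw [fderiv_fun_add (dξ'.clm_apply (by fun_prop)) ((dΓT.clm_apply d1).clm_apply dξ),
      fderiv_clm_apply (dΓT.clm_apply d1) dξ, fderiv_clm_apply dΓT d1]
    simp only [_root_.add_apply, fderiv_fderiv_apply hξ hT.isOpen hx,
      ContinuousLinearMap.comp_apply, ContinuousLinearMap.flip_apply, hΓT,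
      fderiv_fderiv_apply hT.smooth hT.isOpen hx]
    abel
  rw [key, key, curvature_eq hH (hT.mapsTo hx), smooth_snd_symm hξ hT.isOpen hx u v,
    smooth_snd_symm hT.smooth hT.isOpen hx u v]
  simp only [map_add]
  abel

end Commutation

/-! ### Symmetries of the curvature -/

section CurvatureSymm

variable {n : ℕ} {G : E n → Bil n} {U : Set (E n)} {x : E n}

theorem mapOn_id (hU : IsOpen U) : MapOn (id : E n → E n) U U :=
  ⟨hU, contDiffOn_id, mapsTo_id U⟩

/-- The covariant derivative of a constant field w is Γ(·, w), so the curvature is a commutator of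
covariant derivatives along the identity map. In this form it can be compared with other
connections. -/
theorem curvature_eq_covD (G : E n → Bil n) (x u v w : E n) :
    curvature G x u v w = covD G id (fun y => chris G y v w) x u
      - covD G id (fun y => chris G y u w) x v := by
  simp only [curvature, covD_id, ← chris_apply]
  abel

/-- The curvature operator `R(u, v)` as a continuous linear map. -/
def curvL (G : E n → Bil n) (x u v : E n) : E n →L[ℝ] E n :=
  fderiv ℝ (chris G) x u v - fderiv ℝ (chris G) x v u
    + (chris G x u) ∘L (chris G x v) - (chris G x v) ∘L (chris G x u)

theorem curvature_eq_curvL (hG : MetricOn G U) (hx : x ∈ U) (u v w : E n) :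
    curvature G x u v w = curvL G x u v w := by
  rw [curvature_eq hG hx]
  simp [curvL]

theorem curvL_swap (u v : E n) : curvL G x v u = -curvL G x u v := by
  simp only [curvL]
  abel

theorem curvL_add (u u' v : E n) : curvL G x (u + u') v = curvL G x u v + curvL G x u' v := by
  ext1 w
  simp only [curvL, map_add, _root_.add_apply, _root_.sub_apply, ContinuousLinearMap.comp_apply]
  abel

theorem curvL_smul (a : ℝ) (u v : E n) : curvL G x (a • u) v = a • curvL G x u v := by
  ext1 w
  simp only [curvL, map_smul, _root_.smul_apply, _root_.add_apply, _root_.sub_apply,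
    ContinuousLinearMap.comp_apply, smul_add, smul_sub]

theorem curvL_add_right (u v v' : E n) :
    curvL G x u (v + v') = curvL G x u v + curvL G x u v' := by
  rw [curvL_swap, curvL_add, neg_add, ← curvL_swap, ← curvL_swap]

theorem curvL_smul_right (a : ℝ) (u v : E n) : curvL G x u (a • v) = a • curvL G x u v := by
  rw [curvL_swap, curvL_smul, ← smul_neg, ← curvL_swap]

theorem curvL_self (u : E n) : curvL G x u u = 0 := by
  simp [curvL]

theorem smooth_curvL (hG : MetricOn G U) (u v w : E n) :
    ContDiffOn ℝ ∞ (fun x => curvL G x u v w) U := by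
  have h1 := hG.smooth_chris
  have h2 := smooth_fderiv h1 hG.isOpen
  have hΓ : ∀ {ξ : E n → E n} (a : E n), ContDiffOn ℝ ∞ ξ U →
      ContDiffOn ℝ ∞ (fun x => chris G x a (ξ x)) U := fun a hξ =>
    (h1.clm_apply contDiffOn_const).clm_apply hξ
  have hD : ∀ a b : E n, ContDiffOn ℝ ∞ (fun x => fderiv ℝ (chris G) x a b w) U := fun a b =>
    ((h2.clm_apply contDiffOn_const).clm_apply contDiffOn_const).clm_apply contDiffOn_const
  simp only [curvL, _root_.add_apply, _root_.sub_apply, ContinuousLinearMap.comp_apply]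
  exact (((hD u v).sub (hD v u)).add (hΓ u (hΓ v contDiffOn_const))).sub
    (hΓ v (hΓ u contDiffOn_const))

/-- Everything follows from the symmetry of Γ: it passes to the derivative of Γ, so the derivative
terms cancel in pairs, and so do the quadratic terms. -/
theorem bianchi (hG : MetricOn G U) (hx : x ∈ U) (u v w : E n) :
    curvL G x u v w + curvL G x v w u + curvL G x w u v = 0 := by
  have hd : DifferentiableAt ℝ (chris G) x := smooth_diffAt hG.smooth_chris hG.isOpen hx
  have key : ∀ a b c, fderiv ℝ (fun y => chris G y a b) x c = fderiv ℝ (chris G) x c a b :=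
    fun a b c => by
      rw [fderiv_clm_apply (by fun_prop) (by fun_prop), fderiv_clm_apply hd (by fun_prop)]
      simp
  have hs : ∀ a b c, fderiv ℝ (chris G) x c a b = fderiv ℝ (chris G) x c b a := fun a b c => by
    rw [← key, ← key, fderiv_congr_on hG.isOpen hx fun y hy => hG.chris_symm hy a b]
  simp only [curvL, _root_.add_apply, _root_.sub_apply, ContinuousLinearMap.comp_apply]
  rw [hs w u v, hs v u w, hs w v u, hG.chris_symm hx w u, hG.chris_symm hx w v,
    hG.chris_symm hx v u]
  abel

/-- The second derivatives of the function G(w, z) commute. Expanding both orders by compatibility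
with the metric, the difference is G(R(u, v)w, z) + G(w, R(u, v)z). -/
theorem curvL_skew (hG : MetricOn G U) (hx : x ∈ U) (u v w z : E n) :
    G x (curvL G x u v w) z = -G x (curvL G x u v z) w := by
  have hid := mapOn_id hG.isOpen
  have hΓ : ∀ a b : E n, ContDiffOn ℝ ∞ (fun y => chris G y a b) U := fun a b =>
    (hG.smooth_chris.clm_apply contDiffOn_const).clm_apply contDiffOn_const
  have hs : ContDiffOn ℝ ∞ (fun y => G y w z) U :=
    smooth_metric_along (ξ := fun _ => w) (ζ := fun _ => z) hG hid contDiffOn_const contDiffOn_const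
  have h1 : ∀ a, ∀ y ∈ U, fderiv ℝ (fun y => G y w z) y a
      = G y (chris G y a w) z + G y w (chris G y a z) := fun a y hy => by
    have := fderiv_metric_along (ξ := fun _ => w) (ζ := fun _ => z) hG hid hy contDiffOn_const
      contDiffOn_const a
    simpa [covD_id] using this
  have h2 : ∀ a b, fderiv ℝ (fderiv ℝ (fun y => G y w z)) x b a
      = G x (covD G id (fun y => chris G y a w) x b) z + G x (chris G x a w) (chris G x b z)
        + (G x (chris G x b w) (chris G x a z)
          + G x w (covD G id (fun y => chris G y a z) x b)) := fun a b => by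
    rw [← fderiv_fderiv_apply hs hG.isOpen hx, fderiv_congr_on hG.isOpen hx (h1 a)]
    have e1 := fderiv_metric_along (ζ := fun _ => z) hG hid hx (hΓ a w) contDiffOn_const b
    have e2 := fderiv_metric_along (ξ := fun _ => w) hG hid hx contDiffOn_const (hΓ a z) b
    have d1 := smooth_diffAt (smooth_metric_along (ζ := fun _ => z) hG hid (hΓ a w)
      contDiffOn_const) hG.isOpen hx
    have d2 := smooth_diffAt (smooth_metric_along (ξ := fun _ => w) hG hid contDiffOn_const
      (hΓ a z)) hG.isOpen hx
    simp only [id] at e1 e2 d1 d2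
    rw [fderiv_fun_add d1 d2, _root_.add_apply, e1, e2]
    simp [covD_id]
  have h3 := smooth_snd_symm hs hG.isOpen hx u v
  rw [h2, h2] at h3
  rw [← curvature_eq_curvL hG hx, ← curvature_eq_curvL hG hx, curvature_eq_covD, curvature_eq_covD,
    map_sub, map_sub, _root_.sub_apply, _root_.sub_apply]
  have s := (hG.inner x hx).symm
  rw [s w, s w] at h3
  linarith

/-- A curvature tensor with constant sectional curvature. -/
theorem curvL_of_const (hG : MetricOn G U) (hx : x ∈ U) {c : ℝ}
    (hc : ∀ u v, G x (curvL G x u v v) u = c * (G x u u * G x v v - G x u v ^ 2)) (u v w z : E n) :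
    G x (curvL G x u v w) z = c * (G x v w * G x u z - G x u w * G x v z) := by
  have sG := (hG.inner x hx).symm
  -- Q is the deviation from the model tensor of curvature c. It inherits the symmetries of a
  -- curvature tensor and vanishes on all (u, v, v, u); polarization shows that such a tensor is
  -- zero.
  set Q : E n → E n → E n → E n → ℝ := fun u v w z =>
    G x (curvL G x u v w) z - c * (G x v w * G x u z - G x u w * G x v z) with hQ
  have a1 : ∀ u v w z, Q u v w z = -Q v u w z := fun u v w z => by
    simp only [hQ]; rw [curvL_swap]; simp; ring
  have a2 : ∀ u v w z, Q u v w z = -Q u v z w := fun u v w z => by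
    simp only [hQ]; rw [curvL_skew hG hx]; ring
  have a3 : ∀ u v w z, Q u v w z + Q v w u z + Q w u v z = 0 := fun u v w z => by
    have := congrArg (fun t => G x t z) (bianchi hG hx u v w)
    simp only [map_add, _root_.add_apply, map_zero, _root_.zero_apply] at this
    simp only [hQ]
    rw [sG w v, sG u w, sG u v] at *
    linear_combination this
  -- Pair symmetry, from the Bianchi identity for the four cyclic shifts of (u, v, w, z) together
  -- with both skew-symmetries.
  have a4 : ∀ u v w z, Q u v w z = Q w z u v := fun u v w z => by
    have := a3 u v w z
    have := a3 v w z u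
    have := a3 w z u v
    have := a3 z u v w
    have := a1 u v w z; have := a2 u v w z; have := a1 v w u z; have := a2 v w u z
    have := a1 w u v z; have := a2 w u v z; have := a1 v w z u; have := a1 w z v u
    have := a2 w z u v; have := a1 z v w u; have := a2 z v w u; have := a1 w z u v
    have := a1 z u w v; have := a2 z u w v; have := a1 u w z v; have := a2 u w z v
    have := a1 z u v w; have := a1 u v z w; have := a1 v z u w; have := a2 v z u w
    have := a2 w z v u; have := a2 u v z w; have := a2 z u v w; have := a2 v w z u
    linarith
  have b0 : ∀ u v, Q u v v u = 0 := fun u v => by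
    simp only [hQ]; rw [hc, sG v u]; ring
  have add2 : ∀ u v v' w z, Q u (v + v') w z = Q u v w z + Q u v' w z := fun u v v' w z => by
    simp only [hQ, curvL_add_right, _root_.add_apply, map_add]; ring
  have add3 : ∀ u v w w' z, Q u v (w + w') z = Q u v w z + Q u v w' z := fun u v w w' z => by
    simp only [hQ, _root_.add_apply, map_add]; ring
  have b1 : ∀ u v w, Q u v w u = 0 := fun u v w => by
    have h := b0 u (v + w)
    rw [add2, add3, add3, b0, b0] at h
    have h4 := a4 u w v u
    have := a1 v u u w; have := a2 u v u w
    linarith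
  have b2 : ∀ u v w z, Q u v w z = -Q z v w u := fun u v w z => by
    have h := b1 (u + z) v w
    have e : Q (u + z) v w (u + z) = Q u v w u + Q u v w z + (Q z v w u + Q z v w z) := by
      simp only [hQ, curvL_add, _root_.add_apply, map_add]; ring
    rw [e, b1, b1] at h
    linarith
  -- Skew-symmetry in the outer arguments makes the three terms of the Bianchi identity equal, so 3Q
  -- = 0.
  have : Q u v w z = 0 := by
    have h := a3 u v w z
    have c1 : Q v w u z = Q u v w z := by
      have := b2 v w u z; have := a4 z w u v; have := a1 u v z w; have := a2 u v w z
      linarith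
    have c2 : Q w u v z = Q u v w z := by
      have := a1 w u v z; have := b2 u w v z; have := a4 z w v u
      have := a1 v u z w; have := a2 u v z w
      linarith
    linarith
  simp only [hQ] at this
  linarith

end CurvatureSymm

/-! ### The induced metric and the second fundamental form -/

section Immersion

variable {m n : ℕ} {H : E n → Bil n} {T : E m → E n} {U : Set (E m)} {U' : Set (E n)} {x : E m}

/-- A smooth immersion from the open set `U` to the set `U'`. -/
structure ImmOn (T : E m → E n) (U : Set (E m)) (U' : Set (E n)) : Prop extends MapOn T U U' where
  inj : ∀ x ∈ U, Function.Injective (fderiv ℝ T x)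

/-- The metric induced by the map `T` from the metric `H`. -/
def pull (H : E n → Bil n) (T : E m → E n) (y : E m) : Bil m :=
  (H (T y)).bilinearComp (fderiv ℝ T y) (fderiv ℝ T y)

theorem pull_apply (H : E n → Bil n) (T : E m → E n) (y v w : E m) :
    pull H T y v w = H (T y) (fderiv ℝ T y v) (fderiv ℝ T y w) := rfl

/-- The second fundamental form of the map `T`. -/
def sff (H : E n → Bil n) (T : E m → E n) (x v w : E m) : E n :=
  covD H T (fun y => fderiv ℝ T y w) x v - fderiv ℝ T x (chris (pull H T) x v w)

theorem smooth_fderiv_apply (hT : MapOn T U U') {ζ : E m → E m} (hζ : ContDiffOn ℝ ∞ ζ U) :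
    ContDiffOn ℝ ∞ (fun y => fderiv ℝ T y (ζ y)) U :=
  (smooth_fderiv hT.smooth hT.isOpen).clm_apply hζ

variable (hH : MetricOn H U') (hT : ImmOn T U U')

include hH hT

theorem metricOn_pull : MetricOn (pull H T) U where
  isOpen := hT.isOpen
  smooth := by
    refine contDiffOn_clm_apply.2 fun v => contDiffOn_clm_apply.2 fun w => ?_
    change ContDiffOn ℝ ∞ (fun y => H (T y) (fderiv ℝ T y v) (fderiv ℝ T y w)) U
    exact smooth_metric_along hH hT.toMapOn (smooth_fderiv_apply hT.toMapOn contDiffOn_const)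
      (smooth_fderiv_apply hT.toMapOn contDiffOn_const)
  inner x hx :=
    have h := hH.inner _ (hT.mapsTo hx)
    ⟨fun v w => h.symm _ _, fun v hv => h.pos _ fun h0 => hv (hT.inj x hx (by simpa using h0))⟩

/-- The Levi-Civita connection of the induced metric is the tangential part of the ambient one.
Indeed the Koszul formula for `pull H T`, with its derivatives expanded by compatibility and the
mixed terms cancelled by vanishing torsion, computes the tangential part of ∇_v dT(w). -/
theorem sff_tangent (hx : x ∈ U) (v w z : E m) :
    H (T x) (sff H T x v w) (fderiv ℝ T x z) = 0 := by
  have hG := metricOn_pull hH hT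
  have sH := (hH.inner _ (hT.mapsTo hx)).symm
  have hc : ∀ a : E m, ContDiffOn ℝ ∞ (fun y => fderiv ℝ T y a) U := fun a =>
    smooth_fderiv_apply hT.toMapOn contDiffOn_const
  have hD : ∀ a b d, fderiv ℝ (pull H T) x a b d
      = H (T x) (covD H T (fun y => fderiv ℝ T y b) x a) (fderiv ℝ T x d)
        + H (T x) (fderiv ℝ T x b) (covD H T (fun y => fderiv ℝ T y d) x a) := fun a b d => by
    rw [← fderiv_metric_along hH hT.toMapOn hx (hc b) (hc d)]
    have hd := smooth_diffAt hG.smooth hG.isOpen hx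
    change _ = fderiv ℝ (fun y => pull H T y b d) x a
    rw [fderiv_clm_apply (by fun_prop) (by fun_prop), fderiv_clm_apply hd (by fun_prop)]
    simp
  have hk := hG.koszul hx v w z
  rw [hD, hD, hD, covD_fderiv_symm hH hT.toMapOn hx w v, covD_fderiv_symm hH hT.toMapOn hx z v,
    covD_fderiv_symm hH hT.toMapOn hx z w, sH (fderiv ℝ T x w), sH (fderiv ℝ T x v)] at hk
  rw [sff, map_sub, _root_.sub_apply, ← pull_apply]
  linarith

-- The Gauss formula for tangent fields that are not constant: the derivative of ζ contributes only
-- to the tangential part.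
omit hH in
theorem covD_fderiv (hx : x ∈ U) {ζ : E m → E m} (hζ : ContDiffOn ℝ ∞ ζ U) (v : E m) :
    covD H T (fun y => fderiv ℝ T y (ζ y)) x v
      = fderiv ℝ T x (covD (pull H T) id ζ x v) + sff H T x v (ζ x) := by
  have d1 := smooth_diffAt (smooth_fderiv hT.smooth hT.isOpen) hT.isOpen hx
  have d2 := smooth_diffAt hζ hT.isOpen hx
  rw [sff, covD_id, covD_apply, covD_apply, fderiv_clm_apply d1 d2,
    fderiv_fderiv_apply hT.smooth hT.isOpen hx, map_add]
  simp only [_root_.add_apply, ContinuousLinearMap.comp_apply, ContinuousLinearMap.flip_apply]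
  abel

theorem smooth_sff (v w : E m) : ContDiffOn ℝ ∞ (fun y => sff H T y v w) U := by
  have hG := metricOn_pull hH hT
  refine ContDiffOn.sub ?_ ?_
  · exact (smooth_covD hH hT.toMapOn (smooth_fderiv_apply hT.toMapOn
      contDiffOn_const)).clm_apply contDiffOn_const
  · exact smooth_fderiv_apply hT.toMapOn
      ((hG.smooth_chris.clm_apply contDiffOn_const).clm_apply contDiffOn_const)

/-- This comes from differentiating ⟨sff(v, w), dT(z)⟩ = 0 and applying the Gauss formula to dT(z).
-/
theorem covD_sff_tangent (hx : x ∈ U) (u v w z : E m) :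
    H (T x) (covD H T (fun y => sff H T y v w) x u) (fderiv ℝ T x z)
      = -H (T x) (sff H T x v w) (sff H T x u z) := by
  have h := fderiv_metric_along hH hT.toMapOn hx (smooth_sff hH hT v w)
    (smooth_fderiv_apply hT.toMapOn (contDiffOn_const (c := z))) u
  rw [fderiv_congr_on hT.isOpen hx fun y hy => sff_tangent hH hT hy v w z,
    covD_fderiv hT hx contDiffOn_const, map_add, sff_tangent hH hT hx] at h
  simp only [fderiv_fun_const, Pi.zero_apply, _root_.zero_apply] at h
  linarith

/-- The Gauss equation. -/
theorem gauss_equation (hx : x ∈ U) (u v w z : E m) :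
    H (T x) (curvature H (T x) (fderiv ℝ T x u) (fderiv ℝ T x v) (fderiv ℝ T x w)) (fderiv ℝ T x z)
      = pull H T x (curvature (pull H T) x u v w) z
        - H (T x) (sff H T x v w) (sff H T x u z) + H (T x) (sff H T x u w) (sff H T x v z) := by
  have hG := metricOn_pull hH hT
  have hΓ : ∀ a : E m, ContDiffOn ℝ ∞ (fun y => chris (pull H T) y a w) U := fun a =>
    (hG.smooth_chris.clm_apply contDiffOn_const).clm_apply contDiffOn_const
  have key : ∀ a b, H (T x) (covD H T (fun y => covD H T (fun y => fderiv ℝ T y w) y a) x b)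
      (fderiv ℝ T x z) = pull H T x (covD (pull H T) id (fun y => chris (pull H T) y a w) x b) z
        - H (T x) (sff H T x a w) (sff H T x b z) := fun a b => by
    -- The split into tangential and normal part holds on all of `U`, so it may be differentiated
    -- once more.
    have e : ∀ y ∈ U, covD H T (fun y => fderiv ℝ T y w) y a
        = fderiv ℝ T y (chris (pull H T) y a w) + sff H T y a w := fun y hy => by
      rw [sff]; abel
    rw [covD_congr hT.isOpen hx e, covD_add
      (smooth_diffAt (smooth_fderiv_apply hT.toMapOn (hΓ a)) hT.isOpen hx)
      (smooth_diffAt (smooth_sff hH hT a w) hT.isOpen hx), _root_.add_apply,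
      covD_fderiv hT hx (hΓ a), map_add, map_add, _root_.add_apply, _root_.add_apply,
      sff_tangent hH hT hx, covD_sff_tangent hH hT hx, pull_apply]
    ring
  rw [← covD_comm hH hT.toMapOn hx (smooth_fderiv_apply hT.toMapOn contDiffOn_const), map_sub,
    _root_.sub_apply, key, key, curvature_eq_covD, map_sub, _root_.sub_apply]
  ring

end Immersion

/-! ### Immersions between spaces of equal dimension: local isometries -/

section Isometry

variable {n : ℕ} {H : E n → Bil n} {T : E n → E n} {U U' : Set (E n)} {x : E n}

variable (hH : MetricOn H U') (hT : ImmOn T U U')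

include hT in
theorem ImmOn.surj (hx : x ∈ U) : Function.Surjective (fderiv ℝ T x) :=
  LinearMap.surjective_of_injective (f := (fderiv ℝ T x : E n →ₗ[ℝ] E n)) (hT.inj x hx)

include hH hT

/-- In equal dimensions every vector is tangent, so the second fundamental form, being normal, is
orthogonal to itself. -/
theorem sff_eq_zero (hx : x ∈ U) (v w : E n) : sff H T x v w = 0 := by
  obtain ⟨z, hz⟩ := hT.surj hx (sff H T x v w)
  refine (hH.inner _ (hT.mapsTo hx)).eq_zero ?_
  nth_rewrite 2 [← hz]
  exact sff_tangent hH hT hx v w z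

/-- Naturality of the Levi-Civita connection under local isometries. -/
theorem fderiv_chris (hx : x ∈ U) (v w : E n) :
    fderiv ℝ T x (chris (pull H T) x v w)
      = fderiv ℝ (fderiv ℝ T) x v w + chris H (T x) (fderiv ℝ T x v) (fderiv ℝ T x w) := by
  have h := sff_eq_zero hH hT hx v w
  rw [sff, covD_apply, fderiv_fderiv_apply hT.smooth hT.isOpen hx, sub_eq_zero] at h
  exact h.symm

/-- Naturality of the curvature under local isometries. -/
theorem curvature_pull (hx : x ∈ U) (u v w z : E n) :
    H (T x) (curvature H (T x) (fderiv ℝ T x u) (fderiv ℝ T x v) (fderiv ℝ T x w)) (fderiv ℝ T x z)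
      = pull H T x (curvature (pull H T) x u v w) z := by
  rw [gauss_equation hH hT hx, sff_eq_zero hH hT hx v w, sff_eq_zero hH hT hx u w]
  simp

theorem coordSectional_pull (hx : x ∈ U) (u v : E n) :
    coordSectional (pull H T) x u v
      = coordSectional H (T x) (fderiv ℝ T x u) (fderiv ℝ T x v) := by
  rw [coordSectional, coordSectional, curvature_pull hH hT hx]
  rfl

end Isometry

/-! ### Traces -/

section Trace

variable {n : ℕ}

/-- The trace of an endomorphism of `ℝⁿ`. -/
def trL (L : E n →L[ℝ] E n) : ℝ := ∑ i, dualVec i (L (basisVec i))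

theorem sum_dualVec_smul (x : E n) : ∑ i, dualVec i x • basisVec i = x := by
  ext j
  simp [dualVec, basisVec, Finset.sum_apply, Pi.single_apply]

theorem trL_eq (L : E n →L[ℝ] E n) : trL L = LinearMap.trace ℝ (E n) (L : E n →ₗ[ℝ] E n) := by
  rw [LinearMap.trace_eq_matrix_trace ℝ (EuclideanSpace.basisFun (Fin n) ℝ).toBasis,
    Matrix.trace, trL]
  refine Finset.sum_congr rfl fun i _ => ?_
  simp [LinearMap.toMatrix_apply, dualVec, basisVec]

theorem trL_comm (A B : E n →L[ℝ] E n) : trL (A ∘L B) = trL (B ∘L A) := by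
  rw [trL_eq, trL_eq]
  exact LinearMap.trace_mul_comm ℝ (A : E n →ₗ[ℝ] E n) (B : E n →ₗ[ℝ] E n)

theorem trL_add (A B : E n →L[ℝ] E n) : trL (A + B) = trL A + trL B := by
  simp [trL, Finset.sum_add_distrib]

theorem trL_sub (A B : E n →L[ℝ] E n) : trL (A - B) = trL A - trL B := by
  simp [trL, Finset.sum_sub_distrib]

/-- The metric trace is the trace of the endomorphism obtained by raising an index, hence
independent of the basis. -/
theorem metricTrace_eq {b : Bil n} (h : IsInner b) (B : Bil n) :
    metricTrace b (fun v w => B v w) = trL (b.inverse ∘L B) := by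
  refine Finset.sum_congr rfl fun i _ => ?_
  rw [ContinuousLinearMap.comp_apply, ← h.apply_inverse (dualVec i), h.apply_inverse_right]

theorem metricTrace_congr {F : Type*} [AddCommMonoid F] {b : Bil n} {B B' : E n → E n → F}
    (h : ∀ v w, B v w = B' v w) : metricTrace b B = metricTrace b B' := by
  rw [show B = B' from funext fun v => funext fun w => h v w]

theorem IsInner.comp {b : Bil n} (h : IsInner b) (L : E n ≃L[ℝ] E n) :
    IsInner (b.bilinearComp (L : E n →L[ℝ] E n) (L : E n →L[ℝ] E n)) :=
  ⟨fun _ _ => h.symm _ _, fun _ hv => h.pos _ (by simpa using hv)⟩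

/-- The endomorphisms that represent the two forms are conjugate by L. -/
theorem metricTrace_comp {b : Bil n} (h : IsInner b) (B : Bil n) (L : E n ≃L[ℝ] E n) :
    metricTrace (b.bilinearComp (L : E n →L[ℝ] E n) (L : E n →L[ℝ] E n)) (fun v w => B (L v) (L w))
      = metricTrace b (fun v w => B v w) := by
  have h' := h.comp L
  set b' := b.bilinearComp (L : E n →L[ℝ] E n) (L : E n →L[ℝ] E n) with hb'
  set B' := B.bilinearComp (L : E n →L[ℝ] E n) (L : E n →L[ℝ] E n) with hB'
  rw [metricTrace_eq h B]
  change metricTrace b' (fun v w => B' v w) = _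
  rw [metricTrace_eq h' B']
  have key : b'.inverse ∘L B' = (L.symm : E n →L[ℝ] E n) ∘L ((b.inverse ∘L B) ∘L L) := by
    ext1 v
    refine h'.ext fun w => ?_
    simp only [ContinuousLinearMap.comp_apply]
    rw [h'.apply_inverse, hb', hB']
    simp only [ContinuousLinearMap.bilinearComp_apply, ContinuousLinearEquiv.coe_coe,
      ContinuousLinearEquiv.apply_symm_apply]
    rw [h.apply_inverse]
  rw [key, trL_comm]
  congr 1
  ext1 v
  simp

end Trace

/-! ### Orthonormal frames in dimension two -/

section Frame

/-- The vectors `e₁, e₂` are orthonormal for the bilinear form `b`. -/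
structure IsFrame (b : Bil 2) (e₁ e₂ : E 2) : Prop where
  one : b e₁ e₁ = 1
  two : b e₂ e₂ = 1
  orth : b e₁ e₂ = 0

variable {b : Bil 2} {e₁ e₂ : E 2}

theorem IsFrame.expand (hb : IsInner b) (he : IsFrame b e₁ e₂) (v : E 2) :
    v = b v e₁ • e₁ + b v e₂ • e₂ := by
  have h21 : b e₂ e₁ = 0 := by rw [hb.symm, he.orth]
  have hli : LinearIndependent ℝ ![e₁, e₂] := by
    rw [LinearIndependent.pair_iff]
    intro s t hst
    have h1 : b (s • e₁ + t • e₂) e₁ = 0 := by rw [hst]; simp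
    have h2 : b (s • e₁ + t • e₂) e₂ = 0 := by rw [hst]; simp
    simp [he.one, he.two, he.orth, h21] at h1 h2
    exact ⟨h1, h2⟩
  have hsp := hli.span_eq_top_of_card_eq_finrank (by simp)
  have hv : v ∈ Submodule.span ℝ (Set.range ![e₁, e₂]) := hsp ▸ Submodule.mem_top
  simp only [Matrix.range_cons, Matrix.range_empty, Set.union_empty, Set.singleton_union] at hv
  obtain ⟨s, t, rfl⟩ := Submodule.mem_span_pair.1 hv
  simp [he.one, he.two, he.orth, h21]

theorem IsFrame.trL (hb : IsInner b) (he : IsFrame b e₁ e₂) (A : E 2 →L[ℝ] E 2) :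
    trL A = b (A e₁) e₁ + b (A e₂) e₂ := by
  have h : ∀ i, dualVec i (A (basisVec i))
      = b (dualVec i (A e₁) • basisVec i) e₁ + b (dualVec i (A e₂) • basisVec i) e₂ := fun i => by
    conv_lhs => rw [he.expand hb (basisVec i)]
    simp only [map_add, map_smul, smul_eq_mul, _root_.smul_apply]
    ring
  rw [RiemSurf.trL, Finset.sum_congr rfl fun i _ => h i, Finset.sum_add_distrib]
  conv_rhs => rw [← sum_dualVec_smul (A e₁), ← sum_dualVec_smul (A e₂)]
  simp only [map_sum, _root_.sum_apply]

theorem IsFrame.metricTrace (hb : IsInner b) (he : IsFrame b e₁ e₂) (B : Bil 2) :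
    metricTrace b (fun v w => B v w) = B e₁ e₁ + B e₂ e₂ := by
  rw [metricTrace_eq hb, he.trL hb]
  simp [hb.apply_inverse]

theorem exists_isFrame (hb : IsInner b) (h1 : b e₁ e₁ = 1) : ∃ e₂, IsFrame b e₁ e₂ := by
  -- The covector v ↦ det(e₁, v) annihilates e₁, so its metric dual is orthogonal to e₁; it only
  -- remains to normalize it.
  set α : E 2 →L[ℝ] ℝ := e₁ 0 • dualVec 1 - e₁ 1 • dualVec 0 with hα
  have hα1 : α e₁ = 0 := by simp [hα, dualVec]; ring
  have hα0 : α ≠ 0 := fun h => by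
    have a0 : α (basisVec 0) = 0 := by rw [h]; simp
    have a1 : α (basisVec 1) = 0 := by rw [h]; simp
    simp [hα, dualVec, basisVec] at a0 a1
    have : e₁ = 0 := by
      ext i
      fin_cases i
      · exact a1
      · exact a0
    simp [this] at h1
  set k := b.inverse α with hk
  have hk0 : k ≠ 0 := fun h => hα0 (by ext1 v; rw [← hb.apply_inverse α v, ← hk, h]; simp)
  have hpos := hb.pos k hk0
  have hs : √(b k k) ≠ 0 := (Real.sqrt_pos.2 hpos).ne'
  refine ⟨(√(b k k))⁻¹ • k, h1, ?_, ?_⟩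
  · simp only [map_smul, _root_.smul_apply, smul_eq_mul]
    field_simp
    exact (Real.sq_sqrt hpos.le).symm
  · rw [map_smul, show b e₁ k = α e₁ from hb.apply_inverse_right α e₁, hα1, smul_zero]

theorem area_pos {n : ℕ} {b : Bil n} (hb : IsInner b) {u v : E n}
    (h : LinearIndependent ℝ ![u, v]) : 0 < b u u * b v v - b u v ^ 2 := by
  have hv : v ≠ 0 := h.ne_zero 1
  have hvv := hb.pos v hv
  -- The squared length of b(v, v) u - b(u, v) v is b(v, v) times the Gram determinant.
  have hw : b v v • u + (-b u v) • v ≠ 0 := fun h0 => by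
    have := (LinearIndependent.pair_iff.1 h _ _ h0).1
    exact hvv.ne' this
  have := hb.pos _ hw
  simp only [map_add, map_smul, _root_.add_apply, _root_.smul_apply, smul_eq_mul,
    hb.symm v u] at this
  have e : b v v * (b u u * b v v - b u v ^ 2) = b v v * (b v v * b u u + -b u v * b u v)
      + -b u v * (b v v * b u v + -b u v * b v v) := by ring
  have h2 : 0 < b v v * (b u u * b v v - b u v ^ 2) := by rw [e]; linarith
  exact (mul_pos_iff_of_pos_left hvv).1 h2

theorem linearIndependent_basisVec : LinearIndependent ℝ ![(basisVec 0 : E 2), basisVec 1] := by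
  rw [LinearIndependent.pair_iff]
  intro s t h
  have h0 := congrArg (fun x : E 2 => x 0) h
  have h1 := congrArg (fun x : E 2 => x 1) h
  simp [basisVec] at h0 h1
  exact ⟨h0, h1⟩

end Frame

/-! ### The Gaussian curvature in dimension two -/

section GaussK

variable {G : E 2 → Bil 2} {U : Set (E 2)} {x : E 2}

/-- The Gaussian curvature of the metric `G`. -/
def gaussK (G : E 2 → Bil 2) (x : E 2) : ℝ := coordSectional G x (basisVec 0) (basisVec 1)

/-- In dimension two R(u, v) depends on u and v only through det(u, v). Both sides are multiplied by
the square of this determinant when passing from the standard basis to (u, v). -/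
theorem gaussK_spec (hG : MetricOn G U) (hx : x ∈ U) (u v : E 2) :
    G x (curvL G x u v v) u = gaussK G x * (G x u u * G x v v - G x u v ^ 2) := by
  set e₀ : E 2 := basisVec 0
  set e₁ : E 2 := basisVec 1
  have sG := (hG.inner x hx).symm
  have hA := area_pos (hG.inner x hx) linearIndependent_basisVec
  have hK : gaussK G x * (G x e₀ e₀ * G x e₁ e₁ - G x e₀ e₁ ^ 2) = G x (curvL G x e₀ e₁ e₁) e₀ := by
    rw [gaussK, coordSectional, curvature_eq_curvL hG hx]
    exact div_mul_cancel₀ _ hA.ne'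
  have hexp : ∀ w : E 2, w = w 0 • e₀ + w 1 • e₁ := fun w => by
    have := sum_dualVec_smul w
    rw [Fin.sum_univ_two] at this
    exact this.symm
  have hR : curvL G x u v = (u 0 * v 1 - u 1 * v 0) • curvL G x e₀ e₁ := by
    conv_lhs => rw [hexp u, hexp v]
    simp only [curvL_add, curvL_add_right, curvL_smul, curvL_smul_right, curvL_self,
      curvL_swap e₀ e₁]
    module
  have s00 : G x (curvL G x e₀ e₁ e₀) e₀ = 0 := by
    have := curvL_skew hG hx e₀ e₁ e₀ e₀; linarith
  have s11 : G x (curvL G x e₀ e₁ e₁) e₁ = 0 := by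
    have := curvL_skew hG hx e₀ e₁ e₁ e₁; linarith
  have s01 := curvL_skew hG hx e₀ e₁ e₀ e₁
  have hL : G x (curvL G x u v v) u
      = (u 0 * v 1 - u 1 * v 0) ^ 2 * G x (curvL G x e₀ e₁ e₁) e₀ := by
    rw [hR]
    have : G x (curvL G x e₀ e₁ v) u = (u 0 * v 1 - u 1 * v 0) * G x (curvL G x e₀ e₁ e₁) e₀ := by
      conv_lhs => rw [hexp u, hexp v]
      simp only [map_add, map_smul, _root_.add_apply, _root_.smul_apply, smul_eq_mul, s00, s11, s01]
      ring
    simp only [map_smul, _root_.smul_apply, smul_eq_mul, this]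
    ring
  have hB : G x u u * G x v v - G x u v ^ 2
      = (u 0 * v 1 - u 1 * v 0) ^ 2 * (G x e₀ e₀ * G x e₁ e₁ - G x e₀ e₁ ^ 2) := by
    conv_lhs => rw [hexp u, hexp v]
    simp only [map_add, map_smul, _root_.add_apply, _root_.smul_apply, smul_eq_mul, sG e₁ e₀]
    ring
  rw [hL, hB, ← hK]
  ring

theorem coordSectional_eq_gaussK (hG : MetricOn G U) (hx : x ∈ U) {u v : E 2}
    (h : LinearIndependent ℝ ![u, v]) : coordSectional G x u v = gaussK G x := by
  rw [coordSectional, curvature_eq_curvL hG hx, gaussK_spec hG hx,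
    mul_div_cancel_right₀ _ (area_pos (hG.inner x hx) h).ne']

theorem smooth_gaussK (hG : MetricOn G U) : ContDiffOn ℝ ∞ (gaussK G) U := by
  have hc : ∀ a b : E 2, ContDiffOn ℝ ∞ (fun x => G x a b) U := fun a b =>
    (hG.smooth.clm_apply contDiffOn_const).clm_apply contDiffOn_const
  have h : ContDiffOn ℝ ∞ (fun x => G x (curvL G x (basisVec 0) (basisVec 1) (basisVec 1))
      (basisVec 0) / (G x (basisVec 0) (basisVec 0) * G x (basisVec 1) (basisVec 1)
        - G x (basisVec 0) (basisVec 1) ^ 2)) U := by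
    refine ContDiffOn.div ?_ (((hc _ _).mul (hc _ _)).sub ((hc _ _).pow 2)) fun x hx =>
      (area_pos (hG.inner x hx) linearIndependent_basisVec).ne'
    exact (hG.smooth.clm_apply (smooth_curvL hG _ _ _)).clm_apply contDiffOn_const
  refine h.congr fun x hx => ?_
  rw [gaussK, coordSectional, curvature_eq_curvL hG hx]

end GaussK

/-! ### Gradient and Hessian -/

section Hessian

variable {n : ℕ} {G : E n → Bil n} {U : Set (E n)} {x : E n} {u : E n → ℝ}

/-- The gradient of `u` for the metric `G`. -/
def gradE (G : E n → Bil n) (u : E n → ℝ) (x : E n) : E n := (G x).inverse (fderiv ℝ u x)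

/-- The Hessian of `u` for the metric `G`. -/
def hess (G : E n → Bil n) (u : E n → ℝ) (x : E n) : Bil n :=
  fderiv ℝ (fderiv ℝ u) x - (ContinuousLinearMap.compL ℝ (E n) (E n) ℝ (fderiv ℝ u x)) ∘L chris G x

/-- The Laplacian of `u` for the metric `G`. -/
def lapE (G : E n → Bil n) (u : E n → ℝ) (x : E n) : ℝ :=
  -metricTrace (G x) (fun v w => hess G u x v w)

theorem hess_apply (G : E n → Bil n) (u : E n → ℝ) (x v w : E n) :
    hess G u x v w = fderiv ℝ (fderiv ℝ u) x v w - fderiv ℝ u x (chris G x v w) := by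
  simp [hess]

theorem gradE_inner (hG : MetricOn G U) (hx : x ∈ U) (v : E n) :
    G x (gradE G u x) v = fderiv ℝ u x v := (hG.inner x hx).apply_inverse _ _

theorem smooth_gradE (hG : MetricOn G U) (hu : ContDiffOn ℝ ∞ u U) :
    ContDiffOn ℝ ∞ (gradE G u) U :=
  hG.smooth_inverse.clm_apply (smooth_fderiv hu hG.isOpen)

theorem hess_symm (hG : MetricOn G U) (hx : x ∈ U) (hu : ContDiffOn ℝ ∞ u U) (v w : E n) :
    hess G u x v w = hess G u x w v := by
  rw [hess_apply, hess_apply, smooth_snd_symm hu hG.isOpen hx, hG.chris_symm hx]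

theorem smooth_hess_apply (hG : MetricOn G U) (hu : ContDiffOn ℝ ∞ u U) {ξ ζ : E n → E n}
    (hξ : ContDiffOn ℝ ∞ ξ U) (hζ : ContDiffOn ℝ ∞ ζ U) :
    ContDiffOn ℝ ∞ (fun y => hess G u y (ξ y) (ζ y)) U := by
  have h1 := smooth_fderiv hu hG.isOpen
  simp only [hess_apply]
  exact (((smooth_fderiv h1 hG.isOpen).clm_apply hξ).clm_apply hζ).sub
    (h1.clm_apply ((hG.smooth_chris.clm_apply hξ).clm_apply hζ))

/-- This is the derivative of the identity G(grad u, z) = du(z) for a constant field z. -/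
theorem covD_gradE (hG : MetricOn G U) (hx : x ∈ U) (hu : ContDiffOn ℝ ∞ u U) (v z : E n) :
    G x (covD G id (gradE G u) x v) z = hess G u x v z := by
  have h := fderiv_metric_along (ζ := fun _ => z) hG (mapOn_id hG.isOpen) hx (smooth_gradE hG hu)
    contDiffOn_const v
  simp only [id] at h
  rw [fderiv_congr_on hG.isOpen hx fun y hy => gradE_inner hG hy z,
    fderiv_fderiv_apply hu hG.isOpen hx, gradE_inner hG hx] at h
  rw [hess_apply]
  simp only [covD_id (ξ := fun _ => z), fderiv_fun_const, Pi.zero_apply, _root_.zero_apply,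
    zero_add] at h
  linarith

theorem fderiv_normSq_gradE (hG : MetricOn G U) (hx : x ∈ U) (hu : ContDiffOn ℝ ∞ u U) (v : E n) :
    fderiv ℝ (fun y => G y (gradE G u y) (gradE G u y)) x v = 2 * hess G u x v (gradE G u x) := by
  have h := fderiv_metric_along hG (mapOn_id hG.isOpen) hx (smooth_gradE hG hu)
    (smooth_gradE hG hu) v
  simp only [id] at h
  rw [h, (hG.inner x hx).symm (gradE G u x), covD_gradE hG hx hu]
  ring

end Hessian

/-! ### Covariant derivative of bilinear forms -/

section NablaBil

variable {n : ℕ} {G b : E n → Bil n} {U : Set (E n)} {x : E n}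

/-- The covariant derivative `∇_z b` of the field `b` of bilinear forms. -/
def nablaBil (G b : E n → Bil n) (x z : E n) : Bil n :=
  fderiv ℝ b x z - (b x).bilinearComp (chris G x z) (.id ℝ (E n))
    - (b x).bilinearComp (.id ℝ (E n)) (chris G x z)

theorem nablaBil_apply (G b : E n → Bil n) (x z v w : E n) :
    nablaBil G b x z v w = fderiv ℝ b x z v w - b x (chris G x z v) w - b x v (chris G x z w) := by
  simp [nablaBil]

theorem fderiv_bil_apply (hb : ContDiffOn ℝ ∞ b U) (hU : IsOpen U) (hx : x ∈ U) (z v w : E n) :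
    fderiv ℝ (fun y => b y v w) x z = fderiv ℝ b x z v w := by
  have hd := smooth_diffAt hb hU hx
  rw [fderiv_clm_apply (by fun_prop) (by fun_prop), fderiv_clm_apply hd (by fun_prop)]
  simp

theorem nablaBil_symm (hb : ContDiffOn ℝ ∞ b U) (hU : IsOpen U) (hx : x ∈ U)
    (hs : ∀ y ∈ U, ∀ v w, b y v w = b y w v) (z v w : E n) :
    nablaBil G b x z v w = nablaBil G b x z w v := by
  rw [nablaBil_apply, nablaBil_apply, ← fderiv_bil_apply hb hU hx, ← fderiv_bil_apply hb hU hx,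
    fderiv_congr_on hU hx fun y hy => hs y hy v w, hs x hx _ w, hs x hx v]
  ring

/-- The Leibniz rule for `b(ξ, ·)`. -/
theorem fderiv_bil_along (hb : ContDiffOn ℝ ∞ b U) (hU : IsOpen U) (hx : x ∈ U)
    {ξ : E n → E n} (hξ : ContDiffOn ℝ ∞ ξ U) (z w : E n) :
    fderiv ℝ (fun y => b y (ξ y) w) x z = nablaBil G b x z (ξ x) w + b x (covD G id ξ x z) w
      + b x (ξ x) (chris G x z w) := by
  have hd := smooth_diffAt hb hU hx
  have hd' := smooth_diffAt hξ hU hx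
  rw [fderiv_clm_apply (by fun_prop) (by fun_prop), fderiv_clm_apply hd hd', nablaBil_apply,
    covD_id]
  simp only [_root_.add_apply, ContinuousLinearMap.flip_apply, ContinuousLinearMap.comp_apply,
    fderiv_fun_const, Pi.zero_apply, ContinuousLinearMap.comp_zero, zero_add, map_add]
  ring

theorem metricTrace_add (β : Bil n) (B B' : E n → E n → ℝ) :
    metricTrace β (fun v w => B v w + B' v w) = metricTrace β B + metricTrace β B' := by
  simp [metricTrace, Finset.sum_add_distrib]

theorem metricTrace_const_mul (β : Bil n) (a : ℝ) (B : E n → E n → ℝ) :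
    metricTrace β (fun v w => a * B v w) = a * metricTrace β B := by
  simp [metricTrace, Finset.mul_sum]

theorem metricTrace_mul (β : Bil n) (α γ : E n →L[ℝ] ℝ) :
    metricTrace β (fun v w => α v * γ w) = γ (β.inverse α) := by
  have h : α = ∑ i, α (basisVec i) • dualVec i := by
    ext1 v
    conv_lhs => rw [← sum_dualVec_smul v]
    simp [mul_comm]
  conv_rhs => rw [h]
  have hinv : ∀ s : Finset (Fin n), β.inverse (∑ i ∈ s, α (basisVec i) • dualVec i)
      = ∑ i ∈ s, α (basisVec i) • β.inverse (dualVec i) := fun s => by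
    simp only [map_sum, map_smul]
  rw [hinv, map_sum]
  simp [metricTrace]

theorem smooth_metricTrace (hG : MetricOn G U) (hb : ContDiffOn ℝ ∞ b U) :
    ContDiffOn ℝ ∞ (fun y => metricTrace (G y) (fun v w => b y v w)) U := by
  refine ContDiffOn.sum fun i _ => ?_
  exact (hb.clm_apply contDiffOn_const).clm_apply (hG.smooth_inverse.clm_apply contDiffOn_const)

/-- The trace commutes with ∇: for the endomorphism A that represents b, the covariant derivative is
∂A plus the commutator [Γ, A], and a commutator has trace zero. -/
theorem fderiv_metricTrace (hG : MetricOn G U) (hb : ContDiffOn ℝ ∞ b U) (hx : x ∈ U) (z : E n) :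
    fderiv ℝ (fun y => metricTrace (G y) (fun v w => b y v w)) x z
      = metricTrace (G x) (fun v w => nablaBil G b x z v w) := by
  set A : E n → E n →L[ℝ] E n := fun y => (G y).inverse ∘L b y with hA
  have sA : ContDiffOn ℝ ∞ A U := hG.smooth_inverse.clm_comp hb
  have dA := smooth_diffAt sA hG.isOpen hx
  have hin := hG.inner x hx
  have hGA : ∀ y ∈ U, ∀ v w, G y (A y v) w = b y v w := fun y hy v w =>
    (hG.inner y hy).apply_inverse _ _
  have key : (G x).inverse ∘L nablaBil G b x z
      = fderiv ℝ A x z + chris G x z ∘L A x - A x ∘L chris G x z := by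
    ext1 v
    refine hin.ext fun w => ?_
    have h := fderiv_metric_along (ξ := fun y => A y v) (ζ := fun _ => w) hG (mapOn_id hG.isOpen) hx
      (sA.clm_apply contDiffOn_const) contDiffOn_const z
    simp only [id] at h
    rw [fderiv_congr_on hG.isOpen hx fun y hy => hGA y hy v w, fderiv_bil_apply hb hG.isOpen hx,
      hGA x hx, covD_id, covD_id, fderiv_clm_apply dA (by fun_prop)] at h
    simp only [fderiv_fun_const, Pi.zero_apply, _root_.zero_apply, zero_add,
      ContinuousLinearMap.comp_zero, ContinuousLinearMap.flip_apply] at h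
    rw [ContinuousLinearMap.comp_apply, hin.apply_inverse, nablaBil_apply, h]
    simp only [_root_.sub_apply, _root_.add_apply, ContinuousLinearMap.comp_apply, map_add, map_sub,
      hGA x hx]
    ring
  rw [metricTrace_eq hin, key, trL_sub, trL_add, trL_comm (A x), add_sub_cancel_right]
  rw [fderiv_congr_on hG.isOpen hx fun y hy => metricTrace_eq (hG.inner y hy) (b y)]
  have hAi : ∀ i : Fin n, DifferentiableAt ℝ (fun y => A y (basisVec i)) x := fun i =>
    dA.clm_apply (by fun_prop)
  have hAi' : ∀ i : Fin n, DifferentiableAt ℝ (fun y => dualVec i (A y (basisVec i))) x :=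
    fun i => (dualVec i).differentiableAt.comp x (hAi i)
  change fderiv ℝ (fun y => ∑ i, dualVec i (A y (basisVec i))) x z = _
  rw [fderiv_fun_sum fun i _ => hAi' i, _root_.sum_apply]
  refine Finset.sum_congr rfl fun i _ => ?_
  have h1 : fderiv ℝ (fun y => dualVec i (A y (basisVec i))) x
      = dualVec i ∘L fderiv ℝ (fun y => A y (basisVec i)) x :=
    (dualVec i).hasFDerivAt.comp x (hAi i).hasFDerivAt |>.fderiv
  change fderiv ℝ (fun y => dualVec i (A y (basisVec i))) x z = _
  rw [h1, ContinuousLinearMap.comp_apply, fderiv_clm_apply dA (by fun_prop)]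
  simp

/-- The divergence of `-f²/2 G + 2 f b`, for a Codazzi tensor `b` with trace `f`. -/
theorem divergence_codazzi (hG : MetricOn G U) (hb : ContDiffOn ℝ ∞ b U) (hx : x ∈ U)
    (hs : ∀ y ∈ U, ∀ v w, b y v w = b y w v)
    (hcod : ∀ u v w, nablaBil G b x u v w = nablaBil G b x v u w) {f : E n → ℝ}
    (hf : ∀ y ∈ U, f y = metricTrace (G y) (fun v w => b y v w)) {S : E n → E n → E n → ℝ}
    (hS : ∀ y ∈ U, ∀ v w, S y v w = -(1 / 2) * f y ^ 2 * G y v w + 2 * f y * b y v w) (z : E n) :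
    metricTrace (G x) (fun v w => fderiv ℝ (fun y => S y w z) x v - S x (christoffel G x v w) z
      - S x w (christoffel G x v z)) = f x * fderiv ℝ f x z + 2 * b x (gradE G f x) z := by
  have sf : ContDiffOn ℝ ∞ f U := (smooth_metricTrace hG hb).congr hf
  have df := smooth_diffAt sf hG.isOpen hx
  have dG := smooth_diffAt hG.smooth hG.isOpen hx
  have db := smooth_diffAt hb hG.isOpen hx
  have dc : ∀ {B : E n → Bil n}, DifferentiableAt ℝ B x → ∀ a c : E n,
      DifferentiableAt ℝ (fun y => B y a c) x := fun h a c => by fun_prop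
  have key : ∀ v w, fderiv ℝ (fun y => S y w z) x v - S x (christoffel G x v w) z
      - S x w (christoffel G x v z)
      = (-f x) * (fderiv ℝ f x v * (G x z) w) + (2 * (fderiv ℝ f x v * (b x z) w)
        + (2 * f x) * nablaBil G b x z v w) := fun v w => by
    -- By the Codazzi equation and symmetry, (∇_v b)(w, z) = (∇_z b)(v, w), whose metric trace over
    -- v and w is the derivative of the trace f. This accounts for the term 2 f df, while the metric
    -- part contributes -f df.
    rw [← hcod v z w, nablaBil_symm hb hG.isOpen hx hs v z w,
      fderiv_congr_on hG.isOpen hx fun y hy => hS y hy w z, hS x hx, hS x hx, ← chris_apply,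
      ← chris_apply, nablaBil_apply, ← fderiv_bil_apply hb hG.isOpen hx]
    have e1 : HasFDerivAt (fun y => -(1 / 2) * f y ^ 2 * G y w z + 2 * f y * b y w z) _ x :=
      (((df.hasFDerivAt.pow 2).const_mul (-(1 / 2))).mul (dc dG w z).hasFDerivAt).add
        ((df.hasFDerivAt.const_mul 2).mul (dc db w z).hasFDerivAt)
    rw [e1.fderiv]
    have e2 : fderiv ℝ (fun y => G y w z) x v = G x (chris G x v w) z + G x w (chris G x v z) := by
      rw [fderiv_bil_apply hG.smooth hG.isOpen hx, hG.fderiv_eq hx]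
    simp only [_root_.add_apply, _root_.smul_apply, smul_eq_mul, e2, nsmul_eq_mul]
    rw [hs x hx z w, (hG.inner x hx).symm z w]
    push_cast
    ring
  rw [metricTrace_congr key, metricTrace_add, metricTrace_add, metricTrace_const_mul,
    metricTrace_const_mul, metricTrace_const_mul, metricTrace_mul, metricTrace_mul,
    ← fderiv_metricTrace hG hb hx, ← fderiv_congr_on hG.isOpen hx hf,
    (hG.inner x hx).apply_inverse_right, hs x hx z]
  rw [gradE]
  ring

end NablaBil

/-! ### Hypersurfaces -/

section Const

variable {n : ℕ} {H : E n → Bil n} {U' : Set (E n)} {y : E n} {c : ℝ}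

/-- This extends the value c to dependent pairs, where both sides vanish; polarization needs all
pairs. -/
theorem sectional_spec (hH : MetricOn H U') (hy : y ∈ U')
    (hc : ∀ u v : E n, LinearIndependent ℝ ![u, v] → coordSectional H y u v = c) (u v : E n) :
    H y (curvL H y u v v) u = c * (H y u u * H y v v - H y u v ^ 2) := by
  by_cases h : LinearIndependent ℝ ![u, v]
  · rw [← hc u v h, coordSectional, curvature_eq_curvL hH hy,
      div_mul_cancel₀ _ (area_pos (hH.inner y hy) h).ne']
  · by_cases hu : u = 0
    · simp [hu]
    · rw [LinearIndependent.pair_iff' hu] at h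
      push Not at h
      obtain ⟨a, rfl⟩ := h
      rw [curvL_smul_right, curvL_self]
      simp
      ring_nf
      simp

end Const

section Hypersurface

variable {H : E 3 → Bil 3} {T : E 2 → E 3} {ν : E 2 → E 3} {U : Set (E 2)} {U' : Set (E 3)}
  {x : E 2} {c : ℝ}

/-- A smooth unit normal field along the immersion `T`. -/
structure NormalOn (H : E 3 → Bil 3) (T ν : E 2 → E 3) (U : Set (E 2)) : Prop where
  smooth : ContDiffOn ℝ ∞ ν U
  unit : ∀ x ∈ U, H (T x) (ν x) (ν x) = 1
  orth : ∀ x ∈ U, ∀ v, H (T x) (ν x) (fderiv ℝ T x v) = 0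

/-- The second fundamental form `b(v, w) = -⟨∇_v ν, dT(w)⟩`. -/
def shapeForm (H : E 3 → Bil 3) (T ν : E 2 → E 3) (x : E 2) : Bil 2 :=
  -((H (T x)).bilinearComp (covD H T ν x) (fderiv ℝ T x))

theorem shapeForm_apply (H : E 3 → Bil 3) (T ν : E 2 → E 3) (x v w : E 2) :
    shapeForm H T ν x v w = -H (T x) (covD H T ν x v) (fderiv ℝ T x w) := rfl

variable (hH : MetricOn H U') (hT : ImmOn T U U') (hν : NormalOn H T ν U)

include hH hT hν

theorem smooth_shapeForm : ContDiffOn ℝ ∞ (shapeForm H T ν) U := by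
  refine contDiffOn_clm_apply.2 fun v => contDiffOn_clm_apply.2 fun w => ?_
  simp only [shapeForm_apply]
  exact (smooth_metric_along hH hT.toMapOn ((smooth_covD hH hT.toMapOn hν.smooth).clm_apply
    contDiffOn_const) (smooth_fderiv_apply hT.toMapOn contDiffOn_const)).neg

theorem covD_normal (hx : x ∈ U) (v : E 2) : H (T x) (covD H T ν x v) (ν x) = 0 := by
  have h := fderiv_metric_along hH hT.toMapOn hx hν.smooth hν.smooth v
  rw [fderiv_congr_on hT.isOpen hx hν.unit, (hH.inner _ (hT.mapsTo hx)).symm (ν x)] at h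
  simp only [fderiv_fun_const, Pi.zero_apply, _root_.zero_apply] at h
  linarith

theorem shapeForm_eq (hx : x ∈ U) (v w : E 2) :
    shapeForm H T ν x v w = H (T x) (covD H T (fun y => fderiv ℝ T y w) x v) (ν x) := by
  have h := fderiv_metric_along hH hT.toMapOn hx hν.smooth
    (smooth_fderiv_apply hT.toMapOn (contDiffOn_const (c := w))) v
  rw [fderiv_congr_on hT.isOpen hx fun y hy => hν.orth y hy w,
    (hH.inner _ (hT.mapsTo hx)).symm (ν x)] at h
  simp only [fderiv_fun_const, Pi.zero_apply, _root_.zero_apply] at h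
  rw [shapeForm_apply]
  linarith

theorem shapeForm_symm (hx : x ∈ U) (v w : E 2) :
    shapeForm H T ν x v w = shapeForm H T ν x w v := by
  rw [shapeForm_eq hH hT hν hx, shapeForm_eq hH hT hν hx, covD_fderiv_symm hH hT.toMapOn hx]

/-- By a dimension count, 2 + 1 = 3, the image of dT and the normal span the whole space; the
tangential part of ξ is orthogonal to itself. -/
theorem normal_decomp (hx : x ∈ U) {ξ : E 3} (hξ : ∀ z, H (T x) ξ (fderiv ℝ T x z) = 0) :
    ξ = H (T x) ξ (ν x) • ν x := by
  have hi := hH.inner _ (hT.mapsTo hx)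
  set L : E 2 × ℝ →ₗ[ℝ] E 3 := (fderiv ℝ T x : E 2 →ₗ[ℝ] E 3).coprod
    (LinearMap.toSpanSingleton ℝ (E 3) (ν x)) with hL
  have hLa : ∀ v t, L (v, t) = fderiv ℝ T x v + t • ν x := fun v t => by simp [hL]
  have hinj : Function.Injective L := by
    rw [← LinearMap.ker_eq_bot, LinearMap.ker_eq_bot']
    rintro ⟨v, t⟩ h
    rw [hLa] at h
    have h1 : H (T x) (ν x) (fderiv ℝ T x v + t • ν x) = 0 := by rw [h, map_zero]
    rw [map_add, map_smul, hν.orth x hx, hν.unit x hx] at h1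
    have ht : t = 0 := by simpa using h1
    rw [ht, zero_smul, add_zero] at h
    have hv : v = 0 := hT.inj x hx (by rw [h, map_zero])
    rw [hv, ht]; rfl
  have hdim : Module.finrank ℝ (E 2 × ℝ) = Module.finrank ℝ (E 3) := by simp
  obtain ⟨⟨v, t⟩, hvt⟩ := (LinearMap.injective_iff_surjective_of_finrank_eq_finrank hdim).1 hinj ξ
  rw [hLa] at hvt
  have h1 := hξ v
  rw [← hvt, map_add, map_smul, _root_.add_apply, _root_.smul_apply, hν.orth x hx, smul_zero,
    add_zero] at h1
  have h2 := hi.eq_zero h1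
  rw [← hvt, h2, zero_add, map_smul, _root_.smul_apply, hν.unit x hx, smul_eq_mul, mul_one]

theorem sff_eq (hx : x ∈ U) (v w : E 2) : sff H T x v w = shapeForm H T ν x v w • ν x := by
  rw [normal_decomp hH hT hν hx (sff_tangent hH hT hx v w), shapeForm_eq hH hT hν hx]
  congr 1
  rw [sff, map_sub, _root_.sub_apply, (hH.inner _ (hT.mapsTo hx)).symm (fderiv ℝ T x _),
    hν.orth x hx, sub_zero]

theorem gaussK_hypersurface (hc : ∀ u v, H (T x) (curvL H (T x) u v v) u
    = c * (H (T x) u u * H (T x) v v - H (T x) u v ^ 2)) (hx : x ∈ U) (u v : E 2) :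
    gaussK (pull H T) x * (pull H T x u u * pull H T x v v - pull H T x u v ^ 2)
      = c * (pull H T x u u * pull H T x v v - pull H T x u v ^ 2)
        + shapeForm H T ν x u u * shapeForm H T ν x v v - shapeForm H T ν x u v ^ 2 := by
  have hG := metricOn_pull hH hT
  have h := gauss_equation hH hT hx u v v u
  rw [curvature_eq_curvL hH (hT.mapsTo hx), hc, curvature_eq_curvL hG hx, gaussK_spec hG hx,
    sff_eq hH hT hν hx, sff_eq hH hT hν hx, sff_eq hH hT hν hx, sff_eq hH hT hν hx] at h
  simp only [map_smul, _root_.smul_apply, smul_eq_mul, hν.unit x hx, ← pull_apply] at h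
  rw [shapeForm_symm hH hT hν hx v u] at h
  linarith

/-- The Codazzi equation. -/
theorem codazzi (hc : ∀ u v, H (T x) (curvL H (T x) u v v) u
    = c * (H (T x) u u * H (T x) v v - H (T x) u v ^ 2)) (hx : x ∈ U) (u v w : E 2) :
    nablaBil (pull H T) (shapeForm H T ν) x u v w
      = nablaBil (pull H T) (shapeForm H T ν) x v u w := by
  have hG := metricOn_pull hH hT
  have hi := hH.inner _ (hT.mapsTo hx)
  have hsD : ∀ a : E 2, ContDiffOn ℝ ∞ (fun y => covD H T ν y a) U := fun a =>
    (smooth_covD hH hT.toMapOn hν.smooth).clm_apply contDiffOn_const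
  -- In constant curvature R(u, v)ν is a combination of the products ⟨v, ν⟩ and ⟨u, ν⟩ for tangent u
  -- and v, hence zero against tangent vectors.
  have hR : H (T x) (curvature H (T x) (fderiv ℝ T x u) (fderiv ℝ T x v) (ν x)) (fderiv ℝ T x w)
      = 0 := by
    rw [curvature_eq_curvL hH (hT.mapsTo hx), curvL_of_const hH (hT.mapsTo hx) hc,
      hi.symm _ (ν x), hi.symm _ (ν x), hν.orth x hx, hν.orth x hx]
    ring
  -- This differentiates b(a, w) = -⟨∇_a ν, dT(w)⟩. The normal part of ∇_b dT(w) drops out because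
  -- ∇_a ν is orthogonal to ν.
  have key : ∀ a b, H (T x) (covD H T (fun y => covD H T ν y a) x b) (fderiv ℝ T x w)
      = -fderiv ℝ (shapeForm H T ν) x b a w + shapeForm H T ν x a (chris (pull H T) x b w) := by
    intro a b
    have h := fderiv_metric_along hH hT.toMapOn hx (hsD a)
      (smooth_fderiv_apply hT.toMapOn (contDiffOn_const (c := w))) b
    have e : (fun y => H (T y) (covD H T ν y a) (fderiv ℝ T y w))
        = fun y => -shapeForm H T ν y a w := by
      funext y; rw [shapeForm_apply, neg_neg]
    have e2 : covD H T (fun y => fderiv ℝ T y w) x b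
        = fderiv ℝ T x (chris (pull H T) x b w) + sff H T x b w := by rw [sff]; abel
    rw [e, fderiv_fun_neg, _root_.neg_apply,
      fderiv_bil_apply (smooth_shapeForm hH hT hν) hT.isOpen hx, e2, map_add,
      sff_eq hH hT hν hx, map_smul, covD_normal hH hT hν hx, smul_zero, add_zero] at h
    rw [shapeForm_apply H T ν x a]
    linarith
  rw [← covD_comm hH hT.toMapOn hx hν.smooth, map_sub, _root_.sub_apply, key, key] at hR
  rw [nablaBil_apply, nablaBil_apply, hG.chris_symm hx v u]
  linarith

end Hypersurface

/-! ### Laplacians of sums, products and compositions -/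

section Laplacian

variable {n : ℕ} {G : E n → Bil n} {U : Set (E n)} {x : E n} {u u' : E n → ℝ}

theorem hess_congr (hU : IsOpen U) (hx : x ∈ U) (h : ∀ y ∈ U, u y = u' y) :
    hess G u x = hess G u' x := by
  have h1 : ∀ y ∈ U, fderiv ℝ u y = fderiv ℝ u' y := fun y hy => fderiv_congr_on hU hy h
  rw [hess, hess, h1 x hx, fderiv_congr_on hU hx h1]

theorem lapE_congr (hU : IsOpen U) (hx : x ∈ U) (h : ∀ y ∈ U, u y = u' y) :
    lapE G u x = lapE G u' x := by
  rw [lapE, lapE, hess_congr hU hx h]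

theorem lapE_add (hG : MetricOn G U) (hx : x ∈ U) (hu : ContDiffOn ℝ ∞ u U)
    (hu' : ContDiffOn ℝ ∞ u' U) : lapE G (fun y => u y + u' y) x = lapE G u x + lapE G u' x := by
  have h1 : ∀ y ∈ U, fderiv ℝ (fun y => u y + u' y) y = fderiv ℝ u y + fderiv ℝ u' y :=
    fun y hy => fderiv_fun_add (smooth_diffAt hu hG.isOpen hy) (smooth_diffAt hu' hG.isOpen hy)
  have h2 : fderiv ℝ (fderiv ℝ (fun y => u y + u' y)) x
      = fderiv ℝ (fderiv ℝ u) x + fderiv ℝ (fderiv ℝ u') x := by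
    rw [fderiv_congr_on hG.isOpen hx h1]
    exact fderiv_fun_add (smooth_diffAt (smooth_fderiv hu hG.isOpen) hG.isOpen hx)
      (smooth_diffAt (smooth_fderiv hu' hG.isOpen) hG.isOpen hx)
  have h3 : ∀ v w, hess G (fun y => u y + u' y) x v w = hess G u x v w + hess G u' x v w :=
    fun v w => by
      rw [hess_apply, hess_apply, hess_apply, h2, h1 x hx]
      simp only [_root_.add_apply]
      ring
  rw [lapE, metricTrace_congr h3, metricTrace_add, lapE, lapE]
  ring

/-- With Δ = -trace ∇d, the mixed first order terms enter with the sign -2. -/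
theorem lapE_mul (hG : MetricOn G U) (hx : x ∈ U) (hu : ContDiffOn ℝ ∞ u U)
    (hu' : ContDiffOn ℝ ∞ u' U) : lapE G (fun y => u y * u' y) x
      = u x * lapE G u' x + u' x * lapE G u x - 2 * G x (gradE G u x) (gradE G u' x) := by
  have d1 : ∀ y ∈ U, DifferentiableAt ℝ u y := fun y hy => smooth_diffAt hu hG.isOpen hy
  have d2 : ∀ y ∈ U, DifferentiableAt ℝ u' y := fun y hy => smooth_diffAt hu' hG.isOpen hy
  have d3 := smooth_diffAt (smooth_fderiv hu hG.isOpen) hG.isOpen hx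
  have d4 := smooth_diffAt (smooth_fderiv hu' hG.isOpen) hG.isOpen hx
  have h1 : ∀ y ∈ U, fderiv ℝ (fun y => u y * u' y) y = u y • fderiv ℝ u' y + u' y • fderiv ℝ u y :=
    fun y hy => fderiv_fun_mul (d1 y hy) (d2 y hy)
  have h3 : ∀ v w, hess G (fun y => u y * u' y) x v w = (u x * hess G u' x v w
      + u' x * hess G u x v w) + (fderiv ℝ u x v * fderiv ℝ u' x w
        + fderiv ℝ u' x v * fderiv ℝ u x w) := fun v w => by
    rw [hess_apply, hess_apply, hess_apply, h1 x hx, fderiv_congr_on hG.isOpen hx h1,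
      fderiv_fun_add ((d1 x hx).fun_smul d4) ((d2 x hx).fun_smul d3), fderiv_fun_smul (d1 x hx) d4,
      fderiv_fun_smul (d2 x hx) d3]
    simp only [_root_.add_apply, _root_.smul_apply, ContinuousLinearMap.smulRight_apply,
      smul_eq_mul]
    ring
  rw [lapE, metricTrace_congr h3, metricTrace_add, metricTrace_add, metricTrace_add,
    metricTrace_const_mul, metricTrace_const_mul, metricTrace_mul, metricTrace_mul, lapE, lapE,
    gradE_inner hG hx]
  have : fderiv ℝ u' x (gradE G u x) = fderiv ℝ u x (gradE G u' x) := by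
    rw [← gradE_inner hG hx, ← gradE_inner hG hx, (hG.inner x hx).symm]
  simp only [gradE] at *
  rw [this]
  ring

variable {F : ℝ → ℝ} {O : Set ℝ}

theorem smooth_deriv (hF : ContDiffOn ℝ ∞ F O) (hO : IsOpen O) : ContDiffOn ℝ ∞ (deriv F) O :=
  hF.deriv_of_isOpen hO (by simp)

theorem fderiv_comp_real (hU : IsOpen U) (hu : ContDiffOn ℝ ∞ u U) (hO : IsOpen O)
    (hF : ContDiffOn ℝ ∞ F O) (hm : MapsTo u U O) (hx : x ∈ U) :
    fderiv ℝ (fun y => F (u y)) x = deriv F (u x) • fderiv ℝ u x := by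
  have d1 := smooth_diffAt hu hU hx
  have d2 := smooth_diffAt hF hO (hm hx)
  exact (d2.hasDerivAt.comp_hasFDerivAt x d1.hasFDerivAt).fderiv

theorem hess_comp (hG : MetricOn G U) (hx : x ∈ U) (hu : ContDiffOn ℝ ∞ u U) (hO : IsOpen O)
    (hF : ContDiffOn ℝ ∞ F O) (hm : MapsTo u U O) (v w : E n) :
    hess G (fun y => F (u y)) x v w = deriv F (u x) * hess G u x v w
      + deriv (deriv F) (u x) * (fderiv ℝ u x v * fderiv ℝ u x w) := by
  have h1 : ∀ y ∈ U, fderiv ℝ (fun y => F (u y)) y = deriv F (u y) • fderiv ℝ u y := fun y hy =>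
    fderiv_comp_real hG.isOpen hu hO hF hm hy
  have d1 : DifferentiableAt ℝ (fun y => deriv F (u y)) x :=
    (smooth_diffAt (smooth_deriv hF hO) hO (hm hx)).comp x (smooth_diffAt hu hG.isOpen hx)
  have d3 := smooth_diffAt (smooth_fderiv hu hG.isOpen) hG.isOpen hx
  rw [hess_apply, hess_apply, h1 x hx, fderiv_congr_on hG.isOpen hx h1, fderiv_fun_smul d1 d3,
    fderiv_comp_real hG.isOpen hu hO (smooth_deriv hF hO) hm hx]
  simp only [_root_.add_apply, _root_.smul_apply, ContinuousLinearMap.smulRight_apply,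
    smul_eq_mul]
  ring

theorem lapE_comp (hG : MetricOn G U) (hx : x ∈ U) (hu : ContDiffOn ℝ ∞ u U) (hO : IsOpen O)
    (hF : ContDiffOn ℝ ∞ F O) (hm : MapsTo u U O) :
    lapE G (fun y => F (u y)) x = deriv F (u x) * lapE G u x
      - deriv (deriv F) (u x) * G x (gradE G u x) (gradE G u x) := by
  rw [lapE, metricTrace_congr (hess_comp hG hx hu hO hF hm), metricTrace_add,
    metricTrace_const_mul, metricTrace_const_mul, metricTrace_mul, lapE, gradE_inner hG hx, gradE]
  ring

end Laplacian

/-! ### The conformal change of metric -/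

section Conformal

variable {G : E 2 → Bil 2} {U : Set (E 2)} {x : E 2} {σ : E 2 → ℝ}

theorem exists_frame {b : Bil 2} (hb : IsInner b) : ∃ e₁ e₂, IsFrame b e₁ e₂ := by
  have hpos := hb.pos _ (linearIndependent_basisVec.ne_zero 0)
  set k : E 2 := (![basisVec 0, basisVec 1] : Fin 2 → E 2) 0
  have hs : √(b k k) ≠ 0 := (Real.sqrt_pos.2 hpos).ne'
  have h1 : b ((√(b k k))⁻¹ • k) ((√(b k k))⁻¹ • k) = 1 := by
    simp only [map_smul, _root_.smul_apply, smul_eq_mul]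
    field_simp
    exact (Real.sq_sqrt hpos.le).symm
  obtain ⟨e₂, h⟩ := exists_isFrame hb h1
  exact ⟨_, e₂, h⟩

theorem metricOn_exp (hG : MetricOn G U) (hσ : ContDiffOn ℝ ∞ σ U) :
    MetricOn (fun y => Real.exp (2 * σ y) • G y) U where
  isOpen := hG.isOpen
  smooth := (Real.contDiff_exp.comp_contDiffOn (contDiffOn_const.mul hσ)).smul hG.smooth
  inner y hy := ⟨fun v w => by simp [(hG.inner y hy).symm v w], fun v hv => by
    simpa using mul_pos (Real.exp_pos _) ((hG.inner y hy).pos v hv)⟩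

/-- Both metrics satisfy a Koszul formula; those formulas differ only by the derivatives 2 dσ of the
factor. -/
theorem chris_exp (hG : MetricOn G U) (hσ : ContDiffOn ℝ ∞ σ U) (hx : x ∈ U) (v w : E 2) :
    chris (fun y => Real.exp (2 * σ y) • G y) x v w = chris G x v w
      + (fderiv ℝ σ x v • w + fderiv ℝ σ x w • v - G x v w • gradE G σ x) := by
  have hG' := metricOn_exp hG hσ
  have dσ := smooth_diffAt hσ hG.isOpen hx
  have dG := smooth_diffAt hG.smooth hG.isOpen hx
  have h1 : ∀ a, fderiv ℝ (fun y => Real.exp (2 * σ y) • G y) x a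
      = Real.exp (2 * σ x) • (fderiv ℝ G x a + (2 * fderiv ℝ σ x a) • G x) := fun a => by
    rw [((dσ.hasFDerivAt.const_mul 2).exp.fun_smul dG.hasFDerivAt).fderiv]
    simp only [_root_.add_apply, _root_.smul_apply, ContinuousLinearMap.smulRight_apply,
      smul_eq_mul]
    module
  refine (hG.inner x hx).ext fun z => ?_
  have hk' := hG'.koszul hx v w z
  have hk := hG.koszul hx v w z
  rw [h1, h1, h1] at hk'
  simp only [_root_.add_apply, _root_.smul_apply, smul_eq_mul] at hk'
  have he := (Real.exp_pos (2 * σ x)).ne'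
  simp only [map_add, map_sub, map_smul, _root_.add_apply, _root_.sub_apply, _root_.smul_apply,
    smul_eq_mul, gradE_inner hG hx]
  have sG := (hG.inner x hx).symm
  refine mul_left_cancel₀ (mul_ne_zero two_ne_zero he) ?_
  linear_combination hk' - Real.exp (2 * σ x) * hk

/-- The new Christoffel map is substituted into the curvature as a commutator, and the result is
evaluated on a `G`-orthonormal frame. The terms quadratic in dσ cancel because |grad σ|² = dσ(e₁)² +
dσ(e₂)², and the Hessian terms add up to the Laplacian. -/
theorem gaussK_exp (hG : MetricOn G U) (hσ : ContDiffOn ℝ ∞ σ U) (hx : x ∈ U) :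
    gaussK (fun y => Real.exp (2 * σ y) • G y) x
      = Real.exp (-(2 * σ x)) * (gaussK G x + lapE G σ x) := by
  have hG' := metricOn_exp hG hσ
  have hin := hG.inner x hx
  obtain ⟨e₁, e₂, he⟩ := exists_frame hin
  have sG := hin.symm
  have dσ := smooth_diffAt (smooth_fderiv hσ hG.isOpen) hG.isOpen hx
  have dgr := smooth_diffAt (smooth_gradE hG hσ) hG.isOpen hx
  have hΓ : ∀ a b : E 2, DifferentiableAt ℝ (fun y => chris G y a b) x := fun a b =>
    smooth_diffAt ((hG.smooth_chris.clm_apply contDiffOn_const).clm_apply contDiffOn_const)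
      hG.isOpen hx
  set θ := fderiv ℝ σ x with h_θ
  have dot_grad : ∀ v, G x (gradE G σ x) v = θ v := gradE_inner hG hx
  -- One half of the commutator for the new metric, paired with z under `G`, in terms of the old
  -- connection, Hess σ and θ = dσ.
  have key : ∀ u v w z, G x (covD (fun y => Real.exp (2 * σ y) • G y) id
      (fun y => chris (fun y => Real.exp (2 * σ y) • G y) y v w) x u) z
      = G x (covD G id (fun y => chris G y v w) x u) z
        + (hess G σ x u v + θ (chris G x u v)) * G x w z + θ v * G x (chris G x u w) z
        + (hess G σ x u w + θ (chris G x u w)) * G x v z + θ w * G x (chris G x u v) z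
        - (G x (chris G x u v) w + G x v (chris G x u w)) * θ z - G x v w * hess G σ x u z
        + (θ u * (G x (chris G x v w) z + (θ v * G x w z + θ w * G x v z - G x v w * θ z))
          + (θ (chris G x v w) + (2 * (θ v * θ w) - G x v w * θ (gradE G σ x))) * G x u z
          - (G x (chris G x v w) u + (θ v * G x w u + θ w * G x v u - G x v w * θ u)) * θ z) := by
    intro u v w z
    have d1 : ∀ a b : E 2, DifferentiableAt ℝ (fun y => fderiv ℝ σ y a • b) x := fun a b =>
      (dσ.clm_apply (by fun_prop)).fun_smul (by fun_prop)
    have dG1 : DifferentiableAt ℝ (fun y => G y v w) x :=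
      smooth_diffAt ((hG.smooth.clm_apply contDiffOn_const).clm_apply contDiffOn_const) hG.isOpen hx
    have d2 : DifferentiableAt ℝ (fun y => (-G y v w) • gradE G σ y) x := dG1.fun_neg.fun_smul dgr
    have hc : ∀ y ∈ U, chris (fun y => Real.exp (2 * σ y) • G y) y v w
        = chris G y v w + ((fderiv ℝ σ y v • w + fderiv ℝ σ y w • v)
          + (-G y v w) • gradE G σ y) := fun y hy => by
      rw [chris_exp hG hσ hy]; module
    have hS : ∀ a b : E 2, G x (covD G id (fun y => fderiv ℝ σ y a • b) x u) z
        = (hess G σ x u a + θ (chris G x u a)) * G x b z + θ a * G x (chris G x u b) z := by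
      intro a b
      rw [covD_smul (dσ.clm_apply (by fun_prop)) (by fun_prop), map_add, _root_.add_apply, map_smul,
        map_smul, fderiv_fderiv_apply hσ hG.isOpen hx, covD_id, hess_apply]
      simp only [fderiv_fun_const, Pi.zero_apply, _root_.zero_apply, zero_add, _root_.smul_apply,
        smul_eq_mul]
      ring
    have hS2 : G x (covD G id (fun y => (-G y v w) • gradE G σ y) x u) z
        = - (G x (chris G x u v) w + G x v (chris G x u w)) * θ z - G x v w * hess G σ x u z := by
      rw [covD_smul dG1.fun_neg dgr, map_add, _root_.add_apply, map_smul, map_smul, _root_.smul_apply,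
        _root_.smul_apply, covD_gradE hG hx hσ, fderiv_fun_neg, _root_.neg_apply,
        fderiv_bil_apply hG.smooth hG.isOpen hx, hG.fderiv_eq hx, dot_grad]
      simp only [smul_eq_mul]
      ring
    rw [covD_id, chris_exp hG hσ hx, fderiv_congr_on hG.isOpen hx hc, hc x hx]
    -- The Christoffel terms are added and subtracted so that each summand becomes a covariant
    -- derivative for `G`; the vector A is then chosen so that the remainder is B alone.
    have split : ∀ A B : E 2, fderiv ℝ (fun y => chris G y v w + ((fderiv ℝ σ y v • w
          + fderiv ℝ σ y w • v) + (-G y v w) • gradE G σ y)) x u + (chris G x u A + B)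
        = (covD G id (fun y => chris G y v w) x u
          + (covD G id (fun y => fderiv ℝ σ y v • w) x u
            + covD G id (fun y => fderiv ℝ σ y w • v) x u)
          + covD G id (fun y => (-G y v w) • gradE G σ y) x u)
          + (chris G x u A - chris G x u (chris G x v w + ((fderiv ℝ σ x v • w
          + fderiv ℝ σ x w • v) + (-G x v w) • gradE G σ x)) + B) := fun A B => by
      rw [fderiv_fun_add (hΓ v w) (((d1 v w).fun_add (d1 w v)).fun_add d2),
        fderiv_fun_add ((d1 v w).fun_add (d1 w v)) d2, fderiv_fun_add (d1 v w) (d1 w v)]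
      simp only [covD_id, map_add, _root_.add_apply]
      abel
    rw [split, sub_self, zero_add, map_add, _root_.add_apply, map_add, _root_.add_apply, map_add,
      _root_.add_apply, map_add, _root_.add_apply, hS, hS, hS2]
    simp only [map_add, map_sub, map_smul, _root_.add_apply, _root_.sub_apply, _root_.smul_apply,
      smul_eq_mul, dot_grad, ← h_θ, sG u (chris G x v w), sG u w, sG u v, sG u (gradE G σ x)]
    ring
  have hK' := gaussK_spec hG' hx e₁ e₂
  rw [← curvature_eq_curvL hG' hx, curvature_eq_covD] at hK'
  have hK := gaussK_spec hG hx e₁ e₂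
  rw [← curvature_eq_curvL hG hx, curvature_eq_covD, map_sub, _root_.sub_apply, he.one, he.two,
    he.orth] at hK
  simp only [_root_.smul_apply, map_sub, _root_.sub_apply, smul_eq_mul, key, he.one, he.two,
    he.orth, sG e₂ e₁] at hK'
  have hexp := he.expand hin (gradE G σ x)
  have hnorm : θ (gradE G σ x) = θ e₁ ^ 2 + θ e₂ ^ 2 := by
    conv_lhs => rw [hexp]
    simp only [map_add, map_smul, smul_eq_mul, dot_grad]
    ring
  have hlap : lapE G σ x = -(hess G σ x e₁ e₁ + hess G σ x e₂ e₂) := by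
    rw [lapE, he.metricTrace hin]
  have hne := (Real.exp_pos (2 * σ x)).ne'
  rw [Real.exp_neg, hlap]
  field_simp
  refine mul_left_cancel₀ hne ?_
  rw [hnorm, hG.chris_symm hx e₂ e₁, hess_symm hG hx hσ e₂ e₁,
    sG e₂ (chris G x e₁ e₂), sG e₁ (chris G x e₂ e₂)] at hK'
  linear_combination -hK' + Real.exp (2 * σ x) * hK

end Conformal

/-! ### The intrinsic geometry of biconservative surfaces -/

/-- The first and second fundamental forms `G`, `b` of a biconservative surface in a space form of
curvature `c`, with mean curvature function `f` without critical points. -/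
structure BiconsOn (c : ℝ) (G b : E 2 → Bil 2) (f : E 2 → ℝ) (U : Set (E 2)) : Prop where
  metric : MetricOn G U
  smooth : ContDiffOn ℝ ∞ b U
  symm : ∀ x ∈ U, ∀ v w, b x v w = b x w v
  codazzi : ∀ x ∈ U, ∀ u v w, nablaBil G b x u v w = nablaBil G b x v u w
  gauss : ∀ x ∈ U, ∀ u v, gaussK G x * (G x u u * G x v v - G x u v ^ 2)
    = c * (G x u u * G x v v - G x u v ^ 2) + b x u u * b x v v - b x u v ^ 2
  trace : ∀ x ∈ U, f x = metricTrace (G x) (fun v w => b x v w)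
  pos : ∀ x ∈ U, 0 < f x
  grad_ne : ∀ x ∈ U, fderiv ℝ f x ≠ 0
  eigen : ∀ x ∈ U, ∀ z, b x (gradE G f x) z = -(f x / 2) * fderiv ℝ f x z

/-- The squared norm of the gradient. -/
def gradSq {n : ℕ} (G : E n → Bil n) (f : E n → ℝ) (x : E n) : ℝ :=
  G x (gradE G f x) (gradE G f x)

theorem smooth_gradSq {n : ℕ} {G : E n → Bil n} {f : E n → ℝ} {U : Set (E n)} (hG : MetricOn G U)
    (hf : ContDiffOn ℝ ∞ f U) : ContDiffOn ℝ ∞ (gradSq G f) U :=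
  (hG.smooth.clm_apply (smooth_gradE hG hf)).clm_apply (smooth_gradE hG hf)

/-! ### The Hessian of the mean curvature function and the first integral -/

namespace BiconsOn

variable {c : ℝ} {G b : E 2 → Bil 2} {f : E 2 → ℝ} {U : Set (E 2)} {x : E 2}
  (h : BiconsOn c G b f U)

include h

theorem smooth_f : ContDiffOn ℝ ∞ f U :=
  (smooth_metricTrace h.metric h.smooth).congr h.trace

theorem gradE_ne (hx : x ∈ U) : gradE G f x ≠ 0 := fun h0 => h.grad_ne x hx <| by
  ext1 v
  rw [← gradE_inner h.metric hx, h0]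
  simp

theorem gradSq_pos (hx : x ∈ U) : 0 < gradSq G f x :=
  (h.metric.inner x hx).pos _ (h.gradE_ne hx)

theorem exists_frame (hx : x ∈ U) : ∃ (N : ℝ) (e₁ e₂ : E 2), 0 < N ∧ N ^ 2 = gradSq G f x ∧
    gradE G f x = N • e₁ ∧ IsFrame (G x) e₁ e₂ := by
  have hpos := h.gradSq_pos hx
  have hs : √(gradSq G f x) ≠ 0 := (Real.sqrt_pos.2 hpos).ne'
  have h1 : G x ((√(gradSq G f x))⁻¹ • gradE G f x) ((√(gradSq G f x))⁻¹ • gradE G f x) = 1 := by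
    simp only [map_smul, _root_.smul_apply, smul_eq_mul]
    field_simp
    exact (Real.sq_sqrt hpos.le).symm
  obtain ⟨e₂, he⟩ := exists_isFrame (h.metric.inner x hx) h1
  exact ⟨_, _, e₂, Real.sqrt_pos.2 hpos, Real.sq_sqrt hpos.le, by rw [smul_inv_smul₀ hs], he⟩

section AtPoint

variable {N : ℝ} {e₁ e₂ : E 2} (hx : x ∈ U) (hN : 0 < N) (hg : gradE G f x = N • e₁)
  (he : IsFrame (G x) e₁ e₂)

include hx hg he

theorem fderiv_e₁ : fderiv ℝ f x e₁ = N := by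
  rw [← gradE_inner h.metric hx, hg, map_smul, _root_.smul_apply, he.one, smul_eq_mul, mul_one]

theorem fderiv_e₂ : fderiv ℝ f x e₂ = 0 := by
  rw [← gradE_inner h.metric hx, hg, map_smul, _root_.smul_apply, he.orth, smul_zero]

include hN

/-- The eigenvalue -f/2 belongs to e₁, and the trace f leaves 3f/2 for e₂. With the Gauss equation
this makes c - K equal to 3f²/4. -/
theorem b_frame : b x e₁ e₁ = -(f x / 2) ∧ b x e₁ e₂ = 0 ∧ b x e₂ e₂ = 3 / 2 * f x := by
  have h1 := h.eigen x hx e₁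
  have h2 := h.eigen x hx e₂
  rw [hg, map_smul, _root_.smul_apply, smul_eq_mul, h.fderiv_e₁ hx hg he] at h1
  rw [hg, map_smul, _root_.smul_apply, smul_eq_mul, h.fderiv_e₂ hx hg he] at h2
  have b11 : b x e₁ e₁ = -(f x / 2) := mul_left_cancel₀ hN.ne' (by linarith)
  have b12 : b x e₁ e₂ = 0 := mul_left_cancel₀ hN.ne' (by linarith)
  have ht := h.trace x hx
  rw [he.metricTrace (h.metric.inner x hx)] at ht
  exact ⟨b11, b12, by linarith⟩

theorem gaussK_of_frame : gaussK G x = c - 3 / 4 * f x ^ 2 := by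
  obtain ⟨b11, b12, b22⟩ := h.b_frame hx hN hg he
  have := h.gauss x hx e₁ e₂
  rw [he.one, he.two, he.orth, b11, b12, b22] at this
  linarith

theorem hess_frame : hess G f x e₁ e₂ = 0 ∧ hess G f x e₂ e₂ = -(3 * N ^ 2 / (4 * f x)) := by
  have hf := h.smooth_f
  have hG := h.metric
  have hin := hG.inner x hx
  have fpos := h.pos x hx
  obtain ⟨b11, b12, b22⟩ := h.b_frame hx hN hg he
  have d1 := h.fderiv_e₁ hx hg he
  have d2 := h.fderiv_e₂ hx hg he
  -- The derivative of the eigenvalue equation b(grad f, ·) = -(f/2) df in the direction u.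
  have key : ∀ u z, N * nablaBil G b x u e₁ z + b x (covD G id (gradE G f) x u) z
      = -(1 / 2) * fderiv ℝ f x u * fderiv ℝ f x z - f x / 2 * hess G f x u z := fun u z => by
    have e1 := fderiv_bil_along (G := G) h.smooth hG.isOpen hx (smooth_gradE hG hf) u z
    have hE : ∀ y ∈ U, b y (gradE G f y) z = (-(1 / 2) * f y) * fderiv ℝ f y z := fun y hy => by
      rw [h.eigen y hy]; ring
    rw [fderiv_congr_on hG.isOpen hx hE, hg] at e1
    have df := smooth_diffAt hf hG.isOpen hx
    have df' := smooth_diffAt (smooth_fderiv hf hG.isOpen) hG.isOpen hx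
    have e2 : HasFDerivAt (fun y => (-(1 / 2) * f y) * fderiv ℝ f y z) _ x :=
      (df.hasFDerivAt.const_mul (-(1 / 2))).mul (df'.clm_apply (by fun_prop : DifferentiableAt ℝ
        (fun _ => z) x)).hasFDerivAt
    rw [e2.fderiv] at e1
    simp only [_root_.add_apply, _root_.smul_apply, smul_eq_mul,
      fderiv_fderiv_apply hf hG.isOpen hx, map_smul] at e1
    have e3 : b x e₁ (chris G x u z) = -(1 / 2) * f x * G x e₁ (chris G x u z) := by
      have := h.eigen x hx (chris G x u z)
      rw [← gradE_inner hG hx, hg] at this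
      simp only [map_smul, _root_.smul_apply, smul_eq_mul] at this
      refine mul_left_cancel₀ hN.ne' ?_
      linarith
    have e4 : fderiv ℝ f x (chris G x u z) = N * G x e₁ (chris G x u z) := by
      rw [← gradE_inner hG hx, hg, map_smul, _root_.smul_apply, smul_eq_mul]
    rw [e3] at e1
    rw [hess_apply, e4]
    linarith
  have b21 : b x e₂ e₁ = 0 := by rw [h.symm x hx, b12]
  have hb : ∀ u, covD G id (gradE G f) x u = hess G f x u e₁ • e₁ + hess G f x u e₂ • e₂ :=
    fun u => by
      conv_lhs => rw [he.expand hin (covD G id (gradE G f) x u)]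
      rw [covD_gradE hG hx hf, covD_gradE hG hx hf]
  have hb1 : ∀ u, b x (covD G id (gradE G f) x u) e₁ = hess G f x u e₁ * -(f x / 2) := fun u => by
    rw [hb]; simp [b11, b21]
  have hb2 : ∀ u, b x (covD G id (gradE G f) x u) e₂ = hess G f x u e₂ * (3 / 2 * f x) :=
    fun u => by rw [hb]; simp [b12, b22]
  have k11 := key e₁ e₁
  have k21 := key e₂ e₁
  have k12 := key e₁ e₂
  have k22 := key e₂ e₂
  rw [hb1, d1] at k11
  rw [hb1, d1, d2] at k21
  rw [hb2, d1, d2] at k12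
  rw [hb2, d2] at k22
  have c1 := h.codazzi x hx e₁ e₂ e₁
  have c2 := h.codazzi x hx e₁ e₂ e₂
  have s1 := nablaBil_symm (G := G) h.smooth hG.isOpen hx h.symm e₁ e₁ e₂
  have s2 := nablaBil_symm (G := G) h.smooth hG.isOpen hx h.symm e₁ e₂ e₁
  have tr := fderiv_metricTrace hG h.smooth hx e₁
  rw [← fderiv_congr_on hG.isOpen hx h.trace, he.metricTrace hin, d1] at tr
  constructor
  · have n0 : N * nablaBil G b x e₂ e₁ e₁ = 0 := by linarith
    have : f x * hess G f x e₁ e₂ = 0 := by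
      have : nablaBil G b x e₁ e₁ e₂ = nablaBil G b x e₂ e₁ e₁ := by linarith
      rw [this] at k12
      linarith
    exact (mul_eq_zero.1 this).resolve_left fpos.ne'
  -- Of ∇_{e₁} tr b = e₁(f) = N, the (e₁, e₁) entry takes -N/2 and leaves 3N/2 for the (e₂, e₂)
  -- entry, which equals (∇_{e₂} b)(e₁, e₂) by Codazzi. Then `k22` gives the Hessian.
  · have n1 : nablaBil G b x e₁ e₁ e₁ = -(N / 2) := mul_left_cancel₀ hN.ne' (by linarith)
    have n2 : nablaBil G b x e₂ e₁ e₂ = 3 / 2 * N := by linarith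
    rw [n2] at k22
    field_simp
    linarith

end AtPoint

theorem gaussK_eq (hx : x ∈ U) : gaussK G x = c - 3 / 4 * f x ^ 2 := by
  obtain ⟨N, e₁, e₂, hN, -, hg, he⟩ := h.exists_frame hx
  exact h.gaussK_of_frame hx hN hg he

/-- The covariant derivative of the gradient of the mean curvature function. -/
theorem covD_grad (hx : x ∈ U) (u : E 2) : covD G id (gradE G f) x u
    = (-(3 / 4) * (gradSq G f x * (f x)⁻¹)) • u
      + (((hess G f x (gradE G f x) (gradE G f x) * (gradSq G f x)⁻¹
          - -(3 / 4) * (gradSq G f x * (f x)⁻¹)) * (gradSq G f x)⁻¹) * fderiv ℝ f x u)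
        • gradE G f x := by
  obtain ⟨N, e₁, e₂, hN, hN2, hg, he⟩ := h.exists_frame hx
  have hf := h.smooth_f
  have hG := h.metric
  have hin := hG.inner x hx
  obtain ⟨h12, h22⟩ := h.hess_frame hx hN hg he
  have d1 := h.fderiv_e₁ hx hg he
  have d2 := h.fderiv_e₂ hx hg he
  have fpos := h.pos x hx
  have h21 : hess G f x e₂ e₁ = 0 := by rw [hess_symm hG hx hf, h12]
  -- The Hessian is diagonal in the frame. Its entries are written through `gradSq` and grad f, not
  -- through the frame, so that the formula has smooth coefficients on `U` and can be differentiated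
  -- again.
  have hu := he.expand hin u
  set s := G x u e₁
  set t := G x u e₂
  have e1 : hess G f x u e₁ = s * hess G f x e₁ e₁ := by rw [hu]; simp [h21]
  have e2 : hess G f x u e₂ = t * -(3 * N ^ 2 / (4 * f x)) := by rw [hu]; simp [h12, h22]
  have e3 : fderiv ℝ f x u = s * N := by rw [hu]; simp [d1, d2]
  rw [he.expand hin (covD G id (gradE G f) x u), covD_gradE hG hx hf, covD_gradE hG hx hf, e1, e2,
    e3, hg, ← hN2]
  conv_rhs => rw [hu]
  simp only [map_smul, _root_.smul_apply, smul_eq_mul, smul_add, smul_smul]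
  rw [add_right_comm, ← add_smul]
  congr 2
  · field_simp
    ring
  · field_simp

/-- The Ricci identity for ∇f: with ∇_u ∇f = α u + β df(u) ∇f, the commutator for (e₁, e₂) paired
with e₂ reads e₁(α) - β N Hess f(e₂, e₂) = -N K. Since α = -(3/4)|∇f|²/f and e₁(|∇f|²) = 2N Hess
f(e₁, e₁), this is a linear equation for Hess f(e₁, e₁). -/
theorem hess_e₁ {N : ℝ} {e₁ e₂ : E 2} (hx : x ∈ U) (hN : 0 < N) (hg : gradE G f x = N • e₁)
    (he : IsFrame (G x) e₁ e₂) :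
    hess G f x e₁ e₁ = 7 / 4 * (N ^ 2 / f x) + 4 / 3 * (c * f x) - f x ^ 3 := by
  have hf := h.smooth_f
  have hG := h.metric
  have hin := hG.inner x hx
  obtain ⟨h12, h22⟩ := h.hess_frame hx hN hg he
  have d1 := h.fderiv_e₁ hx hg he
  have d2 := h.fderiv_e₂ hx hg he
  have fpos := h.pos x hx
  have sQ := smooth_gradSq hG hf
  have hQ : gradSq G f x = N ^ 2 := by
    rw [gradSq, hg]; simp [he.one]; ring
  have sgr := smooth_gradE hG hf
  set α : E 2 → ℝ := fun y => -(3 / 4) * (gradSq G f y * (f y)⁻¹) with hα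
  set β : E 2 → ℝ := fun y => (hess G f y (gradE G f y) (gradE G f y) * (gradSq G f y)⁻¹
    - -(3 / 4) * (gradSq G f y * (f y)⁻¹)) * (gradSq G f y)⁻¹ with hβ
  have sα : ContDiffOn ℝ ∞ α U :=
    contDiffOn_const.mul (sQ.mul (hf.inv fun y hy => (h.pos y hy).ne'))
  have sβ : ContDiffOn ℝ ∞ β U :=
    ((((smooth_hess_apply hG hf sgr sgr).mul (sQ.inv fun y hy => (h.gradSq_pos hy).ne'))).sub
      sα).mul (sQ.inv fun y hy => (h.gradSq_pos hy).ne')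
  have hcov : ∀ u, ∀ y ∈ U, covD G id (gradE G f) y u
      = α y • u + (β y * fderiv ℝ f y u) • gradE G f y := fun u y hy => h.covD_grad hy u
  have dα := smooth_diffAt sα hG.isOpen hx
  have key : ∀ v u, G x (covD G id (fun y => covD G id (gradE G f) y v) x u) e₂
      = fderiv ℝ α x u * G x v e₂ + α x * G x (chris G x u v) e₂
        + β x * fderiv ℝ f x v * hess G f x u e₂ := fun v u => by
    have sβv : ContDiffOn ℝ ∞ (fun y => β y * fderiv ℝ f y v) U :=
      sβ.mul ((smooth_fderiv hf hG.isOpen).clm_apply contDiffOn_const)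
    rw [covD_congr hG.isOpen hx (hcov v), covD_add (dα.fun_smul (by fun_prop))
      ((smooth_diffAt sβv hG.isOpen hx).fun_smul (smooth_diffAt sgr hG.isOpen hx)),
      _root_.add_apply, covD_smul dα (by fun_prop), covD_smul (smooth_diffAt sβv hG.isOpen hx)
        (smooth_diffAt sgr hG.isOpen hx), covD_id (ξ := fun _ => v)]
    simp only [map_add, map_smul, _root_.add_apply, _root_.smul_apply, smul_eq_mul,
      fderiv_fun_const, Pi.zero_apply, _root_.zero_apply, zero_add, gradE_inner hG hx, d2, mul_zero,
      covD_gradE hG hx hf]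
  have hcomm := congrArg (fun t => G x t e₂)
    (covD_comm hG (mapOn_id hG.isOpen) hx sgr e₁ e₂)
  simp only [map_sub, _root_.sub_apply, key, fderiv_id, id, ContinuousLinearMap.coe_id', he.two,
    he.orth, d1, d2, hG.chris_symm hx e₂ e₁, h12, h22, curvature_eq_curvL hG hx, hg, map_smul,
    _root_.smul_apply, smul_eq_mul] at hcomm
  have hK := gaussK_spec hG hx e₁ e₂
  rw [curvL_skew hG hx, he.one, he.two, he.orth, h.gaussK_eq hx] at hK
  have dQ : fderiv ℝ (gradSq G f) x e₁ = 2 * (N * hess G f x e₁ e₁) := by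
    have := fderiv_normSq_gradE hG hx hf e₁
    rw [hg, map_smul, smul_eq_mul] at this
    exact this
  have dα1 : fderiv ℝ α x e₁ = -(3 / 4) * (N ^ 2 * (-N * (f x ^ 2)⁻¹)
      + (f x)⁻¹ * (2 * (N * hess G f x e₁ e₁))) := by
    have e1 := ((smooth_diffAt sQ hG.isOpen hx).hasFDerivAt.mul
      ((hasDerivAt_inv fpos.ne').comp_hasFDerivAt x
        (smooth_diffAt hf hG.isOpen hx).hasFDerivAt)).const_mul (-(3 / 4))
    have e2 : fderiv ℝ α x = _ := e1.fderiv
    rw [e2]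
    simp only [_root_.add_apply, _root_.smul_apply, smul_eq_mul, d1, dQ, hQ, Function.comp]
    ring
  have hβx : β x = (hess G f x e₁ e₁ - -(3 / 4) * (N ^ 2 * (f x)⁻¹)) * (N ^ 2)⁻¹ := by
    simp only [hβ, hQ, hg, map_smul, _root_.smul_apply, smul_eq_mul]
    field_simp
  rw [dα1, hβx] at hcomm
  have hr : G x (curvL G x e₁ e₂ e₁) e₂ = -(c - 3 / 4 * f x ^ 2) := by linarith
  rw [hr] at hcomm
  field_simp at hcomm ⊢
  refine mul_left_cancel₀ (pow_ne_zero 3 hN.ne') ?_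
  linear_combination -hcomm

/-- The Hessian of the mean curvature function in the direction of its gradient. -/
theorem hess_grad (hx : x ∈ U) (v : E 2) : hess G f x v (gradE G f x)
    = (7 / 4 * (gradSq G f x / f x) + 4 / 3 * (c * f x) - f x ^ 3) * fderiv ℝ f x v := by
  obtain ⟨N, e₁, e₂, hN, hN2, hg, he⟩ := h.exists_frame hx
  have hG := h.metric
  obtain ⟨h12, h22⟩ := h.hess_frame hx hN hg he
  have h21 : hess G f x e₂ e₁ = 0 := by rw [hess_symm hG hx h.smooth_f, h12]
  rw [hg, ← hN2, ← h.hess_e₁ hx hN hg he, he.expand (hG.inner x hx) v]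
  simp [h21, h.fderiv_e₁ hx hg he, h.fderiv_e₂ hx hg he]
  ring

theorem lapE_f (hx : x ∈ U) :
    lapE G f x = -(gradSq G f x / f x) - 4 / 3 * ((c - 3 / 4 * f x ^ 2) * f x) := by
  obtain ⟨N, e₁, e₂, hN, hN2, hg, he⟩ := h.exists_frame hx
  have fpos := h.pos x hx
  obtain ⟨h12, h22⟩ := h.hess_frame hx hN hg he
  rw [lapE, he.metricTrace (h.metric.inner x hx), h.hess_e₁ hx hN hg he, h22, ← hN2]
  field_simp
  ring

/-- The first integral of the equation for the mean curvature function. -/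
theorem fderiv_first_integral (hx : x ∈ U) :
    fderiv ℝ (fun y => (9 / 16 * gradSq G f y + c * f y ^ 2 + 9 / 4 * f y ^ 4)
      * f y ^ (-(7 / 2) : ℝ)) x = 0 := by
  have hG := h.metric
  have hf := h.smooth_f
  have fpos := h.pos x hx
  have df := (smooth_diffAt hf hG.isOpen hx).hasFDerivAt
  have dQ := (smooth_diffAt (smooth_gradSq hG hf) hG.isOpen hx).hasFDerivAt
  have e1 := (((dQ.const_mul (9 / 16)).add ((df.pow 2).const_mul c)).add
    ((df.pow 4).const_mul (9 / 4))).mul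
    (df.rpow_const (p := -(7 / 2)) (Or.inl fpos.ne'))
  have e2 : fderiv ℝ (fun y => (9 / 16 * gradSq G f y + c * f y ^ 2 + 9 / 4 * f y ^ 4)
      * f y ^ (-(7 / 2) : ℝ)) x = _ := e1.fderiv
  rw [e2]
  ext1 v
  have dQv : fderiv ℝ (gradSq G f) x v = 2 * ((7 / 4 * (gradSq G f x / f x) + 4 / 3 * (c * f x)
      - f x ^ 3) * fderiv ℝ f x v) := by
    rw [← h.hess_grad hx]
    exact fderiv_normSq_gradE hG hx hf v
  -- The power rule produces the exponent -9/2; all terms are brought to it.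
  have hp : f x ^ (-(7 / 2) : ℝ) = f x * f x ^ (-(7 / 2) - 1 : ℝ) := by
    rw [Real.rpow_sub_one fpos.ne']
    field_simp
  simp only [_root_.add_apply, _root_.smul_apply, smul_eq_mul, dQv, hp, Pi.add_apply, _root_.zero_apply,
    nsmul_eq_mul]
  push_cast
  field_simp
  ring

end BiconsOn

/-! ### Maps between manifolds in charts -/

section Charts

variable {m n : ℕ} {M : Type*} [TopologicalSpace M] [ChartedSpace (E m) M]
  {N : Type*} [TopologicalSpace N] [ChartedSpace (E n) N]

/-- The derivative at `q` of the chart at `p`. -/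
def chartDeriv (p q : M) : E m →L[ℝ] E m := mfderiv (𝓡 m) 𝓘(ℝ, E m) (extChartAt (𝓡 m) p) q

/-- The derivative of a map between manifolds, as a map between the model spaces. -/
def diffl (m n : ℕ) {M : Type*} [TopologicalSpace M] [ChartedSpace (E m) M]
    {N : Type*} [TopologicalSpace N] [ChartedSpace (E n) N] (ψ : M → N) (q : M) : E m →L[ℝ] E n :=
  mfderiv (𝓡 m) (𝓡 n) ψ q

/-- The derivative of a function on a manifold, as a covector of the model space. -/
def dif (u : M → ℝ) (q : M) : E m →L[ℝ] ℝ := mvfderiv (𝓡 m) u q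

/-- The map `ψ` in the charts at `a` and at `b`. -/
def chartRep (a : M) (b : N) (ψ : M → N) (x : E m) : E n :=
  extChartAt (𝓡 n) b (ψ ((extChartAt (𝓡 m) a).symm x))

/-- The points of the chart at `a` whose images under `ψ` are in the chart at `b`. -/
def chartDom (a : M) (b : N) (ψ : M → N) : Set (E m) :=
  (extChartAt (𝓡 m) a).target ∩
    (extChartAt (𝓡 m) a).symm ⁻¹' (ψ ⁻¹' (extChartAt (𝓡 n) b).source)

theorem isOpen_chartPre (a : M) {V : Set M} (hV : IsOpen V) :
    IsOpen ((extChartAt (𝓡 m) a).target ∩ (extChartAt (𝓡 m) a).symm ⁻¹' V) :=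
  (continuousOn_extChartAt_symm a).isOpen_inter_preimage (isOpen_extChartAt_target a) hV

theorem isOpen_chartDom (a : M) (b : N) {ψ : M → N} (hψ : Continuous ψ) :
    IsOpen (chartDom (m := m) (n := n) a b ψ) :=
  isOpen_chartPre a ((isOpen_extChartAt_source b).preimage hψ)

/-! ### Charts, their frames and coordinate changes -/

section Frames

variable [IsManifold (𝓡 m) ∞ M]

theorem mdifferentiableAt_chart_symm {a : M} {x : E m} (hx : x ∈ (extChartAt (𝓡 m) a).target) :
    MDifferentiableAt 𝓘(ℝ, E m) (𝓡 m) (extChartAt (𝓡 m) a).symm x :=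
  ((contMDiffOn_extChartAt_symm (n := ∞) a).contMDiffAt
    ((isOpen_extChartAt_target a).mem_nhds hx)).mdifferentiableAt (by simp)

theorem mdifferentiableAt_chart {a q : M} (hq : q ∈ (extChartAt (𝓡 m) a).source) :
    MDifferentiableAt (𝓡 m) 𝓘(ℝ, E m) (extChartAt (𝓡 m) a) q :=
  mdifferentiableAt_extChartAt (by rwa [extChartAt_source] at hq)

theorem chartDeriv_coordFrame {a : M} {x : E m} (hx : x ∈ (extChartAt (𝓡 m) a).target) (v : E m) :
    chartDeriv a ((extChartAt (𝓡 m) a).symm x) (coordFrame a x v) = v := by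
  have h := mfderiv_extChartAt_comp_mfderivWithin_extChartAt_symm (I := 𝓡 m) hx
  rw [show range (𝓡 m) = univ from range_id, mfderivWithin_univ] at h
  exact DFunLike.congr_fun h v

theorem coordFrame_chartDeriv {a : M} {x : E m} (hx : x ∈ (extChartAt (𝓡 m) a).target) (v : E m) :
    coordFrame a x (chartDeriv a ((extChartAt (𝓡 m) a).symm x) v) = v := by
  have h := mfderivWithin_extChartAt_symm_comp_mfderiv_extChartAt (I := 𝓡 m) hx
  rw [show range (𝓡 m) = univ from range_id, mfderivWithin_univ] at h
  exact DFunLike.congr_fun h v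

/-- The tangent space at a is identified with the model space through the chart at a itself, so this
chart has identity derivative at its own centre. -/
theorem chartDeriv_self (a : M) (v : E m) : chartDeriv a a v = v := by
  have h := mfderiv_extChartAt_self (I := 𝓡 m) (x := a)
  exact DFunLike.congr_fun h v

theorem coordFrame_self (a : M) (v : E m) : coordFrame a (extChartAt (𝓡 m) a a) v = v := by
  have h := chartDeriv_coordFrame (mem_extChartAt_target (I := 𝓡 m) a) v
  rwa [extChartAt_to_inv, chartDeriv_self] at h

/-- The frame of a chart as a linear equivalence. -/
def frameEquiv {a : M} {x : E m} (hx : x ∈ (extChartAt (𝓡 m) a).target) : E m ≃L[ℝ] E m :=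
  ContinuousLinearEquiv.equivOfInverse (coordFrame a x)
    (chartDeriv a ((extChartAt (𝓡 m) a).symm x)) (chartDeriv_coordFrame hx)
    (coordFrame_chartDeriv hx)

theorem frameEquiv_apply {a : M} {x : E m} (hx : x ∈ (extChartAt (𝓡 m) a).target) (v : E m) :
    frameEquiv hx v = coordFrame a x v := rfl

theorem frameEquiv_coe {a : M} {x : E m} (hx : x ∈ (extChartAt (𝓡 m) a).target) :
    (frameEquiv hx : E m →L[ℝ] E m) = coordFrame a x := rfl

theorem fderiv_chartFun {a : M} {u : M → ℝ} {x : E m} (hx : x ∈ (extChartAt (𝓡 m) a).target)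
    (hu : MDifferentiableAt (𝓡 m) 𝓘(ℝ, ℝ) u ((extChartAt (𝓡 m) a).symm x)) (v : E m) :
    fderiv ℝ (fun y => u ((extChartAt (𝓡 m) a).symm y)) x v
      = dif u ((extChartAt (𝓡 m) a).symm x) (coordFrame a x v) := by
  have h := mfderiv_comp x hu (mdifferentiableAt_chart_symm hx)
  rw [mfderiv_eq_fderiv] at h
  exact DFunLike.congr_fun h v

variable [IsManifold (𝓡 n) ∞ N]

theorem fderiv_chartRep {a : M} {b : N} {ψ : M → N} {x : E m}
    (hx : x ∈ chartDom (m := m) (n := n) a b ψ)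
    (hψ : MDifferentiableAt (𝓡 m) (𝓡 n) ψ ((extChartAt (𝓡 m) a).symm x)) (v : E m) :
    fderiv ℝ (chartRep a b ψ) x v = chartDeriv b (ψ ((extChartAt (𝓡 m) a).symm x))
      (diffl m n ψ ((extChartAt (𝓡 m) a).symm x) (coordFrame a x v)) := by
  have h1 := hψ.comp x (mdifferentiableAt_chart_symm hx.1)
  have h := mfderiv_comp x (mdifferentiableAt_chart (m := n) hx.2) h1
  rw [mfderiv_comp x hψ (mdifferentiableAt_chart_symm hx.1), mfderiv_eq_fderiv] at h
  exact DFunLike.congr_fun h v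

theorem smooth_chartRep (a : M) (b : N) {ψ : M → N} (hψ : ContMDiff (𝓡 m) (𝓡 n) ∞ ψ) :
    ContDiffOn ℝ ∞ (chartRep (m := m) (n := n) a b ψ) (chartDom (m := m) (n := n) a b ψ) := by
  rw [← contMDiffOn_iff_contDiffOn]
  have h1 : ContMDiffOn 𝓘(ℝ, E m) (𝓡 n) ∞ (fun x => ψ ((extChartAt (𝓡 m) a).symm x))
      (chartDom (m := m) (n := n) a b ψ) :=
    hψ.comp_contMDiffOn ((contMDiffOn_extChartAt_symm a).mono inter_subset_left)
  have h2 := contMDiffOn_extChartAt (I := 𝓡 n) (n := ∞) (x := b)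
  rw [← extChartAt_source (𝓡 n)] at h2
  exact h2.comp h1 fun x hx => hx.2

theorem chartRep_frame {a : M} {b : N} {ψ : M → N} {x : E m}
    (hx : x ∈ chartDom (m := m) (n := n) a b ψ)
    (hψ : MDifferentiableAt (𝓡 m) (𝓡 n) ψ ((extChartAt (𝓡 m) a).symm x)) (v : E m) :
    coordFrame b (chartRep a b ψ x) (fderiv ℝ (chartRep a b ψ) x v)
      = diffl m n ψ ((extChartAt (𝓡 m) a).symm x) (coordFrame a x v) := by
  rw [fderiv_chartRep hx hψ]
  have hy : chartRep a b ψ x ∈ (extChartAt (𝓡 n) b).target := (extChartAt (𝓡 n) b).map_source hx.2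
  have h := coordFrame_chartDeriv hy
  rw [show (extChartAt (𝓡 n) b).symm (chartRep a b ψ x) = ψ ((extChartAt (𝓡 m) a).symm x) from
    (extChartAt (𝓡 n) b).left_inv hx.2] at h
  exact h _

omit [IsManifold (𝓡 m) ∞ M] [IsManifold (𝓡 n) ∞ N] in
theorem mapsTo_chartRep (a : M) (b : N) (ψ : M → N) :
    MapsTo (chartRep (m := m) (n := n) a b ψ) (chartDom (m := m) (n := n) a b ψ)
      (extChartAt (𝓡 n) b).target :=
  fun _ hx => (extChartAt (𝓡 n) b).map_source hx.2

theorem immOn_chartRep (a : M) (b : N) {ψ : M → N} (hψ : ContMDiff (𝓡 m) (𝓡 n) ∞ ψ)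
    (hinj : ∀ q, Function.Injective (diffl m n ψ q)) :
    ImmOn (chartRep (m := m) (n := n) a b ψ) (chartDom (m := m) (n := n) a b ψ)
      (extChartAt (𝓡 n) b).target where
  isOpen := isOpen_chartDom a b hψ.continuous
  smooth := smooth_chartRep a b hψ
  mapsTo := mapsTo_chartRep a b ψ
  inj x hx v w hvw := by
    have h := congrArg (coordFrame b (chartRep a b ψ x)) hvw
    rw [chartRep_frame hx ((hψ _).mdifferentiableAt (by simp)),
      chartRep_frame hx ((hψ _).mdifferentiableAt (by simp))] at h
    exact (frameEquiv hx.1).injective (hinj _ h)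

omit [IsManifold (𝓡 m) ∞ M] in
theorem coordMetric_apply (g : BilField m M) (a : M) (x v w : E m) :
    coordMetric g a x v w
      = g.toBil ((extChartAt (𝓡 m) a).symm x) (coordFrame a x v) (coordFrame a x w) := rfl

theorem coordMetric_self (g : BilField m M) (a : M) :
    coordMetric g a (extChartAt (𝓡 m) a a) = g.toBil a := by
  ext v w
  rw [coordMetric_apply, coordFrame_self, coordFrame_self, extChartAt_to_inv]

/-- The metric induced by an immersion, in charts. -/
theorem coordMetric_pull {g : BilField m M} {h : BilField n N} {a : M} {b : N} {ψ : M → N}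
    (hψ : ContMDiff (𝓡 m) (𝓡 n) ∞ ψ)
    (hg : ∀ q v w, g.toBil q v w = h.toBil (ψ q) (diffl m n ψ q v) (diffl m n ψ q w)) {x : E m}
    (hx : x ∈ chartDom (m := m) (n := n) a b ψ) :
    coordMetric g a x = pull (coordMetric h b) (chartRep a b ψ) x := by
  ext v w
  rw [coordMetric_apply, pull_apply, coordMetric_apply,
    chartRep_frame hx ((hψ _).mdifferentiableAt (by simp)),
    chartRep_frame hx ((hψ _).mdifferentiableAt (by simp)), hg,
    show (extChartAt (𝓡 n) b).symm (chartRep a b ψ x) = ψ ((extChartAt (𝓡 m) a).symm x) from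
      (extChartAt (𝓡 n) b).left_inv hx.2]

omit [IsManifold (𝓡 m) ∞ M] in
theorem diffl_id (q : M) (v : E m) : diffl m m (id : M → M) q v = v := by
  have h := mfderiv_id (I := 𝓡 m) (x := q)
  exact DFunLike.congr_fun h v

/-- A coordinate change is the identity map read in two charts, hence an immersion in equal
dimensions; all naturality statements for local isometries then apply to it. -/
theorem immOn_transition (a b : M) : ImmOn (chartRep (m := m) (n := m) a b id)
    (chartDom (m := m) (n := m) a b id) (extChartAt (𝓡 m) b).target :=
  immOn_chartRep a b contMDiff_id fun q v w h => by rwa [diffl_id, diffl_id] at h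

theorem coordMetric_transition (g : BilField m M) {a b : M} {x : E m}
    (hx : x ∈ chartDom (m := m) (n := m) a b (id : M → M)) :
    coordMetric g a x = pull (coordMetric g b) (chartRep a b (id : M → M)) x :=
  coordMetric_pull contMDiff_id (fun q v w => by rw [diffl_id, diffl_id]; rfl) hx

end Frames

end Charts

/-! ### Locality -/

section Locality

variable {m n : ℕ} {G G' : E n → Bil n} {U : Set (E n)} {x : E n}

theorem chris_congr (hU : IsOpen U) (hx : x ∈ U) (h : ∀ y ∈ U, G y = G' y) :
    chris G x = chris G' x := by
  rw [chris, chris, h x hx, fderiv_congr_on hU hx h]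

theorem coordSectional_congr (hU : IsOpen U) (hx : x ∈ U) (h : ∀ y ∈ U, G y = G' y) (u v : E n) :
    coordSectional G x u v = coordSectional G' x u v := by
  have h1 : ∀ a b : E n, ∀ y ∈ U, christoffel G y a b = christoffel G' y a b := fun a b y hy => by
    rw [← chris_apply, ← chris_apply, chris_congr hU hy h]
  rw [coordSectional, coordSectional, h x hx, curvature, curvature,
    fderiv_congr_on hU hx (h1 v v), fderiv_congr_on hU hx (h1 u v), h1 _ _ x hx, h1 _ _ x hx,
    h1 _ _ x hx, h1 _ _ x hx]

theorem MetricOn.mono {V : Set (E n)} (hG : MetricOn G U) (hV : IsOpen V) (h : V ⊆ U) :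
    MetricOn G V :=
  ⟨hV, hG.smooth.mono h, fun x hx => hG.inner x (h hx)⟩

theorem MetricOn.congr (hG : MetricOn G U) (h : ∀ y ∈ U, G' y = G y) : MetricOn G' U :=
  ⟨hG.isOpen, hG.smooth.congr h, fun x hx => h x hx ▸ hG.inner x hx⟩

theorem ImmOn.mono {T : E m → E n} {V W : Set (E m)} {U' V' : Set (E n)} (hT : ImmOn T W U')
    (hV : IsOpen V) (h : V ⊆ W) (hm : MapsTo T V V') : ImmOn T V V' where
  isOpen := hV
  smooth := hT.smooth.mono h
  mapsTo := hm
  inj x hx := hT.inj x (h hx)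

/-- Naturality of the covariant derivative under reparametrizations and local isometries. -/
theorem covD_natural {H : E n → Bil n} {S : E n → E n} {ψ ξ : E m → E n} {T : E m → E m}
    {U₀ U₁ : Set (E m)} {U₂ U₃ : Set (E n)} (hH : MetricOn H U₃) (hS : ImmOn S U₂ U₃)
    (hψ : MapOn ψ U₁ U₂) (hT : MapOn T U₀ U₁) (hξ : ContDiffOn ℝ ∞ ξ U₁) {x : E m} (hx : x ∈ U₀)
    (v : E m) :
    covD H (fun y => S (ψ (T y))) (fun y => fderiv ℝ S (ψ (T y)) (ξ (T y))) x v
      = fderiv ℝ S (ψ (T x)) (covD (pull H S) ψ ξ (T x) (fderiv ℝ T x v)) := by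
  have hTx := hT.mapsTo hx
  have hψx := hψ.mapsTo hTx
  have dT := smooth_diffAt hT.smooth hT.isOpen hx
  have dψ := smooth_diffAt hψ.smooth hψ.isOpen hTx
  have dS := smooth_diffAt hS.smooth hS.isOpen hψx
  have dS' := smooth_diffAt (smooth_fderiv hS.smooth hS.isOpen) hS.isOpen hψx
  have dξ := smooth_diffAt hξ hψ.isOpen hTx
  have e1 : fderiv ℝ (fun y => ψ (T y)) x = fderiv ℝ ψ (T x) ∘L fderiv ℝ T x :=
    fderiv_comp x dψ dT
  have dψT : DifferentiableAt ℝ (fun y => ψ (T y)) x := dψ.comp x dT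
  have e2 : fderiv ℝ (fun y => S (ψ (T y))) x
      = fderiv ℝ S (ψ (T x)) ∘L fderiv ℝ (fun y => ψ (T y)) x := fderiv_comp x dS dψT
  have e3 : fderiv ℝ (fun y => ξ (T y)) x = fderiv ℝ ξ (T x) ∘L fderiv ℝ T x :=
    fderiv_comp x dξ dT
  have e4 : fderiv ℝ (fun y => fderiv ℝ S (ψ (T y))) x
      = fderiv ℝ (fderiv ℝ S) (ψ (T x)) ∘L fderiv ℝ (fun y => ψ (T y)) x := fderiv_comp x dS' dψT
  have dST : DifferentiableAt ℝ (fun y => fderiv ℝ S (ψ (T y))) x := dS'.comp x dψT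
  have dξT : DifferentiableAt ℝ (fun y => ξ (T y)) x := dξ.comp x dT
  rw [covD_apply, covD_apply, fderiv_clm_apply dST dξT, e4, e2, e3, e1, map_add,
    fderiv_chris hH hS hψx]
  simp only [_root_.add_apply, ContinuousLinearMap.comp_apply, ContinuousLinearMap.flip_apply]
  abel

end Locality

/-! ### Smooth metrics on manifolds -/

section Metrics

variable {n : ℕ} {M : Type*} [TopologicalSpace M] [ChartedSpace (E n) M]

/-- The part of the chart at `a` lying over `V`. -/
def chartPre (n : ℕ) {M : Type*} [TopologicalSpace M] [ChartedSpace (E n) M] (a : M) (V : Set M) :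
    Set (E n) :=
  (extChartAt (𝓡 n) a).target ∩ (extChartAt (𝓡 n) a).symm ⁻¹' V

theorem mem_chartPre {a q : M} {V : Set M} (hq : q ∈ (extChartAt (𝓡 n) a).source) (hV : q ∈ V) :
    extChartAt (𝓡 n) a q ∈ chartPre n a V :=
  ⟨(extChartAt (𝓡 n) a).map_source hq, by
    rw [mem_preimage, (extChartAt (𝓡 n) a).left_inv hq]; exact hV⟩

/-- The field `g` of bilinear forms is a smooth Riemannian metric on `V`. -/
def SmoothMetricOn (g : BilField n M) (V : Set M) : Prop :=
  ∀ a : M, MetricOn (coordMetric g a) (chartPre n a V)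

variable {g : BilField n M} {V : Set M}

theorem chart_transition_self (a q : M) :
    chartRep (m := n) (n := n) q a (id : M → M) (extChartAt (𝓡 n) q q) = extChartAt (𝓡 n) a q := by
  rw [chartRep, extChartAt_to_inv]; rfl

variable [IsManifold (𝓡 n) ∞ M]

/-- Sectional curvatures can be computed in every chart. -/
theorem coordSectional_transition (hg : SmoothMetricOn g V) {a q : M}
    (hq : q ∈ (extChartAt (𝓡 n) a).source) (hqV : q ∈ V) (u v : E n) :
    coordSectional (coordMetric g q) (extChartAt (𝓡 n) q q) u v
      = coordSectional (coordMetric g a) (extChartAt (𝓡 n) a q)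
        (chartDeriv a q u) (chartDeriv a q v) := by
  set T := chartRep (m := n) (n := n) q a (id : M → M)
  have hT := immOn_transition (m := n) q a
  have hTU : MapsTo T (chartDom (m := n) (n := n) q a (id : M → M) ∩ chartPre n q V)
      (chartPre n a V) := fun x hx => ⟨hT.mapsTo hx.1, by
    have : (extChartAt (𝓡 n) a).symm (T x) = (extChartAt (𝓡 n) q).symm x :=
      (extChartAt (𝓡 n) a).left_inv hx.1.2
    rw [mem_preimage, this]; exact hx.2.2⟩
  have hT' := hT.mono (hT.isOpen.inter (hg q).isOpen) inter_subset_left hTU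
  have hx : extChartAt (𝓡 n) q q ∈ chartDom (m := n) (n := n) q a (id : M → M) ∩ chartPre n q V :=
    ⟨⟨mem_extChartAt_target q, by
      rw [mem_preimage, mem_preimage, extChartAt_to_inv]; exact hq⟩,
      mem_chartPre (mem_extChartAt_source q) hqV⟩
  have hf : ∀ w, fderiv ℝ T (extChartAt (𝓡 n) q q) w = chartDeriv a q w := fun w => by
    rw [fderiv_chartRep hx.1 (mdifferentiableAt_id), diffl_id, coordFrame_self]
    simp only [id, extChartAt_to_inv]
  rw [coordSectional_congr hT'.isOpen hx (fun y hy => coordMetric_transition g hy.1),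
    coordSectional_pull (hg a) hT' hx, hf, hf, chart_transition_self]

/-- A coordinate change does not carry the standard basis to the standard basis, but independent
pairs stay independent, and in dimension two they all give the same sectional curvature. -/
theorem gaussCurvature_eq {M : Type*} [TopologicalSpace M] [ChartedSpace (E 2) M]
    [IsManifold (𝓡 2) ∞ M] {g : BilField 2 M} {V : Set M} (hg : SmoothMetricOn g V) {a q : M}
    (hq : q ∈ (extChartAt (𝓡 2) a).source) (hqV : q ∈ V) :
    gaussCurvature g q = gaussK (coordMetric g a) (extChartAt (𝓡 2) a q) := by
  rw [gaussCurvature, sectionalCurvature, coordSectional_transition hg hq hqV]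
  refine coordSectional_eq_gaussK (hg a) (mem_chartPre hq hqV) ?_
  have hx := (extChartAt (𝓡 2) a).map_source hq
  have h := linearIndependent_basisVec.map' ((frameEquiv hx).symm : E 2 →ₗ[ℝ] E 2)
    (LinearMap.ker_eq_bot.2 (frameEquiv hx).symm.injective)
  have hs : ∀ v, (frameEquiv hx).symm v = chartDeriv a q v := fun v => by
    change chartDeriv a ((extChartAt (𝓡 2) a).symm (extChartAt (𝓡 2) a q)) v = _
    rw [(extChartAt (𝓡 2) a).left_inv hq]
  rw [show ![chartDeriv a q (basisVec 0), chartDeriv a q (basisVec 1)]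
    = ((frameEquiv hx).symm : E 2 →ₗ[ℝ] E 2) ∘ ![basisVec 0, basisVec 1] by
      funext i
      fin_cases i
      exacts [(hs _).symm, (hs _).symm]]
  exact h

/-- The hypothesis speaks of each point in its own chart only; the transition formula carries it to
every point of a given chart. -/
theorem coordSectional_const (hg : SmoothMetricOn g univ) {c : ℝ} (hc : HasConstantCurvature g c)
    {a : M} {y : E n} (hy : y ∈ (extChartAt (𝓡 n) a).target) {u v : E n}
    (huv : LinearIndependent ℝ ![u, v]) : coordSectional (coordMetric g a) y u v = c := by
  set q := (extChartAt (𝓡 n) a).symm y with hq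
  have hqs : q ∈ (extChartAt (𝓡 n) a).source := (extChartAt (𝓡 n) a).map_target hy
  have hqy : extChartAt (𝓡 n) a q = y := (extChartAt (𝓡 n) a).right_inv hy
  have hli := huv.map' (frameEquiv hy : E n →ₗ[ℝ] E n)
    (LinearMap.ker_eq_bot.2 (frameEquiv hy).injective)
  have hli' : LinearIndependent ℝ ![coordFrame a y u, coordFrame a y v] := by
    rw [show ![coordFrame a y u, coordFrame a y v]
      = (frameEquiv hy : E n →ₗ[ℝ] E n) ∘ ![u, v] by ext i; fin_cases i <;> rfl]
    exact hli
  have h1 := hc q _ _ hli'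
  rw [sectionalCurvature, coordSectional_transition hg hqs (mem_univ q), hqy,
    chartDeriv_coordFrame hy, chartDeriv_coordFrame hy] at h1
  exact h1

theorem smooth_chartFun {u : M → ℝ} (hu : ContMDiffOn (𝓡 n) 𝓘(ℝ, ℝ) ∞ u V) (a : M) :
    ContDiffOn ℝ ∞ (fun x => u ((extChartAt (𝓡 n) a).symm x)) (chartPre n a V) := by
  rw [← contMDiffOn_iff_contDiffOn]
  exact hu.comp ((contMDiffOn_extChartAt_symm a).mono inter_subset_left) fun x hx => hx.2

theorem contMDiffAt_of_chart {u : M → ℝ} {a q : M} {U : Set (E n)} (hU : IsOpen U)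
    (hq : q ∈ (extChartAt (𝓡 n) a).source) (hqU : extChartAt (𝓡 n) a q ∈ U)
    (hu : ContDiffOn ℝ ∞ (fun x => u ((extChartAt (𝓡 n) a).symm x)) U) :
    ContMDiffAt (𝓡 n) 𝓘(ℝ, ℝ) ∞ u q := by
  have h1 : ContMDiffAt (𝓡 n) 𝓘(ℝ, E n) ∞ (extChartAt (𝓡 n) a) q :=
    contMDiffAt_extChartAt' (by rwa [extChartAt_source] at hq)
  have h2 := (hu.contDiffAt (hU.mem_nhds hqU)).contMDiffAt
  refine (h2.comp q h1).congr_of_eventuallyEq ?_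
  filter_upwards [(isOpen_extChartAt_source a).mem_nhds hq] with y hy
  simp only [Function.comp, (extChartAt (𝓡 n) a).left_inv hy]

/-- The coordinate field is the tangent map of the inverse chart applied to a constant section.
Pairing two such fields shows that the coefficients of the metric are smooth. -/
theorem smooth_frame_section (b : M) (v : E n) :
    ContMDiffOn 𝓘(ℝ, E n) (𝓡 n).tangent ∞
      (fun x => (⟨(extChartAt (𝓡 n) b).symm x, coordFrame b x v⟩ : TangentBundle (𝓡 n) M))
      (extChartAt (𝓡 n) b).target := by
  have hs := isOpen_extChartAt_target (I := 𝓡 n) b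
  have h1 := (contMDiffOn_extChartAt_symm (I := 𝓡 n) (n := ∞) b).contMDiffOn_tangentMapWithin
    (m := ∞) (by simp) hs.uniqueMDiffOn
  have h2 : ContMDiffOn 𝓘(ℝ, E n) 𝓘(ℝ, E n).tangent ∞
      (fun x => (⟨x, v⟩ : TangentBundle 𝓘(ℝ, E n) (E n))) (extChartAt (𝓡 n) b).target := fun x _ =>
    contMDiffWithinAt_vectorSpace_iff_contDiffWithinAt.2 contDiffWithinAt_const
  refine (h1.comp h2 fun x hx => hx).congr fun x hx => ?_
  simp only [Function.comp, tangentMapWithin, mfderivWithin_of_isOpen hs hx]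
  rfl

end Metrics

/-! ### The ambient Riemannian metric in charts -/

section RiemannianMetric

variable {N : Type*} [TopologicalSpace N] [ChartedSpace (E 3) N] [IsManifold (𝓡 3) ∞ N]
  [RiemannianBundle (fun x : N => TangentSpace (𝓡 3) x)]
  [IsContMDiffRiemannianBundle (𝓡 3) ∞ (E 3) (fun x : N => TangentSpace (𝓡 3) x)]

theorem smoothMetricOn_metricField : SmoothMetricOn (metricField N) univ := fun b => by
  have hU : chartPre 3 b (univ : Set N) = (extChartAt (𝓡 3) b).target := by simp [chartPre]
  rw [hU]
  refine ⟨isOpen_extChartAt_target b, ?_, fun x hx => ⟨fun v w => ?_, fun v hv => ?_⟩⟩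
  · refine contDiffOn_clm_apply.2 fun v => contDiffOn_clm_apply.2 fun w => ?_
    rw [← contMDiffOn_iff_contDiffOn]
    exact ContMDiffOn.inner_bundle (E := fun x : N => TangentSpace (𝓡 3) x)
      (smooth_frame_section b v) (smooth_frame_section b w)
  · exact real_inner_comm (F := TangentSpace (𝓡 3) ((extChartAt (𝓡 3) b).symm x)) _ _
  · have h0 : coordFrame b x v ≠ 0 := fun h => hv ((frameEquiv hx).injective (by
      rw [frameEquiv_apply, h, map_zero]))
    exact real_inner_self_pos (F := TangentSpace (𝓡 3) ((extChartAt (𝓡 3) b).symm x)).2 h0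

end RiemannianMetric

/-! ### Immersed surfaces in charts -/

section ImmersedSurface

variable {M : Type*} [TopologicalSpace M] [ChartedSpace (E 2) M] [IsManifold (𝓡 2) ∞ M]
  {N : Type*} [TopologicalSpace N] [ChartedSpace (E 3) N] [IsManifold (𝓡 3) ∞ N]
  {ψ : M → N}

/-- The field `ξ` along `ψ` in the charts at `a` and at `b`. -/
def fieldRep (a : M) (b : N) (ξ : FieldAlong ψ) (x : E 2) : E 3 :=
  chartDeriv b (ψ ((extChartAt (𝓡 2) a).symm x)) (ξ ((extChartAt (𝓡 2) a).symm x) : E 3)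

/-- The value at `q` of the field `ξ` along `ψ` in the chart at `b`. -/
def fieldRepAt (b : N) (ξ : FieldAlong ψ) (q : M) : E 3 := chartDeriv b (ψ q) (ξ q : E 3)

omit [IsManifold (𝓡 2) ∞ M] [IsManifold (𝓡 3) ∞ N] in
theorem fieldRep_eq (a : M) (b : N) (ξ : FieldAlong ψ) (x : E 2) :
    fieldRep a b ξ x = fieldRepAt b ξ ((extChartAt (𝓡 2) a).symm x) := rfl

/-- The trivialization of the tangent bundle at b is the derivative of the chart at b on fibres, so
the representative is the fibre component of a smooth section. -/
theorem smooth_fieldRep (a : M) (b : N) {ξ : FieldAlong ψ}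
    (hξ : ContMDiff (𝓡 2) (𝓡 3).tangent ∞ (fun p => (⟨ψ p, ξ p⟩ : TangentBundle (𝓡 3) N))) :
    ContDiffOn ℝ ∞ (fieldRep a b ξ) (chartDom (m := 2) (n := 3) a b ψ) := by
  rw [← contMDiffOn_iff_contDiffOn]
  set e := trivializationAt (E 3) (TangentSpace (𝓡 3)) b with he
  have h1 : ContMDiffOn 𝓘(ℝ, E 2) (𝓡 3).tangent ∞
      (fun x => (⟨ψ ((extChartAt (𝓡 2) a).symm x), ξ ((extChartAt (𝓡 2) a).symm x)⟩ :
        TangentBundle (𝓡 3) N)) (chartDom (m := 2) (n := 3) a b ψ) :=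
    hξ.comp_contMDiffOn ((contMDiffOn_extChartAt_symm a).mono inter_subset_left)
  have h2 : ContMDiffOn ((𝓡 3).prod 𝓘(ℝ, E 3)) ((𝓡 3).prod 𝓘(ℝ, E 3)) ∞ e e.source :=
    e.contMDiffOn
  have hb : ∀ x ∈ chartDom (m := 2) (n := 3) a b ψ,
      ψ ((extChartAt (𝓡 2) a).symm x) ∈ (chartAt (E 3) b).source := fun x hx => by
    have := hx.2
    rwa [mem_preimage, mem_preimage, extChartAt_source] at this
  have h3 := contMDiff_snd.comp_contMDiffOn (h2.comp h1 fun x hx => by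
    rw [mem_preimage, e.mem_source]; exact hb x hx)
  refine h3.congr fun x hx => ?_
  have h4 := TangentBundle.continuousLinearMapAt_trivializationAt (I := 𝓡 3) (hb x hx)
  have h5 := DFunLike.congr_fun h4 (ξ ((extChartAt (𝓡 2) a).symm x))
  exact h5.symm.trans (e.continuousLinearMapAt_apply_of_mem (R := ℝ) (hb x hx) _)

theorem covD_congr_map {m n : ℕ} {H H' : E n → Bil n} {T T' ξ ξ' : E m → E n} {U : Set (E m)}
    {x : E m} (hU : IsOpen U) (hx : x ∈ U) (hT : ∀ y ∈ U, T y = T' y) (hξ : ∀ y ∈ U, ξ y = ξ' y)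
    (hH : chris H (T x) = chris H' (T x)) : covD H T ξ x = covD H' T' ξ' x := by
  rw [covD, covD, fderiv_congr_on hU hx hξ, fderiv_congr_on hU hx hT, hH, hT x hx, hξ x hx]

omit [IsManifold (𝓡 2) ∞ M] [IsManifold (𝓡 3) ∞ N] in
theorem mem_chartDom_self (q : M) :
    extChartAt (𝓡 2) q q ∈ chartDom (m := 2) (n := 3) q (ψ q) ψ :=
  ⟨mem_extChartAt_target q, by
    rw [mem_preimage, mem_preimage, extChartAt_to_inv]; exact mem_extChartAt_source _⟩

variable [RiemannianBundle (fun x : N => TangentSpace (𝓡 3) x)]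

/-- The metric of the ambient manifold in the chart at `b`. -/
abbrev ambientMetric (b : N) : E 3 → Bil 3 := coordMetric (metricField N) b

omit [IsManifold (𝓡 2) ∞ M] [IsManifold (𝓡 3) ∞ N] in
theorem covDerivAlong_eq (ξ : FieldAlong ψ) (q : M) (v : E 2) :
    covDerivAlong ξ q v = covD (ambientMetric (ψ q)) (chartRep q (ψ q) ψ) (fieldRep q (ψ q) ξ)
      (extChartAt (𝓡 2) q q) v := by
  rw [covD_apply, chris_apply]
  rfl

variable [IsContMDiffRiemannianBundle (𝓡 3) ∞ (E 3) (fun x : N => TangentSpace (𝓡 3) x)]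

theorem metricOn_ambient (b : N) : MetricOn (ambientMetric b) (extChartAt (𝓡 3) b).target := by
  have h := smoothMetricOn_metricField b
  have hU : chartPre 3 b (univ : Set N) = (extChartAt (𝓡 3) b).target := by simp [chartPre]
  rwa [hU] at h

/-- The covariant derivative along an immersion can be computed in all charts. -/
theorem covDerivAlong_transition (hψ : ContMDiff (𝓡 2) (𝓡 3) ∞ ψ) {ξ : FieldAlong ψ}
    (hξ : ContMDiff (𝓡 2) (𝓡 3).tangent ∞ (fun p => (⟨ψ p, ξ p⟩ : TangentBundle (𝓡 3) N)))
    {a : M} {b : N} {x : E 2} (hx : x ∈ chartDom (m := 2) (n := 3) a b ψ) (v : E 2) :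
    chartDeriv b (ψ ((extChartAt (𝓡 2) a).symm x))
        (covDerivAlong ξ ((extChartAt (𝓡 2) a).symm x) (coordFrame a x v))
      = covD (ambientMetric b) (chartRep a b ψ) (fieldRep a b ξ) x v := by
  set q := (extChartAt (𝓡 2) a).symm x with hq
  have hqa : q ∈ (extChartAt (𝓡 2) a).source := (extChartAt (𝓡 2) a).map_target hx.1
  -- The representation in the charts a, b factors as S ∘ ψ₀ ∘ T, where ψ₀ uses the charts at q and
  -- ψ(q), T is a coordinate change on M and S one on N. The sets U₁ and U₀ are cut down so that the
  -- compositions make sense.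
  set S := chartRep (m := 3) (n := 3) (ψ q) b (id : N → N) with hSd
  set ψ₀ := chartRep (m := 2) (n := 3) q (ψ q) ψ with hψ₀
  set ξ₀ := fieldRep q (ψ q) ξ with hξ₀
  set T := chartRep (m := 2) (n := 2) a q (id : M → M) with hTd
  have hS := immOn_transition (m := 3) (ψ q) b
  have hT := immOn_transition (m := 2) a q
  have sψ := smooth_chartRep (m := 2) (n := 3) q (ψ q) hψ
  set U₁ := chartDom (m := 2) (n := 3) q (ψ q) ψ
    ∩ ψ₀ ⁻¹' (chartDom (m := 3) (n := 3) (ψ q) b (id : N → N)) with hU₁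
  have oU₁ : IsOpen U₁ := sψ.continuousOn.isOpen_inter_preimage
    (isOpen_chartDom q (ψ q) hψ.continuous) hS.isOpen
  have mψ : MapOn ψ₀ U₁ (chartDom (m := 3) (n := 3) (ψ q) b (id : N → N)) :=
    ⟨oU₁, sψ.mono inter_subset_left, fun y hy => hy.2⟩
  set U₀ := chartDom (m := 2) (n := 3) a b ψ
    ∩ (chartDom (m := 2) (n := 2) a q (id : M → M) ∩ T ⁻¹' U₁) with hU₀
  have oU₀ : IsOpen U₀ := (isOpen_chartDom a b hψ.continuous).inter
    (hT.smooth.continuousOn.isOpen_inter_preimage hT.isOpen oU₁)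
  have mT : MapOn T U₀ U₁ := ⟨oU₀, hT.smooth.mono fun y hy => hy.2.1, fun y hy => hy.2.2⟩
  have hTx : T x = extChartAt (𝓡 2) q q := rfl
  have hψx : ψ₀ (T x) = extChartAt (𝓡 3) (ψ q) (ψ q) := by
    rw [hTx, hψ₀, chartRep, extChartAt_to_inv]
  have hSx : extChartAt (𝓡 3) (ψ q) (ψ q) ∈ chartDom (m := 3) (n := 3) (ψ q) b (id : N → N) :=
    ⟨mem_extChartAt_target _, by
      rw [mem_preimage, mem_preimage, extChartAt_to_inv]; exact hx.2⟩
  have hxU₀ : x ∈ U₀ := ⟨hx, ⟨hx.1, mem_extChartAt_source q⟩, by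
    rw [mem_preimage, hTx]
    exact ⟨mem_chartDom_self q, by rw [mem_preimage, ← hTx, hψx]; exact hSx⟩⟩
  have key : ∀ y ∈ U₀, chartRep a b ψ y = S (ψ₀ (T y))
      ∧ fieldRep a b ξ y = fderiv ℝ S (ψ₀ (T y)) (ξ₀ (T y)) := fun y hy => by
    have e1 : (extChartAt (𝓡 2) q).symm (T y) = (extChartAt (𝓡 2) a).symm y :=
      (extChartAt (𝓡 2) q).left_inv hy.2.1.2
    have hz : ψ ((extChartAt (𝓡 2) a).symm y) ∈ (extChartAt (𝓡 3) (ψ q)).source := by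
      have := hy.2.2.1.2
      rwa [mem_preimage, mem_preimage, e1] at this
    have e2 : ψ₀ (T y) = extChartAt (𝓡 3) (ψ q) (ψ ((extChartAt (𝓡 2) a).symm y)) := by
      rw [hψ₀, chartRep, e1]
    have e3 : (extChartAt (𝓡 3) (ψ q)).symm (ψ₀ (T y)) = ψ ((extChartAt (𝓡 2) a).symm y) := by
      rw [e2]; exact (extChartAt (𝓡 3) (ψ q)).left_inv hz
    have hy2 : ψ₀ (T y) ∈ chartDom (m := 3) (n := 3) (ψ q) b (id : N → N) := hy.2.2.2
    constructor
    · rw [hSd, chartRep, chartRep, e3]; rfl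
    · have h5 : ξ₀ (T y) = fieldRepAt (ψ q) ξ ((extChartAt (𝓡 2) a).symm y) := by
        rw [hξ₀, fieldRep_eq, e1]
      have h6 := coordFrame_chartDeriv hy2.1 (ξ ((extChartAt (𝓡 2) a).symm y) : E 3)
      rw [e3] at h6
      rw [fderiv_chartRep hy2 mdifferentiableAt_id, diffl_id, h5, id, e3]
      exact congrArg _ h6.symm
  have hchr : chris (pull (ambientMetric b) S) (ψ₀ (T x)) = chris (ambientMetric (ψ q)) (ψ₀ (T x)) :=
    chris_congr hS.isOpen (by rw [hψx]; exact hSx) fun y hy =>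
      (coordMetric_transition (metricField N) hy).symm
  rw [covD_congr_map oU₀ hxU₀ (fun y hy => (key y hy).1) (fun y hy => (key y hy).2) rfl,
    covD_natural (metricOn_ambient b) hS mψ mT
      ((smooth_fieldRep q (ψ q) hξ).mono inter_subset_left) hxU₀,
    covD_congr_map oU₁ (mT.mapsTo hxU₀) (fun _ _ => rfl) (fun _ _ => rfl) hchr, hψx,
    fderiv_chartRep hSx mdifferentiableAt_id, diffl_id, coordFrame_self,
    fderiv_chartRep hxU₀.2.1 mdifferentiableAt_id, diffl_id]
  simp only [id, extChartAt_to_inv]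
  rw [← hq, chartDeriv_self, covDerivAlong_eq, hTx]

/-- The second fundamental form at `q`. -/
def secondForm (η : FieldAlong ψ) (q : M) : Bil 2 :=
  shapeForm (ambientMetric (ψ q)) (chartRep q (ψ q) ψ) (fieldRep q (ψ q) η) (extChartAt (𝓡 2) q q)

omit [IsContMDiffRiemannianBundle (𝓡 3) ∞ (E 3) (fun x : N => TangentSpace (𝓡 3) x)] in
/-- The metric at `n` in terms of the derivative of a chart. -/
theorem ambientMetric_chart {b n : N} (hn : n ∈ (extChartAt (𝓡 3) b).source) (v w : E 3) :
    ambientMetric b (extChartAt (𝓡 3) b n) (chartDeriv b n v) (chartDeriv b n w)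
      = (metricField N).toBil n v w := by
  have hy := (extChartAt (𝓡 3) b).map_source hn
  have h : ∀ z, coordFrame b (extChartAt (𝓡 3) b n) (chartDeriv b n z) = z := fun z => by
    have := coordFrame_chartDeriv hy z
    rwa [(extChartAt (𝓡 3) b).left_inv hn] at this
  rw [coordMetric_apply, h, h, (extChartAt (𝓡 3) b).left_inv hn]

theorem shapeForm_transition (hψ : ContMDiff (𝓡 2) (𝓡 3) ∞ ψ) {η : FieldAlong ψ}
    (hη : ContMDiff (𝓡 2) (𝓡 3).tangent ∞ (fun p => (⟨ψ p, η p⟩ : TangentBundle (𝓡 3) N)))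
    {a : M} {b : N} {x : E 2} (hx : x ∈ chartDom (m := 2) (n := 3) a b ψ) (v w : E 2) :
    shapeForm (ambientMetric b) (chartRep a b ψ) (fieldRep a b η) x v w
      = -(metricField N).toBil (ψ ((extChartAt (𝓡 2) a).symm x))
        (covDerivAlong η ((extChartAt (𝓡 2) a).symm x) (coordFrame a x v))
        (differential ψ ((extChartAt (𝓡 2) a).symm x) (coordFrame a x w)) := by
  rw [shapeForm_apply, ← covDerivAlong_transition hψ hη hx,
    fderiv_chartRep hx ((hψ _).mdifferentiableAt (by simp))]
  exact congrArg Neg.neg (ambientMetric_chart hx.2 (covDerivAlong η _ (coordFrame a x v) : E 3)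
    (diffl 2 3 ψ ((extChartAt (𝓡 2) a).symm x) (coordFrame a x w)))

theorem secondForm_apply (hψ : ContMDiff (𝓡 2) (𝓡 3) ∞ ψ) {η : FieldAlong ψ}
    (hη : ContMDiff (𝓡 2) (𝓡 3).tangent ∞ (fun p => (⟨ψ p, η p⟩ : TangentBundle (𝓡 3) N)))
    (q : M) (v w : E 2) : secondForm η q v w
      = -(metricField N).toBil (ψ q) (covDerivAlong η q v) (differential ψ q w) := by
  rw [secondForm, shapeForm_transition hψ hη (mem_chartDom_self q), coordFrame_self,
    coordFrame_self]
  exact congrArg (fun q' : M => -(metricField N).toBil (ψ q') (covDerivAlong η q' v)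
    (differential ψ q' w)) (extChartAt_to_inv (I := 𝓡 2) q)

theorem secondForm_transition (hψ : ContMDiff (𝓡 2) (𝓡 3) ∞ ψ) {η : FieldAlong ψ}
    (hη : ContMDiff (𝓡 2) (𝓡 3).tangent ∞ (fun p => (⟨ψ p, η p⟩ : TangentBundle (𝓡 3) N)))
    {a : M} {b : N} {x : E 2} (hx : x ∈ chartDom (m := 2) (n := 3) a b ψ) (v w : E 2) :
    shapeForm (ambientMetric b) (chartRep a b ψ) (fieldRep a b η) x v w
      = secondForm η ((extChartAt (𝓡 2) a).symm x) (coordFrame a x v) (coordFrame a x w) := by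
  rw [shapeForm_transition hψ hη hx, secondForm_apply hψ hη]

omit [IsContMDiffRiemannianBundle (𝓡 3) ∞ (E 3) (fun x : N => TangentSpace (𝓡 3) x)] in
theorem normalOn_fieldRep (hψ : ContMDiff (𝓡 2) (𝓡 3) ∞ ψ) {η : FieldAlong ψ}
    (hη : IsUnitNormal ψ η) (a : M) (b : N) :
    NormalOn (ambientMetric b) (chartRep a b ψ) (fieldRep a b η)
      (chartDom (m := 2) (n := 3) a b ψ) where
  smooth := smooth_fieldRep a b hη.1
  unit x hx := by
    have := ambientMetric_chart hx.2 (η ((extChartAt (𝓡 2) a).symm x) : E 3)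
      (η ((extChartAt (𝓡 2) a).symm x) : E 3)
    exact this.trans (hη.2 _).1
  orth x hx v := by
    rw [fderiv_chartRep hx ((hψ _).mdifferentiableAt (by simp))]
    exact (ambientMetric_chart hx.2 (η ((extChartAt (𝓡 2) a).symm x) : E 3) _).trans
      ((hη.2 _).2 _)

end ImmersedSurface

/-! ### Gradients and Laplacians in charts -/

section Gradients

variable {n : ℕ} {M : Type*} [TopologicalSpace M] [ChartedSpace (E n) M]
  {g : BilField n M} {u : M → ℝ}

/-- The gradient of `u` at `q`, as a vector of the model space. -/
def gradM (g : BilField n M) (u : M → ℝ) (q : M) : E n := (g.toBil q).inverse (dif u q)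

theorem lapE_chart (g : BilField n M) (u : M → ℝ) (p : M) :
    laplacian g u p = lapE (coordMetric g p) (fun x => u ((extChartAt (𝓡 n) p).symm x))
      (extChartAt (𝓡 n) p p) := by
  rw [lapE]
  simp only [hess_apply, chris_apply]
  rfl

variable [IsManifold (𝓡 n) ∞ M]

theorem coordFrame_gradE {a : M} {x : E n} (hx : x ∈ (extChartAt (𝓡 n) a).target)
    (hg : IsInner (g.toBil ((extChartAt (𝓡 n) a).symm x)))
    (hu : MDifferentiableAt (𝓡 n) 𝓘(ℝ, ℝ) u ((extChartAt (𝓡 n) a).symm x)) :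
    coordFrame a x (gradE (coordMetric g a) (fun y => u ((extChartAt (𝓡 n) a).symm y)) x)
      = gradM g u ((extChartAt (𝓡 n) a).symm x) := by
  refine hg.ext fun z => ?_
  obtain ⟨w, rfl⟩ := (frameEquiv hx).surjective z
  rw [frameEquiv_apply, ← coordMetric_apply, gradM, hg.apply_inverse, gradE,
    IsInner.apply_inverse, fderiv_chartFun hx hu]
  have := hg.comp (frameEquiv hx)
  rwa [frameEquiv_coe] at this

theorem fderiv_chartFun_self {q : M} (hu : MDifferentiableAt (𝓡 n) 𝓘(ℝ, ℝ) u q) :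
    fderiv ℝ (fun y => u ((extChartAt (𝓡 n) q).symm y)) (extChartAt (𝓡 n) q q) = dif u q := by
  ext v
  rw [fderiv_chartFun (mem_extChartAt_target q) (by rwa [extChartAt_to_inv]), coordFrame_self,
    extChartAt_to_inv]

theorem gradE_self {q : M} (hu : MDifferentiableAt (𝓡 n) 𝓘(ℝ, ℝ) u q) :
    gradE (coordMetric g q) (fun y => u ((extChartAt (𝓡 n) q).symm y)) (extChartAt (𝓡 n) q q)
      = gradM g u q := by
  rw [gradE, fderiv_chartFun_self hu, coordMetric_self, gradM]

/-- The squared norm of the gradient can be computed in every chart. -/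
theorem gradSq_chart {a : M} {x : E n} (hx : x ∈ (extChartAt (𝓡 n) a).target)
    (hg : IsInner (g.toBil ((extChartAt (𝓡 n) a).symm x)))
    (hu : MDifferentiableAt (𝓡 n) 𝓘(ℝ, ℝ) u ((extChartAt (𝓡 n) a).symm x)) :
    gradSq (coordMetric g a) (fun y => u ((extChartAt (𝓡 n) a).symm y)) x
      = g.toBil ((extChartAt (𝓡 n) a).symm x) (gradM g u ((extChartAt (𝓡 n) a).symm x))
        (gradM g u ((extChartAt (𝓡 n) a).symm x)) := by
  rw [gradSq, coordMetric_apply, coordFrame_gradE hx hg hu]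

end Gradients

/-! ### The fundamental forms of an immersed surface -/

section FundamentalForms

variable {M : Type*} [TopologicalSpace M] [ChartedSpace (E 2) M] [IsManifold (𝓡 2) ∞ M]
  {N : Type*} [TopologicalSpace N] [ChartedSpace (E 3) N] [IsManifold (𝓡 3) ∞ N]
  [RiemannianBundle (fun x : N => TangentSpace (𝓡 3) x)]
  {ψ : M → N} {η : FieldAlong ψ} {a : M} {b : N} {x : E 2}

omit [RiemannianBundle (fun x : N => TangentSpace (𝓡 3) x)] in
theorem immOn_surface (hψ : IsSmoothImmersion ψ) (a : M) (b : N) :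
    ImmOn (chartRep a b ψ) (chartDom (m := 2) (n := 3) a b ψ) (extChartAt (𝓡 3) b).target :=
  immOn_chartRep a b hψ.1 hψ.2

theorem coordMetric_induced (hψ : IsSmoothImmersion ψ)
    (hx : x ∈ chartDom (m := 2) (n := 3) a b ψ) :
    coordMetric (inducedMetric ψ) a x = pull (ambientMetric b) (chartRep a b ψ) x :=
  coordMetric_pull hψ.1 (fun _ _ _ => rfl) hx

variable [IsContMDiffRiemannianBundle (𝓡 3) ∞ (E 3) (fun x : N => TangentSpace (𝓡 3) x)]

theorem metricOn_induced (hψ : IsSmoothImmersion ψ) (a : M) (b : N) :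
    MetricOn (coordMetric (inducedMetric ψ) a) (chartDom (m := 2) (n := 3) a b ψ) :=
  (metricOn_pull (metricOn_ambient b) (immOn_surface hψ a b)).congr
    fun _ hy => coordMetric_induced hψ hy

/-- No single ambient chart need cover the image of a chart of M, so the ambient chart is chosen
separately at each point. -/
theorem smoothMetricOn_induced (hψ : IsSmoothImmersion ψ) :
    SmoothMetricOn (inducedMetric ψ) univ := fun a => by
  have h : ∀ x ∈ chartPre 2 a (univ : Set M),
      ∃ b : N, x ∈ chartDom (m := 2) (n := 3) a b ψ := fun x hx =>
    ⟨ψ ((extChartAt (𝓡 2) a).symm x), hx.1, mem_extChartAt_source _⟩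
  refine ⟨isOpen_chartPre a isOpen_univ, fun x hx => ?_, fun x hx => ?_⟩
  · obtain ⟨b, hb⟩ := h x hx
    have hG := metricOn_induced hψ a b
    exact (hG.smooth.contDiffAt (hG.isOpen.mem_nhds hb)).contDiffWithinAt
  · obtain ⟨b, hb⟩ := h x hx
    exact (metricOn_induced hψ a b).inner x hb

theorem isInner_induced (hψ : IsSmoothImmersion ψ) (q : M) :
    IsInner ((inducedMetric ψ).toBil q) := by
  have h := (metricOn_induced hψ q (ψ q)).inner _ (mem_chartDom_self q)
  rwa [coordMetric_self] at h

theorem meanCurvature_eq (hψ : IsSmoothImmersion ψ) (hη : IsUnitNormal ψ η) (q : M) :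
    meanCurvature η q
      = metricTrace ((inducedMetric ψ).toBil q) (fun v w => secondForm η q v w) := by
  rw [metricTrace_eq (isInner_induced hψ q)]
  refine Finset.sum_congr rfl fun i _ => congrArg (dualVec i) ?_
  refine congrArg ((inducedMetric ψ).toBil q).inverse ?_
  ext w
  exact (secondForm_apply hψ.1 hη.1 q _ w).symm

theorem meanCurvature_chart (hψ : IsSmoothImmersion ψ) (hη : IsUnitNormal ψ η)
    (hx : x ∈ chartDom (m := 2) (n := 3) a b ψ) :
    meanCurvature η ((extChartAt (𝓡 2) a).symm x)
      = metricTrace (coordMetric (inducedMetric ψ) a x)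
        (fun v w => shapeForm (ambientMetric b) (chartRep a b ψ) (fieldRep a b η) x v w) := by
  rw [meanCurvature_eq hψ hη, ← metricTrace_comp (isInner_induced hψ _) _ (frameEquiv hx.1)]
  exact metricTrace_congr fun v w => (secondForm_transition hψ.1 hη.1 hx v w).symm

/-- In charts ∇dψ is the second fundamental form b(·, ·) η of the immersion, and its trace is f η.
-/
theorem tension_eq (hψ : IsSmoothImmersion ψ) (hη : IsUnitNormal ψ η) (q : M) :
    (tension ψ q : E 3) = meanCurvature η q • (η q : E 3) := by
  have hq := mem_chartDom_self (ψ := ψ) q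
  have hH := metricOn_ambient (ψ q)
  have hT := immOn_surface hψ q (ψ q)
  have hG := metricOn_induced hψ q (ψ q)
  have h1 : ∀ v w : E 2,
      fderiv ℝ (fderiv ℝ (chartRep q (ψ q) ψ)) (extChartAt (𝓡 2) q q) v w
      - fderiv ℝ (chartRep q (ψ q) ψ) (extChartAt (𝓡 2) q q)
        (christoffel (coordMetric (inducedMetric ψ) q) (extChartAt (𝓡 2) q q) v w)
      + christoffel (ambientMetric (ψ q)) (chartRep q (ψ q) ψ (extChartAt (𝓡 2) q q))
        (fderiv ℝ (chartRep q (ψ q) ψ) (extChartAt (𝓡 2) q q) v)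
        (fderiv ℝ (chartRep q (ψ q) ψ) (extChartAt (𝓡 2) q q) w)
      = secondForm η q v w • (η q : E 3) := fun v w => by
    have h2 := sff_eq hH hT (normalOn_fieldRep hψ.1 hη q (ψ q)) hq v w
    have h3 : fieldRep q (ψ q) η (extChartAt (𝓡 2) q q) = (η q : E 3) := by
      rw [fieldRep_eq, extChartAt_to_inv]
      exact chartDeriv_self (ψ q) (η q : E 3)
    rw [sff, covD_apply, fderiv_fderiv_apply hT.smooth hT.isOpen hq, h3,
      ← chris_congr hG.isOpen hq fun y hy => coordMetric_induced hψ hy] at h2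
    rw [← chris_apply, ← chris_apply]
    refine Eq.trans ?_ h2
    abel
  refine (metricTrace_congr h1).trans ?_
  rw [meanCurvature_eq hψ hη, metricTrace, metricTrace, coordMetric_self, Finset.sum_smul]

theorem smooth_meanCurvature_chart (hψ : IsSmoothImmersion ψ) (hη : IsUnitNormal ψ η) (a : M)
    (b : N) : ContDiffOn ℝ ∞ (fun x => meanCurvature η ((extChartAt (𝓡 2) a).symm x))
      (chartDom (m := 2) (n := 3) a b ψ) :=
  (smooth_metricTrace (metricOn_induced hψ a b) (smooth_shapeForm (metricOn_ambient b)
    (immOn_surface hψ a b) (normalOn_fieldRep hψ.1 hη a b))).congr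
    fun _ hx => meanCurvature_chart hψ hη hx

theorem contMDiff_meanCurvature (hψ : IsSmoothImmersion ψ) (hη : IsUnitNormal ψ η) :
    ContMDiff (𝓡 2) 𝓘(ℝ, ℝ) ∞ (meanCurvature η) := fun q =>
  contMDiffAt_of_chart (metricOn_induced hψ q (ψ q)).isOpen (mem_extChartAt_source q)
    (mem_chartDom_self q) (smooth_meanCurvature_chart hψ hη q (ψ q))

theorem covDerivAlong_tension (hψ : IsSmoothImmersion ψ) (hη : IsUnitNormal ψ η) (q : M)
    (v : E 2) : (covDerivAlong (tension ψ) q v : E 3)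
      = dif (meanCurvature η) q v • (η q : E 3)
        + meanCurvature η q • (covDerivAlong η q v : E 3) := by
  have hq := mem_chartDom_self (ψ := ψ) q
  have hG := metricOn_induced hψ q (ψ q)
  have h1 : fieldRep q (ψ q) (tension ψ) = fun x =>
      meanCurvature η ((extChartAt (𝓡 2) q).symm x) • fieldRep q (ψ q) η x := by
    funext x
    rw [fieldRep_eq, fieldRepAt, tension_eq hψ hη]
    exact map_smul _ _ _
  have h3 : fieldRep q (ψ q) η (extChartAt (𝓡 2) q q) = (η q : E 3) := by
    rw [fieldRep_eq, extChartAt_to_inv]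
    exact chartDeriv_self (ψ q) (η q : E 3)
  rw [covDerivAlong_eq, covDerivAlong_eq, h1,
    covD_smul (smooth_diffAt (smooth_meanCurvature_chart hψ hη q (ψ q)) hG.isOpen hq)
      (smooth_diffAt (smooth_fieldRep q (ψ q) hη.1) hG.isOpen hq), h3, extChartAt_to_inv,
    fderiv_chartFun_self ((contMDiff_meanCurvature hψ hη q).mdifferentiableAt (by simp))]
  rfl

theorem secondForm_symm (hψ : IsSmoothImmersion ψ) (hη : IsUnitNormal ψ η) (q : M) (v w : E 2) :
    secondForm η q v w = secondForm η q w v :=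
  shapeForm_symm (metricOn_ambient (ψ q)) (immOn_surface hψ q (ψ q))
    (normalOn_fieldRep hψ.1 hη q (ψ q)) (mem_chartDom_self q) v w

/-- From ∇τ = df ⊗ η + f ∇η it follows that ⟨dψ(X), ∇_Y τ⟩ = -f b(X, Y), whence ⟨dψ, ∇τ⟩ = -f²;
moreover |τ|² = f². -/
theorem stressBienergy_eq (hψ : IsSmoothImmersion ψ) (hη : IsUnitNormal ψ η) (q : M)
    (X Y : E 2) : stressBienergy ψ q X Y
      = -(1 / 2) * meanCurvature η q ^ 2 * (inducedMetric ψ).toBil q X Y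
        + 2 * meanCurvature η q * secondForm η q X Y := by
  have hs : ∀ v w : E 3, (metricField N).toBil (ψ q) v w = (metricField N).toBil (ψ q) w v :=
    fun v w => real_inner_comm (F := TangentSpace (𝓡 3) (ψ q)) w v
  have h1 : ∀ v w : E 2, (metricField N).toBil (ψ q) (differential ψ q v)
      (covDerivAlong (tension ψ) q w) = -meanCurvature η q * secondForm η q w v := fun v w => by
    have e1 : (metricField N).toBil (ψ q) (differential ψ q v) (η q) = 0 :=
      (hs _ _).trans ((hη.2 q).2 v)
    have e2 : (metricField N).toBil (ψ q) (differential ψ q v) (covDerivAlong η q w)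
        = -secondForm η q w v := by
      rw [secondForm_apply hψ.1 hη.1, neg_neg]
      exact hs _ _
    have e3 : ∀ (x y z : E 3) (s t : ℝ), (metricField N).toBil (ψ q) x (s • y + t • z)
        = s * (metricField N).toBil (ψ q) x y + t * (metricField N).toBil (ψ q) x z :=
      fun x y z s t => by rw [map_add, map_smul, map_smul, smul_eq_mul, smul_eq_mul]
    refine (congrArg (fun z : E 3 => (metricField N).toBil (ψ q) (differential ψ q v) z)
      (covDerivAlong_tension hψ hη q w)).trans ((e3 _ _ _ _ _).trans
      ((congrArg₂ (fun x y : ℝ => dif (meanCurvature η) q w * x + meanCurvature η q * y)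
        e1 e2).trans ?_))
    ring
  have h2 : (metricField N).toBil (ψ q) (tension ψ q) (tension ψ q) = meanCurvature η q ^ 2 := by
    have e1 : (metricField N).toBil (ψ q) (η q) (η q) = 1 := (hη.2 q).1
    have e2 : ∀ (x : E 3) (s : ℝ), (metricField N).toBil (ψ q) (s • x) (s • x)
        = s ^ 2 * (metricField N).toBil (ψ q) x x := fun x s => by
      rw [map_smul, map_smul, _root_.smul_apply, smul_eq_mul, smul_eq_mul]
      ring
    refine (congrArg (fun z : E 3 => (metricField N).toBil (ψ q) z z)
      (tension_eq hψ hη q)).trans ((e2 _ _).trans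
      ((congrArg (fun x : ℝ => meanCurvature η q ^ 2 * x) e1).trans ?_))
    ring
  have h3 : metricTrace ((inducedMetric ψ).toBil q) (fun v w => (metricField N).toBil (ψ q)
      (differential ψ q v) (covDerivAlong (tension ψ) q w)) = -meanCurvature η q ^ 2 := by
    rw [metricTrace_congr fun v w => (h1 v w).trans (by rw [secondForm_symm hψ hη]),
      metricTrace_const_mul, ← meanCurvature_eq hψ hη]
    ring
  change ((1 / 2) * (metricField N).toBil (ψ q) (tension ψ q) (tension ψ q)
    + metricTrace ((inducedMetric ψ).toBil q) (fun v w => (metricField N).toBil (ψ q)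
      (differential ψ q v) (covDerivAlong (tension ψ) q w))) * (inducedMetric ψ).toBil q X Y
    - (metricField N).toBil (ψ q) (differential ψ q X) (covDerivAlong (tension ψ) q Y)
    - (metricField N).toBil (ψ q) (differential ψ q Y) (covDerivAlong (tension ψ) q X) = _
  rw [h1, h1, h2, h3, secondForm_symm hψ hη q Y X]
  ring

end FundamentalForms

/-! ### Biconservative surfaces in space forms -/

section Biconservative

variable {M : Type*} [TopologicalSpace M] [ChartedSpace (E 2) M] [IsManifold (𝓡 2) ∞ M]
  {N : Type*} [TopologicalSpace N] [ChartedSpace (E 3) N] [IsManifold (𝓡 3) ∞ N]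
  [RiemannianBundle (fun x : N => TangentSpace (𝓡 3) x)]
  [IsContMDiffRiemannianBundle (𝓡 3) ∞ (E 3) (fun x : N => TangentSpace (𝓡 3) x)]
  {ψ : M → N} {η : FieldAlong ψ} {a : M} {b : N} {x : E 2} {c : ℝ}

theorem ambient_curvature (hN : HasConstantCurvature (metricField N) c) {y : E 3}
    (hy : y ∈ (extChartAt (𝓡 3) b).target) (u v : E 3) :
    ambientMetric b y (curvL (ambientMetric b) y u v v) u = c * (ambientMetric b y u u
      * ambientMetric b y v v - ambientMetric b y u v ^ 2) :=
  sectional_spec (metricOn_ambient b) hy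
    (fun _ _ huv => coordSectional_const smoothMetricOn_metricField hN hy huv) u v

theorem nablaBil_congr_metric {n : ℕ} {G G' B : E n → Bil n} {U : Set (E n)} {x : E n}
    (hU : IsOpen U) (hx : x ∈ U) (h : ∀ y ∈ U, G y = G' y) :
    nablaBil G B x = nablaBil G' B x := by
  ext z v w
  rw [nablaBil_apply, nablaBil_apply, chris_congr hU hx h]

theorem codazzi_chart (hN : HasConstantCurvature (metricField N) c) (hψ : IsSmoothImmersion ψ)
    (hη : IsUnitNormal ψ η) (hx : x ∈ chartDom (m := 2) (n := 3) a b ψ) (u v w : E 2) :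
    nablaBil (coordMetric (inducedMetric ψ) a)
        (shapeForm (ambientMetric b) (chartRep a b ψ) (fieldRep a b η)) x u v w
      = nablaBil (coordMetric (inducedMetric ψ) a)
        (shapeForm (ambientMetric b) (chartRep a b ψ) (fieldRep a b η)) x v u w := by
  have hT := immOn_surface hψ a b
  rw [nablaBil_congr_metric hT.isOpen hx fun y hy => coordMetric_induced hψ hy]
  exact codazzi (metricOn_ambient b) hT (normalOn_fieldRep hψ.1 hη a b)
    (ambient_curvature hN (hT.mapsTo hx)) hx u v w

/-- The divergence of S₂ = -(f²/2) g + 2 f b is f df + 2 b(∇f, ·), and biconservativity makes it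
zero. -/
theorem secondForm_grad (hN : HasConstantCurvature (metricField N) c) (hψ : IsSmoothImmersion ψ)
    (hη : IsUnitNormal ψ η) (hbic : IsBiconservative ψ) (q : M) (z : E 2) : secondForm η q (gradM (inducedMetric ψ) (meanCurvature η) q) z
      = -(meanCurvature η q / 2) * dif (meanCurvature η) q z := by
  have hq := mem_chartDom_self (ψ := ψ) q
  have hH := metricOn_ambient (ψ q)
  have hT := immOn_surface hψ q (ψ q)
  have hν := normalOn_fieldRep hψ.1 hη q (ψ q)
  have df := (contMDiff_meanCurvature hψ hη q).mdifferentiableAt (by simp)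
  have h := divergence_codazzi (metricOn_induced hψ q (ψ q)) (smooth_shapeForm hH hT hν) hq
    (fun y hy => shapeForm_symm hH hT hν hy) (codazzi_chart hN hψ hη hq)
    (f := fun y => meanCurvature η ((extChartAt (𝓡 2) q).symm y))
    (fun y hy => meanCurvature_chart hψ hη hy)
    (S := fun y v w => stressBienergy ψ ((extChartAt (𝓡 2) q).symm y) (coordFrame q y v)
      (coordFrame q y w))
    (fun y hy v w => by
      rw [secondForm_transition hψ.1 hη.1 hy, coordMetric_apply]
      exact stressBienergy_eq hψ hη _ _ _) z
  have h0 := h.symm.trans (hbic q z)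
  rw [gradE_self df, fderiv_chartFun_self df, extChartAt_to_inv] at h0
  have h1 : secondForm η q (gradM (inducedMetric ψ) (meanCurvature η) q) z
      = shapeForm (ambientMetric (ψ q)) (chartRep q (ψ q) ψ) (fieldRep q (ψ q) η)
        (extChartAt (𝓡 2) q q) (gradM (inducedMetric ψ) (meanCurvature η) q) z := rfl
  rw [h1]
  linarith

/-- A biconservative surface in a space form, in charts. -/
theorem biconsOn_chart (hN : HasConstantCurvature (metricField N) c) (hψ : IsSmoothImmersion ψ)
    (hη : IsUnitNormal ψ η) (hbic : IsBiconservative ψ) (hf : ∀ q, 0 < meanCurvature η q)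
    (hgrad : ∀ q, dif (m := 2) (meanCurvature η) q ≠ 0) (a : M) (b : N) :
    BiconsOn c (coordMetric (inducedMetric ψ) a)
      (shapeForm (ambientMetric b) (chartRep a b ψ) (fieldRep a b η))
      (fun x => meanCurvature η ((extChartAt (𝓡 2) a).symm x))
      (chartDom (m := 2) (n := 3) a b ψ) := by
  have hH := metricOn_ambient b
  have hT := immOn_surface hψ a b
  have hν := normalOn_fieldRep hψ.1 hη a b
  have df : ∀ q, MDifferentiableAt (𝓡 2) 𝓘(ℝ, ℝ) (meanCurvature η) q := fun q =>
    (contMDiff_meanCurvature hψ hη q).mdifferentiableAt (by simp)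
  refine ⟨metricOn_induced hψ a b, smooth_shapeForm hH hT hν,
    fun x hx => shapeForm_symm hH hT hν hx, fun x hx => codazzi_chart hN hψ hη hx,
    fun x hx u v => ?_, fun x hx => meanCurvature_chart hψ hη hx, fun x _ => hf _,
    fun x hx h0 => hgrad ((extChartAt (𝓡 2) a).symm x) ?_, fun x hx z => ?_⟩
  · have hK : gaussK (coordMetric (inducedMetric ψ) a) x
        = gaussK (pull (ambientMetric b) (chartRep a b ψ)) x :=
      coordSectional_congr hT.isOpen hx (fun y hy => coordMetric_induced hψ hy) _ _
    rw [hK, coordMetric_induced hψ hx]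
    exact gaussK_hypersurface hH hT hν (ambient_curvature hN (hT.mapsTo hx)) hx u v
  · ext v
    obtain ⟨w, rfl⟩ := (frameEquiv hx.1).surjective v
    rw [frameEquiv_apply, ← fderiv_chartFun hx.1 (df _), h0]
    rfl
  · rw [secondForm_transition hψ.1 hη.1 hx, coordFrame_gradE hx.1 (isInner_induced hψ _) (df _),
      secondForm_grad hN hψ hη hbic, fderiv_chartFun hx.1 (df _)]

end Biconservative

/-! ### Conformal metrics on surfaces -/

section Conformal

variable {M : Type*} [TopologicalSpace M] [ChartedSpace (E 2) M] [IsManifold (𝓡 2) ∞ M]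
  {g : BilField 2 M} {V : Set M} {ρ : M → ℝ}

omit [IsManifold (𝓡 2) ∞ M] in
theorem coordMetric_conformal (ρ : M → ℝ) (g : BilField 2 M) (a : M) (x : E 2) :
    coordMetric (conformal ρ g) a x = ρ ((extChartAt (𝓡 2) a).symm x) • coordMetric g a x := rfl

omit [IsManifold (𝓡 2) ∞ M] in
theorem SmoothMetricOn.mono {W : Set M} (hg : SmoothMetricOn g V) (hW : IsOpen W) (h : W ⊆ V) :
    SmoothMetricOn g W := fun a =>
  (hg a).mono (isOpen_chartPre a hW) fun _ hx => ⟨hx.1, h hx.2⟩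

omit [IsManifold (𝓡 2) ∞ M] in
theorem coordMetric_conformal_eq (hpos : ∀ q ∈ V, 0 < ρ q) (g : BilField 2 M) (a : M) {x : E 2}
    (hx : x ∈ chartPre 2 a V) : coordMetric (conformal ρ g) a x
      = Real.exp (2 * (1 / 2 * Real.log (ρ ((extChartAt (𝓡 2) a).symm x)))) • coordMetric g a x := by
  rw [coordMetric_conformal, ← mul_assoc, mul_one_div_cancel two_ne_zero, one_mul,
    Real.exp_log (hpos _ hx.2)]

theorem smooth_logFactor (hpos : ∀ q ∈ V, 0 < ρ q) (hρ : ContMDiffOn (𝓡 2) 𝓘(ℝ, ℝ) ∞ ρ V)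
    (a : M) : ContDiffOn ℝ ∞ (fun x => 1 / 2 * Real.log (ρ ((extChartAt (𝓡 2) a).symm x)))
      (chartPre 2 a V) :=
  contDiffOn_const.mul ((smooth_chartFun hρ a).log fun _ hx => (hpos _ hx.2).ne')

theorem SmoothMetricOn.conformal (hg : SmoothMetricOn g V) (hpos : ∀ q ∈ V, 0 < ρ q)
    (hρ : ContMDiffOn (𝓡 2) 𝓘(ℝ, ℝ) ∞ ρ V) : SmoothMetricOn (conformal ρ g) V := fun a =>
  (metricOn_exp (hg a) (smooth_logFactor hpos hρ a)).congr
    fun _ hy => coordMetric_conformal_eq hpos g a hy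

/-- The Gaussian curvature of a conformal metric. -/
theorem gaussCurvature_conformal (hg : SmoothMetricOn g V) (hpos : ∀ q ∈ V, 0 < ρ q)
    (hρ : ContMDiffOn (𝓡 2) 𝓘(ℝ, ℝ) ∞ ρ V) {p : M} (hp : p ∈ V) :
    gaussCurvature (conformal ρ g) p = (ρ p)⁻¹ * (gaussCurvature g p
      + laplacian g (fun q => 1 / 2 * Real.log (ρ q)) p) := by
  have hx := mem_chartPre (mem_extChartAt_source (I := 𝓡 2) p) hp
  have h1 : gaussCurvature (RiemSurf.conformal ρ g) p
      = gaussK (fun x => Real.exp (2 * (1 / 2 * Real.log (ρ ((extChartAt (𝓡 2) p).symm x))))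
        • coordMetric g p x) (extChartAt (𝓡 2) p p) :=
    coordSectional_congr (hg p).isOpen hx (fun y hy => coordMetric_conformal_eq hpos g p hy) _ _
  rw [h1, gaussK_exp (hg p) (smooth_logFactor hpos hρ p) hx, lapE_chart, ← mul_assoc 2,
    mul_one_div_cancel two_ne_zero, one_mul, extChartAt_to_inv, Real.exp_neg,
    Real.exp_log (hpos p hp)]
  rfl

theorem contMDiffOn_gaussCurvature (hg : SmoothMetricOn g V) :
    ContMDiffOn (𝓡 2) 𝓘(ℝ, ℝ) ∞ (gaussCurvature g) V := fun q hq => by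
  refine (contMDiffAt_of_chart (hg q).isOpen (mem_extChartAt_source q)
    (mem_chartPre (mem_extChartAt_source q) hq) ?_).contMDiffWithinAt
  refine (smooth_gaussK (hg q)).congr fun x hx => ?_
  rw [gaussCurvature_eq hg ((extChartAt (𝓡 2) q).map_target hx.1) hx.2,
    (extChartAt (𝓡 2) q).right_inv hx.1]

omit [IsManifold (𝓡 2) ∞ M] in
theorem laplacian_congr {u u' : M → ℝ} (hV : IsOpen V) (h : ∀ q ∈ V, u q = u' q) {p : M}
    (hp : p ∈ V) : laplacian g u p = laplacian g u' p := by
  rw [lapE_chart, lapE_chart]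
  exact lapE_congr (isOpen_chartPre p hV) (mem_chartPre (mem_extChartAt_source p) hp)
    fun y hy => h _ hy.2

end Conformal

/-! ### Smooth solutions of ordinary differential equations -/

section ODE

/-- Bootstrapping: if α is of class Cⁿ, then so is its derivative X ∘ α, so α is of class Cⁿ⁺¹. -/
theorem contDiffOn_of_hasDerivAt {F : Type*} [NormedAddCommGroup F] [NormedSpace ℝ F] {X : F → F}
    {D : Set F} (hX : ContDiffOn ℝ ∞ X D) {α : ℝ → F} {I : Set ℝ} (hI : IsOpen I)
    (hm : MapsTo α I D) (hα : ∀ t ∈ I, HasDerivAt α (X (α t)) t) : ContDiffOn ℝ ∞ α I := by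
  rw [contDiffOn_infty]
  intro n
  induction n with
  | zero =>
    rw [Nat.cast_zero, contDiffOn_zero]
    exact fun t ht => (hα t ht).continuousAt.continuousWithinAt
  | succ n ih =>
    rw [Nat.cast_succ, contDiffOn_succ_iff_deriv_of_isOpen hI]
    refine ⟨fun t ht => (hα t ht).differentiableAt.differentiableWithinAt,
      fun h => absurd h (by simp), ?_⟩
    exact ((hX.of_le (by exact_mod_cast le_top)).comp ih hm).congr fun t ht => (hα t ht).deriv

/-- Second order equations with smooth right-hand side have smooth local solutions. -/
theorem exists_smooth_solution {F : ℝ × ℝ × ℝ → ℝ} {D : Set (ℝ × ℝ × ℝ)} (hD : IsOpen D)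
    (hF : ContDiffOn ℝ ∞ F D) {t₀ y₀ z₀ : ℝ} (h₀ : (t₀, y₀, z₀) ∈ D) :
    ∃ ε > 0, ∃ Φ : ℝ → ℝ, ContDiffOn ℝ ∞ Φ (Ioo (t₀ - ε) (t₀ + ε)) ∧
      ∀ t ∈ Ioo (t₀ - ε) (t₀ + ε), deriv (deriv Φ) t = F (t, Φ t, deriv Φ t) := by
  -- The equation as an autonomous first order system for (t, Φ, Φ'), with time as the first
  -- component.
  set X : ℝ × ℝ × ℝ → ℝ × ℝ × ℝ := fun p => (1, p.2.2, F p) with hXd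
  have hX : ContDiffOn ℝ ∞ X D := contDiffOn_const.prodMk
    ((contDiff_snd.comp contDiff_snd).contDiffOn.prodMk hF)
  have hX1 : ContDiffAt ℝ 1 X (t₀, y₀, z₀) :=
    (hX.contDiffAt (hD.mem_nhds h₀)).of_le (by exact_mod_cast le_top)
  obtain ⟨α, hα0, ε₁, hε₁, hα⟩ :=
    ContDiffAt.exists_forall_mem_closedBall_exists_eq_forall_mem_Ioo_hasDerivAt₀ hX1 t₀
  have hα_cont : ContinuousAt α t₀ := (hα t₀ ⟨by linarith, by linarith⟩).continuousAt
  have hnhds : α ⁻¹' D ∈ 𝓝 t₀ := hα_cont.preimage_mem_nhds (hD.mem_nhds (by rwa [hα0]))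
  obtain ⟨ε₂, hε₂, hball⟩ := Metric.mem_nhds_iff.1 hnhds
  refine ⟨min ε₁ ε₂, lt_min hε₁ hε₂, fun t => (α t).2.1, ?_⟩
  set I := Ioo (t₀ - min ε₁ ε₂) (t₀ + min ε₁ ε₂) with hI
  have hI1 : ∀ t ∈ I, HasDerivAt α (X (α t)) t := fun t ht => hα t
    ⟨by linarith [ht.1, min_le_left ε₁ ε₂], by linarith [ht.2, min_le_left ε₁ ε₂]⟩
  have hm : MapsTo α I D := fun t ht => hball (by
    rw [Real.ball_eq_Ioo]
    exact ⟨by linarith [ht.1, min_le_right ε₁ ε₂], by linarith [ht.2, min_le_right ε₁ ε₂]⟩)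
  have sα := contDiffOn_of_hasDerivAt hX isOpen_Ioo hm hI1
  have d1 : ∀ t ∈ I, HasDerivAt (fun t => (α t).1) 1 t := fun t ht => (hI1 t ht).fst
  have d2 : ∀ t ∈ I, HasDerivAt (fun t => (α t).2.1) (α t).2.2 t := fun t ht =>
    (hI1 t ht).snd.fst
  have d3 : ∀ t ∈ I, HasDerivAt (fun t => (α t).2.2) (F (α t)) t := fun t ht =>
    (hI1 t ht).snd.snd
  have h0I : t₀ ∈ I := ⟨by linarith [lt_min hε₁ hε₂], by linarith [lt_min hε₁ hε₂]⟩
  -- The first component has derivative 1 and the value t₀ at t₀, so it is the time.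
  have e1 : ∀ t ∈ I, (α t).1 = t := by
    have hc : ∀ t ∈ I, fderivWithin ℝ (fun t => (α t).1 - t) I t = 0 := fun t ht => by
      have := (((d1 t ht).sub (hasDerivAt_id t)).hasFDerivAt.hasFDerivWithinAt
        (s := I)).fderivWithin (isOpen_Ioo.uniqueDiffWithinAt ht)
      refine this.trans ?_
      ext
      simp
    intro t ht
    have : (α t).1 - t = (α t₀).1 - t₀ := (convex_Ioo _ _).is_const_of_fderivWithin_eq_zero (𝕜 := ℝ)
      (fun t ht => ((d1 t ht).sub (hasDerivAt_id t)).differentiableAt.differentiableWithinAt)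
      hc ht h0I
    rw [hα0, sub_self] at this
    exact sub_eq_zero.1 this
  refine ⟨(contDiff_fst.comp contDiff_snd).comp_contDiffOn sα, fun t ht => ?_⟩
  have e2 : deriv (fun t => (α t).2.1) =ᶠ[𝓝 t] fun t => (α t).2.2 := by
    filter_upwards [isOpen_Ioo.mem_nhds ht] with s hs using (d2 s hs).deriv
  rw [e2.deriv_eq, (d3 t ht).deriv, (d2 t ht).deriv]
  congr 1
  ext <;> simp [e1 t ht]

end ODE

/-! ### The Laplacian on a manifold -/

section Laplacian

variable {n : ℕ} {M : Type*} [TopologicalSpace M] [ChartedSpace (E n) M] [IsManifold (𝓡 n) ∞ M]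
  {g : BilField n M} {V : Set M} {u u' : M → ℝ} {p : M} {F : ℝ → ℝ} {O : Set ℝ}

omit [IsManifold (𝓡 n) ∞ M] in
theorem contMDiffOn_comp_real (hu : ContMDiffOn (𝓡 n) 𝓘(ℝ, ℝ) ∞ u V) (hF : ContDiffOn ℝ ∞ F O)
    (hm : MapsTo u V O) : ContMDiffOn (𝓡 n) 𝓘(ℝ, ℝ) ∞ (fun q => F (u q)) V :=
  hF.contMDiffOn.comp hu hm

omit [IsManifold (𝓡 n) ∞ M] in
theorem mdifferentiableAt_of_open (hV : IsOpen V) (hu : ContMDiffOn (𝓡 n) 𝓘(ℝ, ℝ) ∞ u V)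
    (hp : p ∈ V) : MDifferentiableAt (𝓡 n) 𝓘(ℝ, ℝ) u p :=
  (hu.contMDiffAt (hV.mem_nhds hp)).mdifferentiableAt (by simp)

theorem laplacian_add (hg : SmoothMetricOn g V) (hp : p ∈ V)
    (hu : ContMDiffOn (𝓡 n) 𝓘(ℝ, ℝ) ∞ u V) (hu' : ContMDiffOn (𝓡 n) 𝓘(ℝ, ℝ) ∞ u' V) :
    laplacian g (fun q => u q + u' q) p = laplacian g u p + laplacian g u' p := by
  rw [lapE_chart, lapE_chart, lapE_chart]
  exact lapE_add (hg p) (mem_chartPre (mem_extChartAt_source p) hp) (smooth_chartFun hu p)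
    (smooth_chartFun hu' p)

theorem laplacian_mul (hg : SmoothMetricOn g V) (hV : IsOpen V) (hp : p ∈ V)
    (hu : ContMDiffOn (𝓡 n) 𝓘(ℝ, ℝ) ∞ u V) (hu' : ContMDiffOn (𝓡 n) 𝓘(ℝ, ℝ) ∞ u' V) :
    laplacian g (fun q => u q * u' q) p = u p * laplacian g u' p + u' p * laplacian g u p
      - 2 * g.toBil p (gradM g u p) (gradM g u' p) := by
  rw [lapE_chart, lapE_chart, lapE_chart, lapE_mul (hg p)
    (mem_chartPre (mem_extChartAt_source p) hp) (smooth_chartFun hu p) (smooth_chartFun hu' p),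
    gradE_self (mdifferentiableAt_of_open hV hu hp),
    gradE_self (mdifferentiableAt_of_open hV hu' hp), coordMetric_self, extChartAt_to_inv]

theorem laplacian_comp (hg : SmoothMetricOn g V) (hV : IsOpen V) (hp : p ∈ V)
    (hu : ContMDiffOn (𝓡 n) 𝓘(ℝ, ℝ) ∞ u V) (hO : IsOpen O) (hF : ContDiffOn ℝ ∞ F O)
    (hm : MapsTo u V O) : laplacian g (fun q => F (u q)) p = deriv F (u p) * laplacian g u p
      - deriv (deriv F) (u p) * g.toBil p (gradM g u p) (gradM g u p) := by
  rw [lapE_chart, lapE_chart, lapE_comp (hg p) (mem_chartPre (mem_extChartAt_source p) hp)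
    (smooth_chartFun hu p) hO hF (fun x hx => hm hx.2),
    gradE_self (mdifferentiableAt_of_open hV hu hp), coordMetric_self, extChartAt_to_inv]

theorem dif_comp (hV : IsOpen V) (hp : p ∈ V) (hu : ContMDiffOn (𝓡 n) 𝓘(ℝ, ℝ) ∞ u V)
    (hO : IsOpen O) (hF : ContDiffOn ℝ ∞ F O) (hm : MapsTo u V O) :
    dif (m := n) (fun q => F (u q)) p = deriv F (u p) • dif u p := by
  rw [← fderiv_chartFun_self (mdifferentiableAt_of_open hV hu hp), ← fderiv_chartFun_self
    (mdifferentiableAt_of_open hV (contMDiffOn_comp_real hu hF hm) hp),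
    fderiv_comp_real (isOpen_chartPre p hV) (smooth_chartFun hu p) hO hF (fun x hx => hm hx.2)
      (mem_chartPre (mem_extChartAt_source p) hp), extChartAt_to_inv]

end Laplacian

/-! ### The intrinsic equations of a biconservative surface -/

section Intrinsic

/-- A surface with the intrinsic properties of the biconservative surfaces in a space form of
curvature `c`, in terms of the mean curvature function `f`. -/
structure BiconsSurface {M : Type*} [TopologicalSpace M] [ChartedSpace (E 2) M] (c : ℝ)
    (g : BilField 2 M) (f : M → ℝ) : Prop where
  metric : SmoothMetricOn g univ
  inner : ∀ p, IsInner (g.toBil p)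
  smooth : ContMDiff (𝓡 2) 𝓘(ℝ, ℝ) ∞ f
  pos : ∀ p, 0 < f p
  dif_ne : ∀ p, dif (m := 2) f p ≠ 0
  curvature_eq : ∀ p, gaussCurvature g p = c - 3 / 4 * f p ^ 2
  laplacian_eq : ∀ p, laplacian g f p = -(g.toBil p (gradM g f p) (gradM g f p) / f p)
    - 4 / 3 * ((c - 3 / 4 * f p ^ 2) * f p)
  first_integral : ∀ p₀, ∃ V : Set M, IsOpen V ∧ p₀ ∈ V ∧ ∃ C : ℝ, ∀ q ∈ V,
    (9 / 16 * g.toBil q (gradM g f q) (gradM g f q) + c * f q ^ 2 + 9 / 4 * f q ^ 4)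
      * f q ^ (-(7 / 2) : ℝ) = C

theorem biconsSurface_induced
    {M : Type*} [TopologicalSpace M] [ChartedSpace (E 2) M] [IsManifold (𝓡 2) ∞ M]
    {N : Type*} [TopologicalSpace N] [ChartedSpace (E 3) N] [IsManifold (𝓡 3) ∞ N]
    [RiemannianBundle (fun x : N => TangentSpace (𝓡 3) x)]
    [IsContMDiffRiemannianBundle (𝓡 3) ∞ (E 3) (fun x : N => TangentSpace (𝓡 3) x)]
    {ψ : M → N} {η : FieldAlong ψ} {c : ℝ} (hN : HasConstantCurvature (metricField N) c)
    (hψ : IsSmoothImmersion ψ) (hη : IsUnitNormal ψ η) (hbic : IsBiconservative ψ)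
    (hf : ∀ q, 0 < meanCurvature η q) (hgrad : ∀ q, dif (m := 2) (meanCurvature η) q ≠ 0) :
    BiconsSurface c (inducedMetric ψ) (meanCurvature η) := by
  have hB := fun q : M => biconsOn_chart hN hψ hη hbic hf hgrad q (ψ q)
  have hs := contMDiff_meanCurvature hψ hη
  have df : ∀ q, MDifferentiableAt (𝓡 2) 𝓘(ℝ, ℝ) (meanCurvature η) q := fun q =>
    (hs q).mdifferentiableAt (by simp)
  refine ⟨smoothMetricOn_induced hψ, isInner_induced hψ, hs, hf, hgrad, fun p => ?_, fun p => ?_,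
    fun p => ?_⟩
  · have h := (hB p).gaussK_eq (mem_chartDom_self p)
    rwa [extChartAt_to_inv] at h
  · have h := (hB p).lapE_f (mem_chartDom_self p)
    rwa [gradSq, gradE_self (df p), coordMetric_self, extChartAt_to_inv, ← lapE_chart] at h
  · have hU := (hB p).metric.isOpen
    -- The first integral has zero derivative, hence is constant on a ball in the chart; its value C
    -- may depend on the ball.
    obtain ⟨ε, hε, hball⟩ := Metric.isOpen_iff.1 hU _ (mem_chartDom_self p)
    obtain ⟨C, hC⟩ := Metric.isOpen_ball.exists_is_const_of_fderiv_eq_zero (𝕜 := ℝ)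
      (convex_ball (extChartAt (𝓡 2) p p) ε).isPreconnected
      (f := fun y => (9 / 16 * gradSq (coordMetric (inducedMetric ψ) p)
          (fun x => meanCurvature η ((extChartAt (𝓡 2) p).symm x)) y
        + c * meanCurvature η ((extChartAt (𝓡 2) p).symm y) ^ 2
        + 9 / 4 * meanCurvature η ((extChartAt (𝓡 2) p).symm y) ^ 4)
        * meanCurvature η ((extChartAt (𝓡 2) p).symm y) ^ (-(7 / 2) : ℝ))
      (fun z hz => by
        have h1 := smooth_diffAt (smooth_gradSq (hB p).metric (hB p).smooth_f) hU (hball hz)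
        have h2 := smooth_diffAt (hB p).smooth_f hU (hball hz)
        exact ((((h1.const_mul _).add ((h2.pow 2).const_mul c)).add
          ((h2.pow 4).const_mul _)).mul
          (h2.rpow_const (Or.inl ((hB p).pos z (hball hz)).ne'))).differentiableWithinAt)
      (fun z hz => (hB p).fderiv_first_integral (hball hz))
    refine ⟨(extChartAt (𝓡 2) p).source ∩ extChartAt (𝓡 2) p ⁻¹' Metric.ball _ ε,
      (continuousOn_extChartAt p).isOpen_inter_preimage (isOpen_extChartAt_source p)
        Metric.isOpen_ball, ⟨mem_extChartAt_source p, Metric.mem_ball_self hε⟩, C,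
      fun q hq => ?_⟩
    have h := hC _ hq.2
    rwa [gradSq_chart (hball hq.2).1 (isInner_induced hψ _) (df _),
      (extChartAt (𝓡 2) p).left_inv hq.1] at h

end Intrinsic

/-! ### Powers of `c - K` -/

section Powers

theorem smooth_logSq (k : ℝ) :
    ContDiffOn ℝ ∞ (fun t : ℝ => k * Real.log (3 / 4 * t ^ 2)) (Ioi 0) :=
  contDiffOn_const.mul (ContDiffOn.log (by fun_prop) fun t ht => by
    have : 0 < t := ht
    positivity)

theorem deriv_logSq (k : ℝ) {t : ℝ} (ht : 0 < t) :
    deriv (fun t : ℝ => k * Real.log (3 / 4 * t ^ 2)) t = 2 * k * t⁻¹ := by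
  have h := ((((hasDerivAt_id t).pow 2).const_mul (3 / 4)).log (by simp; positivity)).const_mul k
  refine (HasDerivAt.deriv h).trans ?_
  simp
  field_simp

theorem deriv_deriv_logSq (k : ℝ) {t : ℝ} (ht : 0 < t) :
    deriv (deriv fun t : ℝ => k * Real.log (3 / 4 * t ^ 2)) t = -(2 * k * (t ^ 2)⁻¹) := by
  have h : deriv (fun t : ℝ => k * Real.log (3 / 4 * t ^ 2)) =ᶠ[𝓝 t] fun t => 2 * k * t⁻¹ := by
    filter_upwards [Ioi_mem_nhds ht] with s hs using deriv_logSq k hs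
  rw [h.deriv_eq, ((hasDerivAt_inv ht.ne').const_mul (2 * k)).deriv]
  ring

variable {M : Type*} [TopologicalSpace M] [ChartedSpace (E 2) M] [IsManifold (𝓡 2) ∞ M]
  {c : ℝ} {g : BilField 2 M} {f r : M → ℝ} {V : Set M} {p : M}

namespace BiconsSurface

variable (h : BiconsSurface c g f)
include h

omit [IsManifold (𝓡 2) ∞ M] in
theorem sub_curvature (q : M) : c - gaussCurvature g q = 3 / 4 * f q ^ 2 := by
  rw [h.curvature_eq]; ring

omit [IsManifold (𝓡 2) ∞ M] in
theorem sub_curvature_pos (q : M) : 0 < c - gaussCurvature g q := by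
  have := h.pos q
  rw [h.sub_curvature]; positivity

omit [IsManifold (𝓡 2) ∞ M] in
theorem power_eq (r : M → ℝ) (q : M) : (c - gaussCurvature g q) ^ r q
    = Real.exp (r q * Real.log (3 / 4 * f q ^ 2)) := by
  rw [Real.rpow_def_of_pos (h.sub_curvature_pos q), h.sub_curvature, mul_comm]

omit [IsManifold (𝓡 2) ∞ M] in
theorem smooth_log (k : ℝ) :
    ContMDiffOn (𝓡 2) 𝓘(ℝ, ℝ) ∞ (fun q => k * Real.log (3 / 4 * f q ^ 2)) univ :=
  contMDiffOn_comp_real (F := fun t => k * Real.log (3 / 4 * t ^ 2)) h.smooth.contMDiffOn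
    (smooth_logSq k) fun q _ => h.pos q

/-- In Δ log f = Δf/f + |∇f|²/f² the gradient terms cancel, leaving -(4/3) K. For k = 3/8 the result
is -K, which says that (c - K)^{3/4} g is flat. -/
theorem laplacian_log (k : ℝ) (p : M) :
    laplacian g (fun q => k * Real.log (3 / 4 * f q ^ 2)) p
      = -(8 / 3 * k * gaussCurvature g p) := by
  have fp := h.pos p
  rw [laplacian_comp h.metric isOpen_univ (mem_univ p) h.smooth.contMDiffOn isOpen_Ioi
    (smooth_logSq k) (fun q _ => h.pos q), deriv_logSq k fp, deriv_deriv_logSq k fp,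
    h.laplacian_eq, h.curvature_eq]
  field_simp
  ring

theorem gradM_log (p : M) : gradM g (fun q => 1 / 2 * Real.log (3 / 4 * f q ^ 2)) p
    = -(1 / 2 * (c - gaussCurvature g p)⁻¹) • gradM g (gaussCurvature g) p := by
  have fp := h.pos p
  have hK : gaussCurvature g = fun q => (fun t : ℝ => c - 3 / 4 * t ^ 2) (f q) :=
    funext h.curvature_eq
  have hd : deriv (fun t : ℝ => c - 3 / 4 * t ^ 2) (f p) = -(3 / 2 * f p) := by
    have := (((hasDerivAt_id (f p)).pow 2).const_mul (3 / 4)).const_sub c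
    refine (HasDerivAt.deriv this).trans ?_
    simp
    ring
  rw [h.sub_curvature, gradM, gradM, hK, dif_comp isOpen_univ (mem_univ p) h.smooth.contMDiffOn
    isOpen_Ioi (smooth_logSq (1 / 2)) (fun q _ => h.pos q),
    dif_comp (F := fun t : ℝ => c - 3 / 4 * t ^ 2) isOpen_univ (mem_univ p)
    h.smooth.contMDiffOn isOpen_univ (by fun_prop) (mapsTo_univ _ _), deriv_logSq _ fp, hd,
    map_smul, map_smul, smul_smul]
  congr 1
  field_simp
  ring

omit [IsManifold (𝓡 2) ∞ M] in
theorem smooth_power (hr : ContMDiffOn (𝓡 2) 𝓘(ℝ, ℝ) ∞ r V) :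
    ContMDiffOn (𝓡 2) 𝓘(ℝ, ℝ) ∞ (fun q => (c - gaussCurvature g q) ^ r q) V := by
  have h1 := contMDiffOn_comp_real (hr.mul ((h.smooth_log 1).mono (subset_univ V)))
    (Real.contDiff_exp.contDiffOn (s := univ)) (mapsTo_univ _ _)
  refine h1.congr fun q _ => ?_
  rw [h.power_eq, Pi.mul_apply, one_mul]

omit [IsManifold (𝓡 2) ∞ M] in
theorem power_pos (r : M → ℝ) (q : M) : 0 < (c - gaussCurvature g q) ^ r q :=
  Real.rpow_pos_of_pos (h.sub_curvature_pos q) _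

theorem smoothMetricOn_power (hV : IsOpen V) (hr : ContMDiffOn (𝓡 2) 𝓘(ℝ, ℝ) ∞ r V) :
    SmoothMetricOn (powerMetric c g r) V :=
  (h.metric.mono hV (subset_univ V)).conformal (fun q _ => h.power_pos r q) (h.smooth_power hr)

theorem gaussCurvature_power (hV : IsOpen V) (hr : ContMDiffOn (𝓡 2) 𝓘(ℝ, ℝ) ∞ r V)
    (hp : p ∈ V) : gaussCurvature (powerMetric c g r) p = (c - gaussCurvature g p) ^ (-r p)
      * (gaussCurvature g p
        + laplacian g (fun q => r q * (1 / 2 * Real.log (3 / 4 * f q ^ 2))) p) := by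
  rw [powerMetric, gaussCurvature_conformal (h.metric.mono hV (subset_univ V))
    (fun q _ => h.power_pos r q) (h.smooth_power hr) hp, Real.rpow_neg (h.sub_curvature_pos p).le]
  congr 3
  funext q
  rw [h.power_eq, Real.log_exp]
  ring

/-- The product rule for Δ(r · ½ log(c - K)): the logarithm contributes -(4/3) r K, and the mixed
term gives the gradient of K because ∇ log(c - K) = -(c - K)⁻¹ ∇K. -/
theorem gaussCurvature_power_eq (hV : IsOpen V) (hr : ContMDiffOn (𝓡 2) 𝓘(ℝ, ℝ) ∞ r V)
    (hp : p ∈ V) : gaussCurvature (powerMetric c g r) p = (c - gaussCurvature g p) ^ (-r p) *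
      ((3 - 4 * r p) / 3 * gaussCurvature g p
        + 1 / 2 * Real.log (c - gaussCurvature g p) * laplacian g r p
        + (c - gaussCurvature g p)⁻¹
          * g.toBil p (gradM g r p) (gradM g (gaussCurvature g) p)) := by
  rw [h.gaussCurvature_power hV hr hp, laplacian_mul (h.metric.mono hV (subset_univ V)) hV hp hr
    ((h.smooth_log _).mono (subset_univ V)), h.laplacian_log, h.gradM_log, map_smul, smul_eq_mul,
    ← h.sub_curvature]
  ring

/-- The metric to be tested for flatness is again conformal to g. Half the logarithm of its factor
is the function under Δ in (*), so its curvature is a positive multiple of the left side of (*). -/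
theorem isRicciSurfaceOn_iff (hV : IsOpen V) (hr : ContMDiffOn (𝓡 2) 𝓘(ℝ, ℝ) ∞ r V)
    (hpos : ∀ q ∈ V, 0 < c - gaussCurvature (powerMetric c g r) q) :
    IsRicciSurfaceOn c (powerMetric c g r) V ↔ SolvesEquationOn c g r V := by
  have sm := h.smoothMetricOn_power hV hr
  set κ := gaussCurvature (powerMetric c g r) with hκ
  have s1 : ContMDiffOn (𝓡 2) 𝓘(ℝ, ℝ) ∞ (fun q => (c - κ q) ^ (1 / 2 : ℝ)) V :=
    contMDiffOn_comp_real (F := fun t => (c - t) ^ (1 / 2 : ℝ)) (O := {t | 0 < c - t})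
      (contMDiffOn_gaussCurvature sm)
      (ContDiffOn.rpow_const_of_ne (by fun_prop) fun t ht => (show 0 < c - t from ht).ne') hpos
  have p1 : ∀ q ∈ V, 0 < (c - κ q) ^ (1 / 2 : ℝ) := fun q hq => Real.rpow_pos_of_pos (hpos q hq) _
  have key : ∀ p ∈ V, gaussCurvature (conformal (fun q => (c - κ q) ^ (1 / 2 : ℝ))
      (powerMetric c g r)) p = ((c - κ p) ^ (1 / 2 : ℝ) * (c - gaussCurvature g p) ^ r p)⁻¹
      * (gaussCurvature g p + laplacian g (fun q => 1 / 4 * Real.log (c - κ q)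
        + r q / 2 * Real.log (c - gaussCurvature g q)) p) := fun p hp => by
    have e1 : conformal (fun q => (c - κ q) ^ (1 / 2 : ℝ)) (powerMetric c g r)
        = conformal (fun q => (c - κ q) ^ (1 / 2 : ℝ) * (c - gaussCurvature g q) ^ r q) g :=
      funext fun q => smul_smul _ _ _
    rw [e1, gaussCurvature_conformal (h.metric.mono hV (subset_univ V))
      (fun q hq => mul_pos (p1 q hq) (h.power_pos r q)) (s1.mul (h.smooth_power hr)) hp]
    congr 2
    refine laplacian_congr hV (fun q hq => ?_) hp
    rw [Real.log_mul (p1 q hq).ne' (h.power_pos r q).ne', Real.log_rpow (hpos q hq),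
      Real.log_rpow (h.sub_curvature_pos q)]
    ring
  constructor
  · intro hR p hp
    have h0 := hR.2 p hp
    rw [key p hp] at h0
    exact (mul_eq_zero.1 h0).resolve_left
      (inv_ne_zero (mul_pos (p1 p hp) (h.power_pos r p)).ne')
  · refine fun hS => ⟨hpos, fun p hp => ?_⟩
    rw [key p hp, hS p hp, mul_zero]

end BiconsSurface

end Powers

/-! ### Ricci metrics in the conformal class of a biconservative surface -/

section Existence

variable {M : Type*} [TopologicalSpace M] [ChartedSpace (E 2) M] [IsManifold (𝓡 2) ∞ M]
  {c : ℝ} {g : BilField 2 M} {f : M → ℝ}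

/-- The squared norm of `∇f` as a function of `f`, where `C` is the value of the first integral. -/
def gradSqFun (c C t : ℝ) : ℝ := 16 / 9 * (C * t ^ (7 / 2 : ℝ) - c * t ^ 2 - 9 / 4 * t ^ 4)

/-- The Laplacian of `f` as a function of `f`. -/
def laplacianFun (c C t : ℝ) : ℝ := -(gradSqFun c C t / t) - 4 / 3 * ((c - 3 / 4 * t ^ 2) * t)

theorem smooth_gradSqFun (c C : ℝ) : ContDiffOn ℝ ∞ (gradSqFun c C) (Ioi 0) := by
  have h : ContDiffOn ℝ ∞ (fun t : ℝ => t ^ (7 / 2 : ℝ)) (Ioi 0) :=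
    contDiffOn_id.rpow_const_of_ne fun t ht => (show 0 < t from ht).ne'
  exact contDiffOn_const.mul (((contDiffOn_const.mul h).sub (by fun_prop)).sub (by fun_prop))

theorem smooth_laplacianFun (c C : ℝ) : ContDiffOn ℝ ∞ (laplacianFun c C) (Ioi 0) :=
  (((smooth_gradSqFun c C).div contDiffOn_id fun t ht => (show 0 < t from ht).ne').neg).sub
    (by fun_prop)

/-- The equation for the conformal factor. -/
theorem exists_conformal_factor (c C : ℝ) {t₀ : ℝ} (ht₀ : 0 < t₀) (hP : gradSqFun c C t₀ ≠ 0) :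
    ∃ ε > 0, ∃ Φ : ℝ → ℝ, ContDiffOn ℝ ∞ Φ (Ioo (t₀ - ε) (t₀ + ε)) ∧
      ∀ t ∈ Ioo (t₀ - ε) (t₀ + ε), deriv (deriv Φ) t = (laplacianFun c C t * deriv Φ t
        - (3 / 4 * t ^ 2) ^ (3 / 4 : ℝ) * (c * Real.exp (2 * Φ t) - Real.exp (-(2 * Φ t))))
        / gradSqFun c C t := by
  -- The equation is solved for Φ'', so the values of t must stay where |∇f|², as a function of t,
  -- is nonzero.
  set O : Set ℝ := Ioi 0 ∩ gradSqFun c C ⁻¹' {0}ᶜ with hO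
  have oO : IsOpen O := (smooth_gradSqFun c C).continuousOn.isOpen_inter_preimage isOpen_Ioi
    isOpen_compl_singleton
  set D : Set (ℝ × ℝ × ℝ) := Prod.fst ⁻¹' O with hD
  have s1 : ∀ {u : ℝ → ℝ}, ContDiffOn ℝ ∞ u (Ioi 0) →
      ContDiffOn ℝ ∞ (fun p : ℝ × ℝ × ℝ => u p.1) D := fun hu =>
    hu.comp contDiffOn_fst fun p hp => hp.1
  have s2 : ContDiffOn ℝ ∞ (fun t : ℝ => (3 / 4 * t ^ 2) ^ (3 / 4 : ℝ)) (Ioi 0) :=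
    ContDiffOn.rpow_const_of_ne (by fun_prop) fun t ht => by
      have : 0 < t := ht
      positivity
  -- Any initial values would do; Φ and Φ' are started at 0.
  refine exists_smooth_solution (D := D) (F := fun p => (laplacianFun c C p.1 * p.2.2
    - (3 / 4 * p.1 ^ 2) ^ (3 / 4 : ℝ) * (c * Real.exp (2 * p.2.1) - Real.exp (-(2 * p.2.1))))
    / gradSqFun c C p.1) (oO.preimage continuous_fst) ?_ (y₀ := 0) (z₀ := 0) ⟨ht₀, hP⟩
  refine ContDiffOn.div (((s1 (smooth_laplacianFun c C)).mul (by fun_prop)).sub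
    ((s1 s2).mul ?_)) (s1 (smooth_gradSqFun c C)) fun p hp => hp.2
  exact ContDiff.contDiffOn (by fun_prop)

namespace BiconsSurface

variable (h : BiconsSurface c g f)
include h

omit [IsManifold (𝓡 2) ∞ M] in
theorem exists_gradSq_eq (p₀ : M) : ∃ V : Set M, IsOpen V ∧ p₀ ∈ V ∧ ∃ C : ℝ, ∀ q ∈ V,
    g.toBil q (gradM g f q) (gradM g f q) = gradSqFun c C (f q) := by
  obtain ⟨V, hV, hp, C, hC⟩ := h.first_integral p₀
  refine ⟨V, hV, hp, C, fun q hq => ?_⟩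
  have fq := h.pos q
  have h1 : f q ^ (-(7 / 2) : ℝ) * f q ^ (7 / 2 : ℝ) = 1 := by
    rw [← Real.rpow_add fq]; norm_num
  rw [gradSqFun, ← hC q hq, mul_assoc _ (f q ^ (-(7 / 2) : ℝ)), h1]
  ring

omit [IsManifold (𝓡 2) ∞ M] in
theorem gradSq_pos (q : M) : 0 < g.toBil q (gradM g f q) (gradM g f q) :=
  (h.inner q).pos _ fun h0 => h.dif_ne q <| by
    ext v
    rw [← (h.inner q).apply_inverse (dif f q) v, ← gradM, h0, map_zero]

/-- The metrics `(c - K)^r g` with `r` a function of `f` solving an ordinary differential equation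
are Ricci metrics. -/
theorem exists_ricci {p₀ : M} (hp₀ : c - gaussCurvature g p₀ ≠ 1) :
    ∃ V : Set M, IsOpen V ∧ p₀ ∈ V ∧ V ⊆ {q | c - gaussCurvature g q ≠ 1} ∧
      ∃ r : M → ℝ, ContMDiffOn (𝓡 2) 𝓘(ℝ, ℝ) ∞ r V ∧
        (∀ p ∈ V, ∃ a : ℝ, dif (m := 2) r p = a • dif f p) ∧
        SolvesEquationOn c g r V ∧ IsRicciSurfaceOn c (powerMetric c g r) V := by
  obtain ⟨V₁, hV₁, hp₁, C, hC⟩ := h.exists_gradSq_eq p₀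
  obtain ⟨ε, hε, Φ, sΦ, hΦ⟩ := exists_conformal_factor c C (h.pos p₀)
    (by rw [← hC p₀ hp₁]; exact (h.gradSq_pos p₀).ne')
  set I := Ioo (f p₀ - ε) (f p₀ + ε) with hI
  -- The condition 3t²/4 ≠ 1 keeps log(c - K) away from zero, so that r can be obtained by division.
  set O : Set ℝ := I ∩ (Ioi 0 ∩ {t : ℝ | 3 / 4 * t ^ 2 ≠ 1}) with hOd
  have oO : IsOpen O := isOpen_Ioo.inter (isOpen_Ioi.inter
    (isOpen_ne_fun (by fun_prop) continuous_const))
  set V := V₁ ∩ f ⁻¹' O with hVd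
  have oV : IsOpen V := hV₁.inter (oO.preimage h.smooth.continuous)
  have hfV : MapsTo f V O := fun q hq => hq.2
  have hlog : ∀ t ∈ O, Real.log (3 / 4 * t ^ 2) ≠ 0 := fun t ht h0 => by
    have tpos : 0 < t := ht.2.1
    rcases Real.log_eq_zero.1 h0 with h1 | h1 | h1
    · have : 0 < 3 / 4 * t ^ 2 := by positivity
      exact this.ne' h1
    · exact ht.2.2 h1
    · nlinarith
  have sΦO : ContDiffOn ℝ ∞ Φ O := sΦ.mono inter_subset_left
  have sL : ∀ k : ℝ, ContDiffOn ℝ ∞ (fun t : ℝ => k * Real.log (3 / 4 * t ^ 2)) O := fun k =>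
    (smooth_logSq k).mono fun t ht => ht.2.1
  -- The exponent is chosen so that (c - K)^r = e^{2Φ} (c - K)^{3/4}.
  set R : ℝ → ℝ := fun t => (2 * Φ t + 3 / 4 * Real.log (3 / 4 * t ^ 2))
    / (1 * Real.log (3 / 4 * t ^ 2)) with hR
  have sR : ContDiffOn ℝ ∞ R O := ((contDiffOn_const.mul sΦO).add (sL _)).div (sL 1)
    fun t ht => by rw [one_mul]; exact hlog t ht
  have hf := h.smooth.contMDiffOn (s := V)
  have sr : ContMDiffOn (𝓡 2) 𝓘(ℝ, ℝ) ∞ (fun q => R (f q)) V := contMDiffOn_comp_real hf sR hfV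
  have hgV := h.metric.mono oV (subset_univ V)
  have hrL : ∀ q ∈ V, R (f q) * Real.log (3 / 4 * f q ^ 2)
      = 2 * Φ (f q) + 3 / 4 * Real.log (3 / 4 * f q ^ 2) := fun q hq => by
    have := hlog (f q) hq.2
    simp only [hR]
    rw [one_mul, div_mul_cancel₀ _ this]
  -- As (c - K)^{3/4} g is flat, the curvature of e^{2Φ} (c - K)^{3/4} g is e^{-2Φ} (c - K)^{-3/4}
  -- ΔΦ; the differential equation for Φ turns this into c - e^{-4Φ}.
  have hK : ∀ p ∈ V, gaussCurvature (powerMetric c g fun q => R (f q)) p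
      = c - Real.exp (-(4 * Φ (f p))) := fun p hp => by
    have fp := h.pos p
    have wp : 0 < 3 / 4 * f p ^ 2 := by positivity
    have hS := hC p hp.1
    have hS0 : gradSqFun c C (f p) ≠ 0 := by rw [← hS]; exact (h.gradSq_pos p).ne'
    have hΔ : laplacian g f p = laplacianFun c C (f p) := by
      rw [h.laplacian_eq, hS, laplacianFun]
    have e1 : laplacian g (fun q => R (f q) * (1 / 2 * Real.log (3 / 4 * f q ^ 2))) p
        = laplacian g (fun q => Φ (f q) + 3 / 8 * Real.log (3 / 4 * f q ^ 2)) p :=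
      laplacian_congr oV (fun q hq => by linear_combination 1 / 2 * hrL q hq) hp
    have e2 : laplacian g (fun q => Φ (f q)) p = (3 / 4 * f p ^ 2) ^ (3 / 4 : ℝ)
        * (c * Real.exp (2 * Φ (f p)) - Real.exp (-(2 * Φ (f p)))) := by
      rw [laplacian_comp hgV oV hp hf oO sΦO hfV, hS, hΔ, hΦ _ hp.2.1]
      field_simp
      ring
    have e3 : (c - gaussCurvature g p) ^ (-R (f p)) = Real.exp (-(2 * Φ (f p)))
        * ((3 / 4 * f p ^ 2) ^ (3 / 4 : ℝ))⁻¹ := by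
      rw [h.sub_curvature, Real.rpow_def_of_pos wp, Real.rpow_def_of_pos wp, ← Real.exp_neg,
        ← Real.exp_add]
      congr 1
      linear_combination -hrL p hp
    rw [h.gaussCurvature_power oV sr hp, e1, laplacian_add hgV hp
      (contMDiffOn_comp_real hf sΦO hfV) ((h.smooth_log _).mono (subset_univ V)), e2,
      h.laplacian_log, e3]
    have e4 : ((3 / 4 * f p ^ 2) ^ (3 / 4 : ℝ)) ≠ 0 := (Real.rpow_pos_of_pos wp _).ne'
    have e5 : Real.exp (-(2 * Φ (f p))) * Real.exp (2 * Φ (f p)) = 1 := by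
      rw [← Real.exp_add]; simp
    have e6 : Real.exp (-(4 * Φ (f p))) = Real.exp (-(2 * Φ (f p))) * Real.exp (-(2 * Φ (f p))) := by
      rw [← Real.exp_add]; congr 1; ring
    rw [e6]
    generalize (3 / 4 * f p ^ 2) ^ (3 / 4 : ℝ) = A at e4 ⊢
    have e7 : A⁻¹ * A = 1 := inv_mul_cancel₀ e4
    linear_combination (c * Real.exp (-(2 * Φ (f p))) * Real.exp (2 * Φ (f p))
      - Real.exp (-(2 * Φ (f p))) * Real.exp (-(2 * Φ (f p)))) * e7 + c * e5
  have hpos : ∀ q ∈ V, 0 < c - gaussCurvature (powerMetric c g fun q => R (f q)) q :=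
    fun q hq => by rw [hK q hq, sub_sub_cancel]; exact Real.exp_pos _
  -- Here ¼ log(c - K_r) = -Φ cancels the Φ in (r/2) log(c - K), leaving (3/8) log(c - K), whose
  -- Laplacian is -K.
  have hsol : SolvesEquationOn c g (fun q => R (f q)) V := fun p hp => by
    have e1 : laplacian g (fun q => 1 / 4 * Real.log (c - gaussCurvature (powerMetric c g
        fun q => R (f q)) q) + R (f q) / 2 * Real.log (c - gaussCurvature g q)) p
        = laplacian g (fun q => 3 / 8 * Real.log (3 / 4 * f q ^ 2)) p := by
      refine laplacian_congr oV (fun q hq => ?_) hp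
      rw [hK q hq, sub_sub_cancel, Real.log_exp, h.sub_curvature]
      linear_combination 1 / 2 * hrL q hq
    rw [e1, h.laplacian_log]
    ring
  refine ⟨V, oV, ⟨hp₁, ⟨by linarith, by linarith⟩, h.pos p₀, ?_⟩, fun q hq => ?_,
    fun q => R (f q), sr, fun p hp => ⟨_, dif_comp oV hp hf oO sR hfV⟩, hsol,
    (h.isRicciSurfaceOn_iff oV sr hpos).2 hsol⟩
  · rwa [mem_ofPred_eq, ← h.sub_curvature]
  · rw [mem_ofPred_eq, h.sub_curvature]
    exact hq.2.2.2

omit [IsManifold (𝓡 2) ∞ M] in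
theorem isOpen_curvature_ne : IsOpen {q | c - gaussCurvature g q ≠ 1} := by
  simp only [h.sub_curvature]
  exact isOpen_ne_fun (continuous_const.mul (h.smooth.continuous.pow 2)) continuous_const

/-- On an open set where c - K = 1 the function f > 0 is constant, which contradicts df ≠ 0. -/
theorem dense_curvature_ne : Dense {q | c - gaussCurvature g q ≠ 1} := by
  have hE : {q | c - gaussCurvature g q ≠ 1} = {q | c - gaussCurvature g q = 1}ᶜ := rfl
  rw [hE, ← interior_eq_empty_iff_dense_compl, eq_empty_iff_forall_notMem]
  intro p hp
  have hcst : ∀ q ∈ interior {q | c - gaussCurvature g q = 1}, f q = f p := fun q hq => by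
    have h1 : q ∈ {q | c - gaussCurvature g q = 1} := interior_subset hq
    have h2 : p ∈ {q | c - gaussCurvature g q = 1} := interior_subset hp
    rw [mem_ofPred_eq] at h1 h2
    rw [h.sub_curvature] at h1 h2
    have := h.pos q
    have := h.pos p
    nlinarith
  refine h.dif_ne p ?_
  rw [← fderiv_chartFun_self ((h.smooth p).mdifferentiableAt (by simp)),
    fderiv_congr_on (isOpen_chartPre p isOpen_interior)
      (mem_chartPre (mem_extChartAt_source p) hp) fun y hy => hcst _ hy.2]
  exact fderiv_const_apply _

end BiconsSurface

end Existence

end RiemSurf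

end

/-! ### The theorem for immersed biconservative surfaces -/

theorem mainTheorem2
    {N : Type*} [MetricSpace N] [ChartedSpace (E 3) N] [IsManifold (𝓡 3) ∞ N]
    [RiemannianBundle (fun x : N => TangentSpace (𝓡 3) x)]
    [IsContMDiffRiemannianBundle (𝓡 3) ∞ (E 3) (fun x : N => TangentSpace (𝓡 3) x)]
    [IsRiemannianManifold (𝓡 3) N] [CompleteSpace N] [SimplyConnectedSpace N]
    (c : ℝ) (hN : HasConstantCurvature (metricField N) c)
    {M : Type*} [TopologicalSpace M] [T2Space M] [SecondCountableTopology M] [ConnectedSpace M]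
    [ChartedSpace (E 2) M] [IsManifold (𝓡 2) ∞ M]
    (ψ : M → N) (hψ : IsSmoothImmersion ψ) (hbic : IsBiconservative ψ)
    (η : FieldAlong ψ) (hη : IsUnitNormal ψ η)
    (g : BilField 2 M) (hg : g = inducedMetric ψ)
    (K : M → ℝ) (hK : K = gaussCurvature g)
    (f : M → ℝ) (hf : f = meanCurvature η)
    (hfpos : ∀ p, 0 < f p) (hgrad : ∀ p, grad g f p ≠ 0) :
    (∀ p, 0 < c - K p) ∧
    (∀ (V : Set M) (r : M → ℝ), IsOpen V → ContMDiffOn (𝓡 2) 𝓘(ℝ, ℝ) ∞ r V →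
      (∀ p ∈ V, gaussCurvature (powerMetric c g r) p = (c - K p) ^ (-r p) *
        ((3 - 4 * r p) / 3 * K p + 1 / 2 * Real.log (c - K p) * laplacian g r p
          + (c - K p)⁻¹ * g p (grad g r p) (grad g K p))) ∧
      ((∀ p ∈ V, 0 < c - gaussCurvature (powerMetric c g r) p) →
        (IsRicciSurfaceOn c (powerMetric c g r) V ↔ SolvesEquationOn c g r V))) ∧
    ∃ W : Set M, IsOpen W ∧ Dense W ∧ ∀ p₀ ∈ W, ∃ V : Set M, IsOpen V ∧ p₀ ∈ V ∧ V ⊆ W ∧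
      ∃ r : M → ℝ, ContMDiffOn (𝓡 2) 𝓘(ℝ, ℝ) ∞ r V ∧
        (∀ p ∈ V, ∀ v : TangentSpace (𝓡 2) p,
          mvfderiv (𝓡 2) f p v = 0 → mvfderiv (𝓡 2) r p v = 0) ∧
        SolvesEquationOn c g r V ∧ IsRicciSurfaceOn c (powerMetric c g r) V := by
  subst hg hK hf
  have hdif : ∀ q, dif (m := 2) (meanCurvature η) q ≠ 0 := fun q h0 => hgrad q <| by
    change ((inducedMetric ψ).toBil q).inverse (dif (meanCurvature η) q) = 0
    rw [h0, map_zero]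
  have h := biconsSurface_induced hN hψ hη hbic hfpos hdif
  -- W is the set where c - K ≠ 1: elsewhere (c - K)^r = 1 for every r, so the value of r at such a
  -- point does not affect the metric there.
  refine ⟨h.sub_curvature_pos, fun V r hV hr =>
    ⟨fun p hp => h.gaussCurvature_power_eq hV hr hp, h.isRicciSurfaceOn_iff hV hr⟩,
    {q | c - gaussCurvature (inducedMetric ψ) q ≠ 1}, h.isOpen_curvature_ne,
    h.dense_curvature_ne, fun p₀ hp₀ => ?_⟩
  obtain ⟨V, hV, hpV, hVW, r, hr, hdr, hsol, hric⟩ := h.exists_ricci hp₀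
  refine ⟨V, hV, hpV, hVW, r, hr, fun p hp v hv => ?_, hsol, hric⟩
  obtain ⟨a, ha⟩ := hdr p hp
  refine (DFunLike.congr_fun ha v).trans ?_
  exact (congrArg (a * ·) hv).trans (mul_zero a)
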